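/- Let $n\ge 2$, $d=2n$, identify $\mathbb C^n=\mathbb R^d$, and let $S^{d-1}$ be the unit sphere with its surface measure. For $z\ne\zeta$ let $$B_j(z,\zeta)=\frac{\overline{\zeta_j-z_j}}{|\zeta-z|^{2n}},\qquad 1\le j\le n,$$ be the coefficients of the Bochner–Martinelli kernel. For an integer $N\ge1$ and $\zeta\neq0$ let $P_j^{N-1}(\cdot,\zeta)$ be the Taylor polynomial of degree $N-1$ (in the real variables) of $B_j(\cdot,\zeta)$ at the origin, and put, for $z,\zeta\ne0$, $$I_j^N(z,\zeta)=\Big(\frac{|\zeta|}{|z|}\Big)^N|\zeta|^{d-1}\big(B_j(z,\zeta)-P_j^{N-1}(z,\zeta)\big),\qquad I^N=c_n\sum_{j=1}^n I^N_j\,\widehat{d\bar\zeta_j},\quad c_n=\frac{(n-1)!}{(2\pi i)^n},$$ where $\widehat{d\bar\zeta_j}=d\zeta_j\wedge\bigwedge_{k\ne j}(d\bar\zeta_k\wedge d\zeta_k)$. Let $\psi(z,\zeta)$ be a real-valued function that is smooth where $\zeta\ne0$, equals $1$ if $|z-\zeta|>\frac1N|\zeta|$ and $0$ if $|z-\zeta|<\frac1{2N}|\zeta|$,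 and satisfies $|D^k\psi|\le A_k(|\zeta|/N)^{-k}$ for all $k\ge0$. Put $K_N=\psi I^N$ and, for $s,t>0$, $K_N^{s,t}(\xi,\eta)=K_N(s\xi,t\eta)$ for $\xi,\eta\in S^{d-1}$. A kernel $k=\sum_j k_j\,\widehat{d\bar\zeta_j}$ on $S^{d-1}\times S^{d-1}$ is identified with the operator $Tf(\xi)=\int_{S^{d-1}}\sum_j k_j(\xi,\eta)f_j(\eta)\,d\sigma(\eta)$ on functions $f=(f_1,\dots,f_n):S^{d-1}\to\mathbb C^n$ (coefficients of $(0,1)$-forms). For $\xi,\eta\in S^{d-1}$ let $\theta=\theta(\xi,\eta)\in[0,\pi]$ be the angle between them. For $\lambda\in(0,1)$ denote by $\chi^\lambda$ any smooth function $S^{d-1}\times S^{d-1}\to[0,1]$ that vanishes where $|\sin\theta|>100\lambda$, and by $\chi_\lambda$ any such function that vanishes where $|\sin\theta|<\lambda/100$ or $|\sin\theta|>100\lambda$, in both cases with $|D^k\chi|\le B_k\lambda^{-k}$ for all $k\ge0$. Here derivatives on the sphere are those of the extension that is homogeneous of degree $0$ in each variable. Let $1\le p\le 2$, let $p'$ be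 the conjugate exponent, and let $\frac1p-\frac1{p'}=\frac1q$ (so $1\le q\le\infty$). Then the following hold. (i) Fix $\mu\ge1$. If $\frac1{200}N^{-1/\mu}\le\lambda\le200N^{-1/\mu}$, then $\chi^\lambda K_N^{s,t}$ maps $L^p(S^{d-1})\to L^{p'}(S^{d-1})$ with norm at most $$C\,N^{\frac d{2\mu q}-\frac1{\mu q}}\,\lambda^{-\frac d{2q}+d-1-\mu(d-2)}\Big(\Big|1-\frac st\Big|+\lambda^\mu\Big)^{-1}.$$ (ii) If $\lambda\ge\frac1{200}N^{-1}$, then $\chi_\lambda K_N^{s,t}$ maps $L^p(S^{d-1})\to L^{p'}(S^{d-1})$ with norm at most $$C\,N^{\frac d{2q}-\frac1q}\,\lambda^{-\frac d{2q}}\Big(\Big|1-\frac st\Big|+\lambda\Big)^{-1}.$$ The constants $C$ depend only on $d$, $p$, the constants $(A_k)$, $(B_k)$ and, in (i), on the fixed $\mu$; they do not depend on $N,\lambda,s,t,\psi$ or the choice of the cutoffs. -/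

import Mathlib

open MeasureTheory
open scoped ENNReal ContDiff

noncomputable section

namespace BMKernel

/-- `ℂⁿ = ℝᵈ`, `d = 2n`, with its Euclidean norm. -/
abbrev Cn (n : ℕ) : Type := EuclideanSpace ℂ (Fin n)

/-- The unit sphere `S^{d-1}` of `ℂⁿ = ℝᵈ`. -/
abbrev Sph (n : ℕ) : Type := Metric.sphere (0 : Cn n) 1

/-- The surface measure on `S^{d-1}` induced by Lebesgue measure on `ℂⁿ = ℝᵈ`. -/
def surf (n : ℕ) : Measure (Sph n) := (volume : Measure (Cn n)).toSphere

/-- The coefficient `B_j(z, ζ) = conj (ζ_j - z_j) / |ζ - z|^{2n}` of the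
Bochner-Martinelli kernel. -/
def bm {n : ℕ} (j : Fin n) (z ζ : Cn n) : ℂ :=
  (starRingEnd ℂ) (ζ j - z j) / ((‖ζ - z‖ ^ (2 * n) : ℝ) : ℂ)

/-- The Taylor polynomial of degree `N - 1` (that is, of all total orders `< N` in the real
variables) of `B_j(·, ζ)` at the origin, evaluated at `z`. -/
def bmTaylor {n : ℕ} (N : ℕ) (j : Fin n) (z ζ : Cn n) : ℂ :=
  ∑ k ∈ Finset.range N,
    ((k.factorial : ℂ))⁻¹ * iteratedFDeriv ℝ k (fun w : Cn n => bm j w ζ) 0 (fun _ => z)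

/-- `I_j^N(z, ζ) = (|ζ| / |z|)^N |ζ|^{d-1} (B_j(z, ζ) - P_j^{N-1}(z, ζ))`. -/
def remCoeff {n : ℕ} (N : ℕ) (j : Fin n) (z ζ : Cn n) : ℂ :=
  (((‖ζ‖ / ‖z‖) ^ N * ‖ζ‖ ^ (2 * n - 1) : ℝ) : ℂ) * (bm j z ζ - bmTaylor N j z ζ)

/-- The coefficients `c_n I_j^N`, `c_n = (n-1)! / (2πi)^n`, of the `(n, n-1)`-form `I^N` with
respect to the forms `dζ_j ∧ ⋀_{k ≠ j} (dζ̄_k ∧ dζ_k)`. -/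
def formI {n : ℕ} (N : ℕ) (z ζ : Cn n) (j : Fin n) : ℂ :=
  (((n - 1).factorial : ℂ) / (2 * (Real.pi : ℂ) * Complex.I) ^ n) * remCoeff N j z ζ

/-- The (coefficients of the) kernel `K_N = ψ I^N`. -/
def kernelK {n : ℕ} (N : ℕ) (ψ : Cn n × Cn n → ℝ) (z ζ : Cn n) (j : Fin n) : ℂ :=
  (ψ (z, ζ) : ℂ) * formI N z ζ j

/-- `ψ` is a smooth cutoff away from the diagonal, at relative scale `1/N`, with derivative
bounds `|D^k ψ| ≤ A_k (|ζ| / N)^{-k}`. -/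
structure IsDiagCutoff {n : ℕ} (A : ℕ → ℝ) (N : ℕ) (ψ : Cn n × Cn n → ℝ) : Prop where
  smooth : ContDiffOn ℝ ∞ ψ {x | x.2 ≠ 0}
  eq_one : ∀ z ζ : Cn n, ζ ≠ 0 → 1 / (N : ℝ) * ‖ζ‖ < ‖z - ζ‖ → ψ (z, ζ) = 1
  eq_zero : ∀ z ζ : Cn n, ζ ≠ 0 → ‖z - ζ‖ < 1 / (2 * (N : ℝ)) * ‖ζ‖ → ψ (z, ζ) = 0
  deriv_le : ∀ (k : ℕ) (z ζ : Cn n), ζ ≠ 0 →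
    ‖iteratedFDeriv ℝ k ψ (z, ζ)‖ ≤ A k * (‖ζ‖ / (N : ℝ)) ^ (-(k : ℤ))

/-- `|sin θ(x, y)|`, where `θ(x, y) ∈ [0, π]` is the (real) angle between `x` and `y`. -/
def absSin {n : ℕ} (x y : Cn n) : ℝ := |Real.sin (InnerProductGeometry.angle x y)|

/-- The extension of a function of two unit vectors to pairs of nonzero vectors that is
homogeneous of degree `0` in each of them. Only the values of `χ` on `S^{d-1} × S^{d-1}` matter
(at pairs of nonzero vectors). -/
def homExt {n : ℕ} (χ : Cn n × Cn n → ℝ) (x : Cn n × Cn n) : ℝ :=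
  χ (‖x.1‖⁻¹ • x.1, ‖x.2‖⁻¹ • x.2)

/-- `χ`, as a function on `S^{d-1} × S^{d-1}`, is smooth, has values in `[0, 1]` and satisfies
`|D^k χ| ≤ B_k l^{-k}` for all `k`. Derivatives on the sphere are those of the homogeneous
extension of degree `0`, taken at points of the sphere; up to constants that depend only on the
dimension and on `k`, such bounds are the same as bounds in a fixed system of coordinates,
since `l < 1` in all uses. -/
structure IsSphereBump {n : ℕ} (B : ℕ → ℝ) (l : ℝ) (χ : Cn n × Cn n → ℝ) : Prop where
  mem_Icc : ∀ ξ η : Sph n, χ ((ξ : Cn n), (η : Cn n)) ∈ Set.Icc (0 : ℝ) 1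
  smooth : ContDiffOn ℝ ∞ (homExt χ) {x | x.1 ≠ 0 ∧ x.2 ≠ 0}
  deriv_le : ∀ (k : ℕ) (ξ η : Sph n),
    ‖iteratedFDeriv ℝ k (homExt χ) ((ξ : Cn n), (η : Cn n))‖ ≤ B k * l ^ (-(k : ℤ))

/-- `χ` is a cutoff `χ^l` to `{|sin θ| ≲ l}`. -/
structure IsUpperCutoff {n : ℕ} (B : ℕ → ℝ) (l : ℝ) (χ : Cn n × Cn n → ℝ) : Prop
    extends IsSphereBump B l χ where
  eq_zero : ∀ ξ η : Sph n, 100 * l < absSin (ξ : Cn n) (η : Cn n) →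
    χ ((ξ : Cn n), (η : Cn n)) = 0

/-- `χ` is a cutoff `χ_l` to `{|sin θ| ≈ l}`. -/
structure IsAnnularCutoff {n : ℕ} (B : ℕ → ℝ) (l : ℝ) (χ : Cn n × Cn n → ℝ) : Prop
    extends IsSphereBump B l χ where
  eq_zero : ∀ ξ η : Sph n,
    (absSin (ξ : Cn n) (η : Cn n) < l / 100 ∨ 100 * l < absSin (ξ : Cn n) (η : Cn n)) →
    χ ((ξ : Cn n), (η : Cn n)) = 0

/-- The kernel `χ K_N^{s,t}` on `S^{d-1} × S^{d-1}`, where `K_N^{s,t}(ξ, η) = K_N(sξ, tη)`. -/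
def sphKernel {n : ℕ} (N : ℕ) (ψ χ : Cn n × Cn n → ℝ) (s t : ℝ) (ξ η : Sph n) (j : Fin n) : ℂ :=
  (χ ((ξ : Cn n), (η : Cn n)) : ℂ) * kernelK N ψ (s • (ξ : Cn n)) (t • (η : Cn n)) j

/-- The operator induced by a kernel with `n` coefficients; it acts on the coefficients
`f = (f_1, …, f_n)` of a `(0,1)`-form by `(Tf)(ξ) = ∫ ∑_j k_j(ξ, η) f_j(η) dσ(η)`. -/
def kernelOp {n : ℕ} (k : Sph n → Sph n → Fin n → ℂ) (f : Sph n → Cn n) (ξ : Sph n) : ℂ :=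
  ∫ η, ∑ j, k ξ η j * f η j ∂(surf n)

/-- The operator induced by `k` is well defined on `L^p(S^{d-1})` and maps it to
`L^{p'}(S^{d-1})` with norm at most `M`. -/
def MapsLp {n : ℕ} (k : Sph n → Sph n → Fin n → ℂ) (p p' : ℝ≥0∞) (M : ℝ) : Prop :=
  ∀ f : Sph n → Cn n, MemLp f p (surf n) →
    (∀ ξ, Integrable (fun η => ∑ j, k ξ η j * f η j) (surf n)) ∧
    MemLp (kernelOp k f) p' (surf n) ∧
    eLpNorm (kernelOp k f) p' (surf n) ≤ ENNReal.ofReal M * eLpNorm f p (surf n)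

end BMKernel

end

/-!
# `L^p` bounds for localized Bochner–Martinelli–Taylor kernels on the sphere

Put `x = Re ⟨ξ, η⟩ = cos θ` and `u = s / t`. Then `|tη - sξ|² = t² (1 - 2xu + u²)`, and the Taylor
polynomials of the Bochner–Martinelli kernel are partial sums of the generating function
`(1 - 2xu + u²)^{-n} = ∑ C_k^{(n)}(x) u^k` of the Gegenbauer polynomials (`bmTaylor_eq`). Hence,
up to `c_n` and the cutoffs, the coefficients of `K_N^{s,t}` are
`conj η_j · rem_N - conj ξ_j · rem_{N-1}`, where `rem_N` is the normalized remainder of that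
series (`remCoeff_eq`). Multiplication by `1 - 2xu + u²` lowers the index `n`, so `rem_N` obeys a
recursion in the index whose source terms are first differences of Gegenbauer polynomials and
polynomials of lower index (`rem`, `pow_mul_rem`).

**Pointwise bounds.** With `x = re z`, `|z| = 1`, the generating function is a product of
geometric series in `zu` and `z̄u`, which bounds `C_k^{(n)}`; partial fractions trade factors
`sin θ` for powers of `k`. Through the recursion, the kernel is `O(N^{d-2} (|1 - u| + 1/N)^{-1})`
off the diagonal (`exists_comb_le`) and `O(N^{n-1} l^{-n} (|1 - u| + l)^{-1})` where
`|sin θ| ≈ l ≳ 1/N` (`exists_sqrt_pow_mul_rem_le`).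

**`L²` bounds.** If `N^{1/μ} l` is bounded above and below, the size of the kernel and the measure
`O(l^{d-1})` of the set `|sin θ| ≲ l` suffice, by Schur's test (`exists_opBound_of_absSin_le`). If
`N l` is large, `ψ = 1` on the support of the annular cutoff, and the kernel is bounded on `L²` by
`(|1 - u| + l)^{-1}`, without any power of `N` (`exists_opBound_annular`), for the following
reasons.
* The kernel `C_k^{(n)}(ξ · η)` is bounded on `L²` uniformly in `k`: it is a sum of mutually
  orthogonal zonal kernels, and the Poisson kernel bounds all such sums at once (`opBound_geg`).
* Smooth functions of `(η - εξ) / l`, in particular the cutoffs and the powers of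
  `(|1 - εu| + l)² / (1 - 2xu + u²)`, are Schur multipliers, by Fourier inversion
  (`exists_opBound_mul_symbol`, `exists_opBound_cut_mul_quadR`, `exists_opBound_sphereBump`).
* The three-term recurrence says that second differences of `ε^k C_k` are of order
  `‖η - εξ‖² ≈ l²`, up to first differences times `O(1 / k)`. Landau's inequality then gives first
  differences of order `l` (`opBound_landau`, `gegDiffBound`), and since `C_k^{(a)}` is a
  difference of `C^{(a+1)}` divided by `k`, lowering the index gains a factor `l / k`
  (`gegBound`). This is what the recursion of `rem_N` needs (`exists_opBound_cut_mul_rem`).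

**Interpolation.** The pointwise bound is a bound `L¹ → L^∞`, and `1/q` is the parameter that puts
`L^p → L^{p'}` between it and `L² → L²`; Marcinkiewicz's argument gives the product of the powers
`1/q` and `1 - 1/q` of the two norms (`exists_interpolation`).
-/

set_option linter.unusedSectionVars false

noncomputable section

namespace BMKernel

/-! ### Gegenbauer polynomials -/

section Gegenbauer

open PowerSeries

/-- The quadratic `1 - 2αu + βu²`, as a formal power series in `u`. -/
def quad (α β : ℝ) : PowerSeries ℝ := 1 - C (2 * α) * X + C β * X ^ 2

/-- The homogenized Gegenbauer polynomial: the coefficient of `u^k` in `(1 - 2αu + βu²)^{-a}`.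
The classical polynomial `C_k^{(a)}(x)` is `geg a k x 1`. -/
def geg (a k : ℕ) (α β : ℝ) : ℝ := coeff k ((quad α β)⁻¹ ^ a)

lemma quad_constantCoeff (α β : ℝ) : constantCoeff (quad α β) ≠ 0 := by
  simp [quad]

lemma quad_mul_inv (α β : ℝ) : quad α β * (quad α β)⁻¹ = 1 :=
  PowerSeries.mul_inv_cancel _ (quad_constantCoeff α β)

lemma quad_mul_inv_pow (a : ℕ) (α β : ℝ) :
    quad α β * (quad α β)⁻¹ ^ (a + 1) = (quad α β)⁻¹ ^ a := by
  rw [pow_succ', ← mul_assoc, quad_mul_inv, one_mul]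

/-- `geg a (k - 2)`, with the value `0` for `k < 2`. -/
def gegS (a k : ℕ) (α β : ℝ) : ℝ := coeff k (X ^ 2 * (quad α β)⁻¹ ^ a)

@[simp] lemma gegS_add_two (a k : ℕ) (α β : ℝ) : gegS a (k + 2) α β = geg a k α β := by
  simp [gegS, geg, coeff_X_pow_mul]

@[simp] lemma gegS_zero (a : ℕ) (α β : ℝ) : gegS a 0 α β = 0 := by
  simp [gegS, coeff_X_pow_mul']

@[simp] lemma gegS_one (a : ℕ) (α β : ℝ) : gegS a 1 α β = 0 := by
  simp [gegS, coeff_X_pow_mul']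

lemma coeff_X_mul_geg (a k : ℕ) (α β : ℝ) :
    coeff k (X * (quad α β)⁻¹ ^ a) = gegS a (k + 1) α β := by
  cases k with
  | zero => simp
  | succ k => rw [coeff_succ_X_mul, gegS_add_two, geg]

lemma geg_zero_left (k : ℕ) (α β : ℝ) : geg 0 k α β = if k = 0 then 1 else 0 := by
  simp [geg, coeff_one]

@[simp] lemma geg_zero_right (a : ℕ) (α β : ℝ) : geg a 0 α β = 1 := by
  simp [geg, quad]

lemma gegS_rec (a k : ℕ) (α β : ℝ) :
    gegS (a + 1) (k + 2) α β =
      2 * α * gegS (a + 1) (k + 1) α β - β * gegS (a + 1) k α β + gegS a (k + 2) α β := by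
  have h := congrArg (coeff k) (quad_mul_inv_pow a α β)
  have e : quad α β * (quad α β)⁻¹ ^ (a + 1) = (quad α β)⁻¹ ^ (a + 1)
      - C (2 * α) * (X * (quad α β)⁻¹ ^ (a + 1)) + C β * (X ^ 2 * (quad α β)⁻¹ ^ (a + 1)) := by
    rw [quad]; ring
  rw [e, map_add, map_sub, coeff_C_mul, coeff_C_mul, coeff_X_mul_geg] at h
  rw [gegS_add_two, gegS_add_two, geg, geg, ← h, gegS, gegS]
  ring

lemma geg_rec (a k : ℕ) (α β : ℝ) :
    geg (a + 1) (k + 2) α β =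
      2 * α * geg (a + 1) (k + 1) α β - β * geg (a + 1) k α β + geg a (k + 2) α β := by
  simpa using gegS_rec a (k + 2) α β

lemma geg_rec_one (a : ℕ) (α β : ℝ) : geg (a + 1) 1 α β = 2 * α + geg a 1 α β := by
  simpa using gegS_rec a 1 α β

lemma derivative_quad_inv_pow (a : ℕ) (α β : ℝ) :
    d⁄dX ℝ ((quad α β)⁻¹ ^ a) =
      C (a : ℝ) * (C (2 * α) - C (2 * β) * X) * (quad α β)⁻¹ ^ (a + 1) := by
  have hq : d⁄dX ℝ (quad α β) = -(C (2 * α)) + C (2 * β) * X := by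
    have h2 : (C (2 * β) : PowerSeries ℝ) = 2 * C β := by
      rw [two_mul, two_mul, map_add]
    simp [quad, Derivation.leibniz, smul_eq_mul, h2]
    ring
  rcases a with _ | a
  · simp
  · rw [derivative_pow, derivative_inv', hq]
    simp only [Nat.add_sub_cancel, map_natCast]
    ring

lemma coeff_X_mul_derivative (f : PowerSeries ℝ) (k : ℕ) :
    coeff k (X * d⁄dX ℝ f) = k * coeff k f := by
  cases k with
  | zero => simp
  | succ k => rw [coeff_succ_X_mul, coeff_derivative]; push_cast; ring

/-- Euler's identity for the homogenized Gegenbauer polynomials. -/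
lemma geg_euler (a k : ℕ) (α β : ℝ) :
    k * geg a k α β =
      2 * a * (α * gegS (a + 1) (k + 1) α β - β * gegS (a + 1) k α β) := by
  have h := coeff_X_mul_derivative ((quad α β)⁻¹ ^ a) k
  have e : X * (C (a : ℝ) * (C (2 * α) - C (2 * β) * X) * (quad α β)⁻¹ ^ (a + 1)) =
      C (a * (2 * α)) * (X * (quad α β)⁻¹ ^ (a + 1)) -
        C (a * (2 * β)) * (X ^ 2 * (quad α β)⁻¹ ^ (a + 1)) := by
    simp only [map_mul]
    ring
  rw [derivative_quad_inv_pow, e, map_sub, coeff_C_mul, coeff_C_mul, coeff_X_mul_geg] at h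
  rw [geg, ← h, gegS, gegS]
  ring

lemma quad_inv_pow_eq (a k : ℕ) (α β : ℝ) :
    geg a k α β = geg (a + 1) k α β - 2 * α * gegS (a + 1) (k + 1) α β
      + β * gegS (a + 1) k α β := by
  have := gegS_rec a k α β
  rw [gegS_add_two, gegS_add_two] at this
  linarith

/-- Lowering the index `a`: `(k + a) C_k^a = a (C_k^{a+1} - β C_{k-2}^{a+1})`. -/
lemma geg_contig (a k : ℕ) (α β : ℝ) :
    (k + a) * geg a k α β = a * (geg (a + 1) k α β - β * gegS (a + 1) k α β) := by
  have h1 := geg_euler a k α β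
  have h2 := quad_inv_pow_eq a k α β
  linear_combination h1 + (a : ℝ) * h2

/-- The derivative of a homogenized Gegenbauer polynomial along functions `A`, `B`. With
`gegS` and truncated subtraction the formula holds for all indices. -/
lemma hasFDerivAt_gegS {E : Type*} [NormedAddCommGroup E] [NormedSpace ℝ E] {A B : E → ℝ}
    {A' B' : E →L[ℝ] ℝ} {y : E} (hA : HasFDerivAt A A' y) (hB : HasFDerivAt B B' y) (a k : ℕ) :
    HasFDerivAt (fun y => gegS a k (A y) (B y))
      ((2 * a * gegS (a + 1) (k - 1) (A y) (B y)) • A'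
        - (a * gegS (a + 1) (k - 2) (A y) (B y)) • B') y := by
  induction a generalizing k with
  | zero =>
    have : (fun y => gegS 0 k (A y) (B y)) = fun _ => gegS 0 k 0 0 := by
      funext y; simp [gegS]
    rw [this]
    simpa using hasFDerivAt_const (𝕜 := ℝ) (gegS 0 k 0 0) y
  | succ a iha =>
    induction k using Nat.strong_induction_on with
    | _ k ihk =>
      match k with
      | 0 => simpa using hasFDerivAt_const (𝕜 := ℝ) (0 : ℝ) y
      | 1 => simpa using hasFDerivAt_const (𝕜 := ℝ) (0 : ℝ) y
      | k + 2 =>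
        have e : (fun y => gegS (a + 1) (k + 2) (A y) (B y)) = fun y =>
            2 * A y * gegS (a + 1) (k + 1) (A y) (B y) - B y * gegS (a + 1) k (A y) (B y)
              + gegS a (k + 2) (A y) (B y) := by
          funext y; exact gegS_rec a k _ _
        rw [e]
        have h1 := ihk (k + 1) (by omega)
        have h2 := ihk k (by omega)
        refine ((((hA.const_mul 2).mul h1).sub (hB.mul h2)).add (iha (k + 2))).congr_fderiv ?_
        ext v
        simp only [Nat.add_sub_cancel, show k + 2 - 1 = k + 1 from rfl]
        have r1 : gegS (a + 1 + 1) (k + 1) (A y) (B y) =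
            2 * A y * gegS (a + 1 + 1) k (A y) (B y) - B y * gegS (a + 1 + 1) (k - 1) (A y) (B y)
              + gegS (a + 1) (k + 1) (A y) (B y) := by
          cases k with
          | zero => simp
          | succ k => simpa using gegS_rec (a + 1) k (A y) (B y)
        have r2 : gegS (a + 1 + 1) k (A y) (B y) =
            2 * A y * gegS (a + 1 + 1) (k - 1) (A y) (B y)
              - B y * gegS (a + 1 + 1) (k - 2) (A y) (B y)
              + gegS (a + 1) k (A y) (B y) := by
          match k with
          | 0 => simp
          | 1 => simp
          | k + 2 => simpa using gegS_rec (a + 1) k (A y) (B y)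
        simp only [add_apply, sub_apply, smul_apply, smul_eq_mul,
          show k + 1 - 2 = k - 1 by omega]
        push_cast
        linear_combination (-2 * (a + 1 : ℝ) * A' v) * r1 + ((a + 1 : ℝ) * B' v) * r2

/-! ### Bounds for Gegenbauer polynomials -/

/-- The coefficients of `f` grow at most like `A (k + 1)^e`. -/
def CoeffLe (f : PowerSeries ℂ) (A : ℝ) (e : ℕ) : Prop :=
  ∀ k, ‖coeff k f‖ ≤ A * ((k : ℝ) + 1) ^ e

/-- The geometric series `(1 - zu)⁻¹`. -/
def geom (z : ℂ) : PowerSeries ℂ := PowerSeries.mk fun k => z ^ k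

lemma geom_mul (z : ℂ) : geom z * (1 - C z * X) = 1 := by
  ext k
  cases k with
  | zero => simp [geom]
  | succ k =>
    rw [mul_sub, mul_one, map_sub, ← mul_assoc, coeff_succ_mul_X, mul_comm, coeff_C_mul]
    simp [geom, coeff_one]
    ring

lemma CoeffLe.mul_geom {f : PowerSeries ℂ} {A : ℝ} {e : ℕ} (hf : CoeffLe f A e) {z : ℂ}
    (hz : ‖z‖ = 1) : CoeffLe (f * geom z) A (e + 1) := by
  intro k
  have hA : 0 ≤ A := by simpa using (norm_nonneg _).trans (hf 0)
  rw [coeff_mul]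
  calc _ ≤ ∑ p ∈ Finset.HasAntidiagonal.antidiagonal k, A * ((k : ℝ) + 1) ^ e := by
        refine norm_sum_le_of_le _ fun p hp => ?_
        have : p.1 ≤ k := by have := Finset.HasAntidiagonal.mem_antidiagonal.1 hp; omega
        rw [norm_mul, geom, coeff_mk, norm_pow, hz, one_pow, mul_one]
        refine (hf p.1).trans ?_
        gcongr
    _ = _ := by
        rw [Finset.sum_const, Finset.Nat.card_antidiagonal, nsmul_eq_mul]
        push_cast
        ring

lemma CoeffLe.sub {f g : PowerSeries ℂ} {A B : ℝ} {e : ℕ} (hf : CoeffLe f A e)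
    (hg : CoeffLe g B e) : CoeffLe (f - g) (A + B) e := by
  intro k
  rw [map_sub, add_mul]
  exact (norm_sub_le _ _).trans (add_le_add (hf k) (hg k))

lemma CoeffLe.C_mul {f : PowerSeries ℂ} {A : ℝ} {e : ℕ} (hf : CoeffLe f A e) (c : ℂ) :
    CoeffLe (C c * f) (‖c‖ * A) e := by
  intro k
  rw [coeff_C_mul, norm_mul, mul_assoc]
  exact mul_le_mul_of_nonneg_left (hf k) (norm_nonneg _)

lemma coeffLe_geom {z : ℂ} (hz : ‖z‖ = 1) : CoeffLe (geom z) 1 0 := by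
  intro k
  simp [geom, hz]

/-- The complexification of `(quad x 1)⁻¹`, for `x = z.re` with `‖z‖ = 1`. -/
def quadGeom (z : ℂ) : PowerSeries ℂ := geom z * geom ((starRingEnd ℂ) z)

lemma map_quad_inv {z : ℂ} (hz : ‖z‖ = 1) :
    PowerSeries.map (algebraMap ℝ ℂ) (quad z.re 1)⁻¹ = quadGeom z := by
  have h1 : PowerSeries.map (algebraMap ℝ ℂ) (quad z.re 1) =
      (1 - C z * X) * (1 - C ((starRingEnd ℂ) z) * X) := by
    have e1 : C z + C ((starRingEnd ℂ) z) = (C ((2 * z.re : ℝ) : ℂ) : PowerSeries ℂ) := by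
      rw [← map_add, Complex.add_conj]
    have e2 : C z * C ((starRingEnd ℂ) z) = (1 : PowerSeries ℂ) := by
      rw [← map_mul, Complex.mul_conj, Complex.normSq_eq_norm_sq, hz]; simp
    simp only [quad, map_add, map_sub, map_mul, map_one, map_pow, PowerSeries.map_X,
      PowerSeries.map_C, Complex.coe_algebraMap]
    rw [← map_mul, ← Complex.ofReal_mul, ← e1]
    linear_combination (-(X : PowerSeries ℂ) ^ 2) * e2
  have h2 : PowerSeries.map (algebraMap ℝ ℂ) (quad z.re 1) *
      PowerSeries.map (algebraMap ℝ ℂ) (quad z.re 1)⁻¹ = 1 := by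
    rw [← map_mul, quad_mul_inv, map_one]
  have g1 := geom_mul z
  have g2 := geom_mul ((starRingEnd ℂ) z)
  rw [h1] at h2
  rw [quadGeom]
  calc _ = (geom z * (1 - C z * X)) * (geom ((starRingEnd ℂ) z) *
        (1 - C ((starRingEnd ℂ) z) * X)) *
        PowerSeries.map (algebraMap ℝ ℂ) (quad z.re 1)⁻¹ := by rw [g1, g2]; simp
    _ = geom z * geom ((starRingEnd ℂ) z) * ((1 - C z * X) * (1 - C ((starRingEnd ℂ) z) * X) *
        PowerSeries.map (algebraMap ℝ ℂ) (quad z.re 1)⁻¹) := by ring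
    _ = _ := by rw [h2, mul_one]

lemma ofReal_geg {z : ℂ} (hz : ‖z‖ = 1) (a k : ℕ) :
    ((geg a k z.re 1 : ℝ) : ℂ) = coeff k (quadGeom z ^ a) := by
  rw [← map_quad_inv hz, ← map_pow, coeff_map]; rfl

/-- Partial fractions: `(z - z̄) / ((1 - zu)(1 - z̄u))` is a difference of two geometric series.
This trades a factor `sin θ = im z` for one power of the degree in the coefficient bounds below. -/
lemma quadGeom_sub {z : ℂ} :
    C (z - (starRingEnd ℂ) z) * quadGeom z =
      C z * geom z - C ((starRingEnd ℂ) z) * geom ((starRingEnd ℂ) z) := by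
  have g1 := geom_mul z
  have g2 := geom_mul ((starRingEnd ℂ) z)
  rw [quadGeom, map_sub]
  linear_combination (-(C ((starRingEnd ℂ) z)) * geom ((starRingEnd ℂ) z)) * g1 +
    (C z * geom z) * g2

lemma CoeffLe.mul_quadGeom_pow {f : PowerSeries ℂ} {A : ℝ} {e : ℕ} (hf : CoeffLe f A e) {z : ℂ}
    (hz : ‖z‖ = 1) (m : ℕ) : CoeffLe (f * quadGeom z ^ m) A (e + 2 * m) := by
  induction m with
  | zero => simpa using hf
  | succ m ih =>
    have := (ih.mul_geom hz).mul_geom (z := (starRingEnd ℂ) z) (by simpa using hz)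
    rw [pow_succ, quadGeom, ← mul_assoc, ← mul_assoc]
    exact this

lemma CoeffLe.mul_sub_pow {f : PowerSeries ℂ} {A : ℝ} {e : ℕ} (hf : CoeffLe f A e) {z : ℂ}
    (hz : ‖z‖ = 1) (m : ℕ) :
    CoeffLe (f * (C (z - (starRingEnd ℂ) z) * quadGeom z) ^ m) (2 ^ m * A) (e + m) := by
  induction m with
  | zero => simpa using hf
  | succ m ih =>
    have hz' : ‖(starRingEnd ℂ) z‖ = 1 := by simpa using hz
    have := ((ih.mul_geom hz).C_mul z).sub ((ih.mul_geom hz').C_mul ((starRingEnd ℂ) z))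
    rw [hz, hz'] at this
    rw [pow_succ, ← mul_assoc]
    nth_rw 2 [quadGeom_sub]
    convert this using 1 <;> ring

lemma coeffLe_quadGeom_pow {z : ℂ} (hz : ‖z‖ = 1) (a : ℕ) :
    CoeffLe (quadGeom z ^ (a + 1)) 1 (2 * a + 1) := by
  have h := ((coeffLe_geom hz).mul_geom (z := (starRingEnd ℂ) z)
    (by simpa using hz)).mul_quadGeom_pow hz a
  rw [pow_succ']
  rwa [show 2 * a + 1 = 0 + 1 + 2 * a by ring]

lemma coeffLe_sub_mul_quadGeom {z : ℂ} (hz : ‖z‖ = 1) :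
    CoeffLe (C (z - (starRingEnd ℂ) z) * quadGeom z) 2 0 := by
  have hz' : ‖(starRingEnd ℂ) z‖ = 1 := by simpa using hz
  have h := ((coeffLe_geom hz).C_mul z).sub ((coeffLe_geom hz').C_mul ((starRingEnd ℂ) z))
  rw [hz, hz'] at h
  rw [quadGeom_sub]
  convert h using 1
  norm_num

lemma norm_sub_conj (z : ℂ) : ‖z - (starRingEnd ℂ) z‖ = 2 * |z.im| := by
  rw [Complex.sub_conj]
  simp

/-- The unit complex number with real part `x`, for `|x| ≤ 1`. -/
lemma exists_unit {x : ℝ} (hx : |x| ≤ 1) :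
    ∃ z : ℂ, ‖z‖ = 1 ∧ z.re = x ∧ |z.im| = √(1 - x ^ 2) := by
  have h : 0 ≤ 1 - x ^ 2 := by
    have := (sq_le_one_iff_abs_le_one x).2 hx
    linarith
  refine ⟨⟨x, √(1 - x ^ 2)⟩, ?_, rfl, abs_of_nonneg (Real.sqrt_nonneg _)⟩
  rw [← sq_eq_sq₀ (norm_nonneg _) zero_le_one, ← Complex.normSq_eq_norm_sq, Complex.normSq_mk,
    Real.mul_self_sqrt h]
  ring

/-- The generating function is a product of `2 (a + 1)` geometric series with unimodular ratios. -/
lemma abs_geg_le {x : ℝ} (hx : |x| ≤ 1) (a k : ℕ) :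
    |geg (a + 1) k x 1| ≤ ((k : ℝ) + 1) ^ (2 * a + 1) := by
  obtain ⟨z, hz, rfl, -⟩ := exists_unit hx
  have := coeffLe_quadGeom_pow hz a k
  rwa [← ofReal_geg hz, Complex.norm_real, Real.norm_eq_abs, one_mul] at this

/-- With `x = cos θ`, one factor `sin θ` saves one power of `k` over `abs_geg_le`. -/
lemma sqrt_mul_abs_geg_le {x : ℝ} (hx : |x| ≤ 1) (a k : ℕ) :
    √(1 - x ^ 2) * |geg (a + 1) k x 1| ≤ ((k : ℝ) + 1) ^ (2 * a) := by
  obtain ⟨z, hz, rfl, him⟩ := exists_unit hx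
  have := (coeffLe_sub_mul_quadGeom hz).mul_quadGeom_pow hz a k
  rw [mul_assoc, ← pow_succ', coeff_C_mul, ← ofReal_geg hz, norm_mul, Complex.norm_real,
    Real.norm_eq_abs, norm_sub_conj, him, zero_add] at this
  linarith

/-- With `x = cos θ`, each of the `a + 1` factors `sin θ` saves a power of `k` over `abs_geg_le`. -/
lemma sqrt_pow_mul_abs_geg_le {x : ℝ} (hx : |x| ≤ 1) (a k : ℕ) :
    √(1 - x ^ 2) ^ (a + 1) * |geg (a + 1) k x 1| ≤ ((k : ℝ) + 1) ^ a := by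
  obtain ⟨z, hz, rfl, him⟩ := exists_unit hx
  have := (coeffLe_sub_mul_quadGeom hz).mul_sub_pow hz a k
  rw [← pow_succ', mul_pow, ← map_pow, coeff_C_mul, ← ofReal_geg hz, norm_mul, Complex.norm_real,
    Real.norm_eq_abs, norm_pow, norm_sub_conj, him, zero_add, mul_pow] at this
  have h2 : (0 : ℝ) < 2 ^ (a + 1) := by positivity
  refine le_of_mul_le_mul_left ?_ h2
  rw [← mul_assoc]
  exact this.trans_eq (by ring)

/-- The generating function of the signed first differences: the factor `1 - εu` cancels `1 - zu` up
to an error with the factor `z - ε`. -/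
lemma one_sub_mul_quadGeom (z : ℂ) (ε : ℝ) (a : ℕ) :
    (1 - C (ε : ℂ) * X) * quadGeom z ^ (a + 1) =
      geom ((starRingEnd ℂ) z) * quadGeom z ^ a + C (z - ε) * (X * quadGeom z ^ (a + 1)) := by
  have g1 := geom_mul z
  rw [pow_succ', map_sub]
  nth_rw 1 [quadGeom]
  nth_rw 3 [quadGeom]
  linear_combination (geom ((starRingEnd ℂ) z) * quadGeom z ^ a) * g1

lemma ofReal_geg_succ_sub {z : ℂ} (hz : ‖z‖ = 1) (ε : ℝ) (a k : ℕ) :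
    ((geg (a + 1) (k + 1) z.re 1 - ε * geg (a + 1) k z.re 1 : ℝ) : ℂ) =
      coeff (k + 1) (geom ((starRingEnd ℂ) z) * quadGeom z ^ a) +
        (z - ε) * ((geg (a + 1) k z.re 1 : ℝ) : ℂ) := by
  have h := congrArg (coeff (k + 1)) (one_sub_mul_quadGeom z ε a)
  rw [map_add, coeff_C_mul, coeff_succ_X_mul, sub_mul, one_mul, mul_assoc, map_sub, coeff_C_mul,
    coeff_succ_X_mul] at h
  push_cast
  rw [ofReal_geg hz, ofReal_geg hz, h]

lemma norm_sub_sign_le {z : ℂ} (hz : ‖z‖ = 1) {ε : ℝ} (hε : ε ^ 2 = 1) (hx : 0 ≤ ε * z.re) :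
    ‖z - ε‖ ≤ 2 * |z.im| := by
  have h1 : z.re ^ 2 + z.im ^ 2 = 1 := by
    have := Complex.normSq_eq_norm_sq z
    rw [hz, Complex.normSq_apply] at this
    linarith
  refine abs_le_of_sq_le_sq' ?_ (by positivity) |>.2
  rw [← Complex.normSq_eq_norm_sq, Complex.normSq_apply, mul_pow, sq_abs]
  simp only [Complex.sub_re, Complex.ofReal_re, Complex.sub_im, Complex.ofReal_im, sub_zero]
  have h2 : (ε * z.re) ^ 2 ≤ 1 := by rw [mul_pow, hε]; nlinarith [sq_nonneg z.im]
  have h3 : ε * z.re ≤ 1 := (abs_le_of_sq_le_sq' (by simpa using h2) zero_le_one).2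
  have h4 : z.im ^ 2 = (1 - ε * z.re) * (1 + ε * z.re) := by
    linear_combination h1 + z.re ^ 2 * hε
  nlinarith [mul_nonneg (sub_nonneg.2 h3) hx]

/-- With `ε` the sign of `x`, signed first differences save one power of `k` over `abs_geg_le`,
uniformly up to the poles `x = ± 1`. -/
lemma abs_geg_succ_sub_le {x ε : ℝ} (hx : |x| ≤ 1) (hε : ε ^ 2 = 1) (hεx : 0 ≤ ε * x) (a k : ℕ) :
    |geg (a + 1) (k + 1) x 1 - ε * geg (a + 1) k x 1| ≤ 3 * ((k : ℝ) + 2) ^ (2 * a) := by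
  have hs := sqrt_mul_abs_geg_le hx a k
  obtain ⟨z, hz, rfl, him⟩ := exists_unit hx
  have h1 := (coeffLe_geom (z := (starRingEnd ℂ) z) (by simpa using hz)).mul_quadGeom_pow hz a
    (k + 1)
  have h2 := norm_sub_sign_le hz hε hεx
  rw [← Real.norm_eq_abs, ← Complex.norm_real, ofReal_geg_succ_sub hz]
  refine (norm_add_le _ _).trans ?_
  rw [norm_mul, Complex.norm_real, Real.norm_eq_abs]
  have h3 : ‖z - ε‖ * |geg (a + 1) k z.re 1| ≤ 2 * ((k : ℝ) + 2) ^ (2 * a) := by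
    calc _ ≤ 2 * (√(1 - z.re ^ 2) * |geg (a + 1) k z.re 1|) := by
          rw [him] at h2
          rw [← mul_assoc]
          gcongr
      _ ≤ 2 * ((k : ℝ) + 1) ^ (2 * a) := by gcongr
      _ ≤ _ := by gcongr; norm_num
  rw [zero_add, one_mul] at h1
  push_cast at h1
  rw [add_assoc, one_add_one_eq_two] at h1
  linarith

lemma sqrt_pow_mul_abs_geg_succ_sub_le {x ε : ℝ} (hx : |x| ≤ 1) (hε : ε ^ 2 = 1)
    (hεx : 0 ≤ ε * x) (a k : ℕ) :
    √(1 - x ^ 2) ^ (a + 1) * |geg (a + 1) (k + 1) x 1 - ε * geg (a + 1) k x 1| ≤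
      3 * √(1 - x ^ 2) * ((k : ℝ) + 2) ^ a := by
  have hs := sqrt_pow_mul_abs_geg_le hx a k
  obtain ⟨z, hz, rfl, him⟩ := exists_unit hx
  have h1 := (coeffLe_geom (z := (starRingEnd ℂ) z) (by simpa using hz)).mul_sub_pow hz a (k + 1)
  have h2 := norm_sub_sign_le hz hε hεx
  rw [him] at h2
  set s := √(1 - z.re ^ 2) with hsdef
  have hs0 : 0 ≤ s := Real.sqrt_nonneg _
  rw [mul_pow, ← map_pow, ← mul_assoc, mul_comm (geom _) (C _), mul_assoc, coeff_C_mul, norm_mul,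
    norm_pow, norm_sub_conj, him, mul_pow, zero_add, mul_one, mul_assoc] at h1
  have h1' := le_of_mul_le_mul_left h1 (by positivity)
  push_cast at h1'
  rw [add_assoc, one_add_one_eq_two] at h1'
  rw [← Real.norm_eq_abs, ← Complex.norm_real, ofReal_geg_succ_sub hz]
  calc _ ≤ s ^ (a + 1) * (‖coeff (k + 1) (geom ((starRingEnd ℂ) z) * quadGeom z ^ a)‖ +
        2 * s * |geg (a + 1) k z.re 1|) := by
        gcongr
        refine (norm_add_le _ _).trans ?_
        rw [norm_mul, Complex.norm_real, Real.norm_eq_abs]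
        gcongr
    _ = s * (s ^ a * ‖coeff (k + 1) (geom ((starRingEnd ℂ) z) * quadGeom z ^ a)‖) +
        2 * s * (s ^ (a + 1) * |geg (a + 1) k z.re 1|) := by ring
    _ ≤ s * ((k : ℝ) + 2) ^ a + 2 * s * ((k : ℝ) + 1) ^ a := by gcongr
    _ ≤ s * ((k : ℝ) + 2) ^ a + 2 * s * ((k : ℝ) + 2) ^ a := by gcongr; norm_num
    _ = _ := by ring

end Gegenbauer

/-! ### Taylor expansion of the Bochner–Martinelli kernel -/

section Taylor

open PowerSeries

/-- The formal Taylor series at the origin of a function on the real line. -/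
def taylorPS (F : ℝ → ℂ) : PowerSeries ℂ :=
  PowerSeries.mk fun k => ((k.factorial : ℂ))⁻¹ * iteratedDeriv k F 0

lemma taylorPS_mul {F G : ℝ → ℂ} (hF : ContDiffAt ℝ ∞ F 0) (hG : ContDiffAt ℝ ∞ G 0) :
    taylorPS (F * G) = taylorPS F * taylorPS G := by
  ext k
  rw [coeff_mul]
  simp only [taylorPS, coeff_mk]
  rw [iteratedDeriv_mul (hF.of_le (by exact_mod_cast le_top)) (hG.of_le (by exact_mod_cast le_top)),
    Finset.mul_sum,
    Finset.Nat.sum_antidiagonal_eq_sum_range_succ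
      (fun i j => (i.factorial : ℂ)⁻¹ * iteratedDeriv i F 0 *
        ((j.factorial : ℂ)⁻¹ * iteratedDeriv j G 0)) k]
  refine Finset.sum_congr rfl fun i hi => ?_
  have hi' : i ≤ k := Nat.lt_succ_iff.1 (Finset.mem_range.1 hi)
  rw [Nat.cast_choose ℂ hi']
  have h1 : (k.factorial : ℂ) ≠ 0 := by exact_mod_cast k.factorial_ne_zero
  have h2 : (i.factorial : ℂ) ≠ 0 := by exact_mod_cast i.factorial_ne_zero
  have h3 : ((k - i).factorial : ℂ) ≠ 0 := by exact_mod_cast (k - i).factorial_ne_zero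
  field_simp

lemma taylorPS_add {F G : ℝ → ℂ} (hF : ContDiffAt ℝ ∞ F 0) (hG : ContDiffAt ℝ ∞ G 0) :
    taylorPS (F + G) = taylorPS F + taylorPS G := by
  ext k
  simp only [taylorPS, coeff_mk, map_add]
  rw [iteratedDeriv_add (hF.of_le (by exact_mod_cast le_top)) (hG.of_le (by exact_mod_cast le_top)),
    mul_add]

lemma taylorPS_const (c : ℂ) : taylorPS (fun _ => c) = C c := by
  ext k
  cases k with
  | zero => simp [taylorPS]
  | succ k => simp [taylorPS, iteratedDeriv_const]

lemma taylorPS_ofReal : taylorPS (fun τ => (τ : ℂ)) = X := by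
  have hd : deriv (fun τ : ℝ => (τ : ℂ)) = fun _ => 1 := by
    funext τ
    exact (Complex.ofRealCLM.hasDerivAt (x := τ)).deriv
  ext k
  match k with
  | 0 => simp [taylorPS]
  | 1 => simp [taylorPS, hd, coeff_X]
  | k + 2 =>
    simp [taylorPS, iteratedDeriv_succ', hd, coeff_X]

lemma taylorPS_congr {F G : ℝ → ℂ} (h : F =ᶠ[nhds 0] G) : taylorPS F = taylorPS G := by
  ext k
  simp only [taylorPS, coeff_mk, h.iteratedDeriv_eq k]

lemma contDiffAt_ofReal' {τ : ℝ} : ContDiffAt ℝ ∞ (fun τ : ℝ => (τ : ℂ)) τ :=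
  Complex.ofRealCLM.contDiff.contDiffAt

lemma contDiffAt_mul_fun {F G : ℝ → ℂ} (hF : ContDiffAt ℝ ∞ F 0) (hG : ContDiffAt ℝ ∞ G 0) :
    ContDiffAt ℝ ∞ (F * G) 0 := hF.mul hG

lemma contDiffAt_pow_fun {F : ℝ → ℂ} (hF : ContDiffAt ℝ ∞ F 0) (a : ℕ) :
    ContDiffAt ℝ ∞ (F ^ a) 0 := hF.pow a

lemma taylorPS_linear (b c : ℂ) : taylorPS (fun τ => b + c * (τ : ℂ)) = C b + C c * X := by
  have h1 : (fun τ : ℝ => b + c * (τ : ℂ)) =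
      (fun _ => b) + ((fun _ => c) * (fun τ : ℝ => (τ : ℂ))) := rfl
  rw [h1, taylorPS_add contDiffAt_const (contDiffAt_mul_fun contDiffAt_const contDiffAt_ofReal'),
    taylorPS_mul contDiffAt_const contDiffAt_ofReal', taylorPS_const, taylorPS_const,
    taylorPS_ofReal]

lemma taylorPS_quad (α β : ℝ) :
    taylorPS (fun τ => ((1 - 2 * α * τ + β * τ ^ 2 : ℝ) : ℂ)) =
      PowerSeries.map (algebraMap ℝ ℂ) (quad α β) := by
  have h1 : (fun τ : ℝ => ((1 - 2 * α * τ + β * τ ^ 2 : ℝ) : ℂ)) =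
      (fun τ : ℝ => (1 : ℂ) + (-(2 * α) : ℂ) * (τ : ℂ)) +
        ((fun τ : ℝ => (0 : ℂ) + (β : ℂ) * (τ : ℂ)) * fun τ : ℝ => (τ : ℂ)) := by
    funext τ; simp; ring
  have c1 : ∀ b c : ℂ, ContDiffAt ℝ ∞ (fun τ : ℝ => b + c * (τ : ℂ)) 0 := fun b c =>
    contDiffAt_const.add (contDiffAt_const.mul contDiffAt_ofReal')
  rw [h1, taylorPS_add (c1 _ _) (contDiffAt_mul_fun (c1 _ _) contDiffAt_ofReal'),
    taylorPS_mul (c1 _ _) contDiffAt_ofReal', taylorPS_linear, taylorPS_linear, taylorPS_ofReal]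
  simp [quad]
  ring

lemma quad_fun_pos {α β : ℝ} : ∀ᶠ τ : ℝ in nhds 0, 1 - 2 * α * τ + β * τ ^ 2 ≠ 0 := by
  have hc : ContinuousAt (fun τ : ℝ => 1 - 2 * α * τ + β * τ ^ 2) 0 := by fun_prop
  exact hc.eventually_ne (by norm_num)

lemma contDiffAt_quad_inv (α β : ℝ) :
    ContDiffAt ℝ ∞ (fun τ : ℝ => (((1 - 2 * α * τ + β * τ ^ 2 : ℝ) : ℂ))⁻¹) 0 := by
  refine ContDiffAt.inv ?_ (by norm_num)
  have : ContDiff ℝ ∞ (fun τ : ℝ => (1 - 2 * α * τ + β * τ ^ 2 : ℝ)) := by fun_prop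
  exact (Complex.ofRealCLM.contDiff.comp this).contDiffAt

/-- The Gegenbauer polynomials are the Taylor coefficients of `(1 - 2ατ + βτ²)^{-a}`. -/
lemma taylorPS_quad_inv_pow (α β : ℝ) (a : ℕ) :
    taylorPS ((fun τ : ℝ => (((1 - 2 * α * τ + β * τ ^ 2 : ℝ) : ℂ))⁻¹) ^ a) =
      PowerSeries.map (algebraMap ℝ ℂ) ((quad α β)⁻¹ ^ a) := by
  have h1 : taylorPS (fun τ : ℝ => (((1 - 2 * α * τ + β * τ ^ 2 : ℝ) : ℂ))⁻¹) =
      PowerSeries.map (algebraMap ℝ ℂ) (quad α β)⁻¹ := by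
    have hq : ContDiffAt ℝ ∞ (fun τ : ℝ => ((1 - 2 * α * τ + β * τ ^ 2 : ℝ) : ℂ)) 0 := by
      have : ContDiff ℝ ∞ (fun τ : ℝ => (1 - 2 * α * τ + β * τ ^ 2 : ℝ)) := by fun_prop
      exact (Complex.ofRealCLM.contDiff.comp this).contDiffAt
    have h2 := taylorPS_mul hq (contDiffAt_quad_inv α β)
    rw [taylorPS_quad, taylorPS_congr (G := fun _ => (1 : ℂ)), taylorPS_const] at h2
    · have h3 : PowerSeries.map (algebraMap ℝ ℂ) (quad α β) *
          PowerSeries.map (algebraMap ℝ ℂ) (quad α β)⁻¹ = 1 := by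
        rw [← map_mul, quad_mul_inv, map_one]
      rw [map_one] at h2
      calc _ = (PowerSeries.map (algebraMap ℝ ℂ) (quad α β) *
          PowerSeries.map (algebraMap ℝ ℂ) (quad α β)⁻¹) * _ := by rw [h3, one_mul]
        _ = PowerSeries.map (algebraMap ℝ ℂ) (quad α β)⁻¹ *
          (PowerSeries.map (algebraMap ℝ ℂ) (quad α β) * taylorPS _) := by ring
        _ = _ := by rw [← h2, mul_one]
    · filter_upwards [quad_fun_pos (α := α) (β := β)] with τ hτ
      exact mul_inv_cancel₀ (Complex.ofReal_ne_zero.2 hτ)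
  induction a with
  | zero =>
    rw [pow_zero, pow_zero, map_one]
    exact (taylorPS_const 1).trans (map_one _)
  | succ a ih =>
    rw [pow_succ, pow_succ, map_mul, taylorPS_mul (contDiffAt_pow_fun (contDiffAt_quad_inv α β) a)
      (contDiffAt_quad_inv α β), ih, h1]

/-- Homogeneity of `geg`. -/
lemma geg_smul (u α β : ℝ) (a k : ℕ) : geg a k (u * α) (u ^ 2 * β) = u ^ k * geg a k α β := by
  have h1 : rescale u (quad α β) = quad (u * α) (u ^ 2 * β) := by
    ext k
    simp only [coeff_rescale, quad, map_add, map_sub, coeff_C_mul, coeff_X_pow, coeff_X, coeff_one]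
    match k with
    | 0 => simp
    | 1 => simp; ring
    | k + 2 => by_cases hk : k = 0 <;> simp [hk]
  have h2 : rescale u (quad α β)⁻¹ = (quad (u * α) (u ^ 2 * β))⁻¹ := by
    have h3 : quad (u * α) (u ^ 2 * β) * rescale u (quad α β)⁻¹ = 1 := by
      rw [← h1, ← map_mul, quad_mul_inv, map_one]
    calc _ = (quad (u * α) (u ^ 2 * β) * (quad (u * α) (u ^ 2 * β))⁻¹) *
          rescale u (quad α β)⁻¹ := by rw [quad_mul_inv, one_mul]
      _ = (quad (u * α) (u ^ 2 * β))⁻¹ * (quad (u * α) (u ^ 2 * β) *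
          rescale u (quad α β)⁻¹) := by ring
      _ = _ := by rw [h3, mul_one]
  rw [geg, ← h2, ← map_pow, coeff_rescale, geg]

lemma geg_smul_one (u x : ℝ) (a k : ℕ) : geg a k (u * x) (u ^ 2) = u ^ k * geg a k x 1 := by
  simpa using geg_smul u x 1 a k

/-- The quantity `1 - 2xu + u² = |η - uξ|²`, `x = ⟨ξ, η⟩`. -/
def quadR (x u : ℝ) : ℝ := 1 - 2 * x * u + u ^ 2

/-- The normalized remainder `u^{-N} ((1 - 2xu + u²)^{-n} - ∑_{k<N} C_k^{(n)}(x) u^k)`, in a form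
that is free of cancellation for large and for small `u`. -/
def rem (n N : ℕ) (x u : ℝ) : ℝ :=
  match n with
  | 0 => if N = 0 then 1 else 0
  | n + 1 => (quadR x u)⁻¹ *
      (geg (n + 1) N x 1 - u * gegS (n + 1) (N + 1) x 1 - geg n N x 1 + rem n N x u)

/-- Multiplying the partial sum of the generating function by `1 - 2xu + u²` lowers the index, up to
terms of order `N` and `N + 1`. -/
lemma quadR_mul_sum (n N : ℕ) (x u : ℝ) :
    quadR x u * ∑ k ∈ Finset.range N, geg (n + 1) k x 1 * u ^ k =
      ∑ k ∈ Finset.range N, geg n k x 1 * u ^ k -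
        u ^ N * (geg (n + 1) N x 1 - u * gegS (n + 1) (N + 1) x 1 - geg n N x 1) := by
  induction N with
  | zero => simp
  | succ N ih =>
    rw [Finset.sum_range_succ, mul_add, ih, Finset.sum_range_succ]
    have h := gegS_rec n (N + 1) x 1
    simp only [gegS_add_two] at h ⊢
    rw [quadR]
    linear_combination (u ^ (N + 1)) * h

lemma pow_mul_rem (n N : ℕ) {x u : ℝ} (hD : quadR x u ≠ 0) :
    u ^ N * rem n N x u =
      (quadR x u)⁻¹ ^ n - ∑ k ∈ Finset.range N, geg n k x 1 * u ^ k := by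
  induction n with
  | zero =>
    cases N with
    | zero => simp [rem]
    | succ N =>
      simp only [rem, geg_zero_left, ite_mul, one_mul, zero_mul, pow_zero]
      rw [Finset.sum_ite_eq' (Finset.range (N + 1)) 0]
      simp
  | succ n ih =>
    have h := quadR_mul_sum n N x u
    rw [rem, pow_succ, ← mul_right_inj' hD]
    calc _ = (quadR x u * (quadR x u)⁻¹) * (u ^ N * (geg (n + 1) N x 1 -
          u * gegS (n + 1) (N + 1) x 1 - geg n N x 1) + u ^ N * rem n N x u) := by ring
      _ = (quadR x u * (quadR x u)⁻¹) * (quadR x u)⁻¹ ^ n -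
          quadR x u * ∑ k ∈ Finset.range N, geg (n + 1) k x 1 * u ^ k := by
          rw [mul_inv_cancel₀ hD, ih, h]; ring
      _ = _ := by ring

/-- Derivatives at the origin in the direction `z` are those of the restriction to a line. -/
lemma iteratedFDeriv_zero_diag {E : Type*} [NormedAddCommGroup E] [NormedSpace ℝ E] {f : E → ℂ}
    {s : Set E} (hs : IsOpen s) (h0 : (0 : E) ∈ s) (hf : ContDiffOn ℝ ∞ f s) (z : E) (k : ℕ) :
    iteratedFDeriv ℝ k f 0 (fun _ => z) = iteratedDeriv k (fun τ : ℝ => f (τ • z)) 0 := by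
  set g : ℝ →L[ℝ] E := (ContinuousLinearMap.id ℝ ℝ).smulRight z
  have hg : g 0 = 0 := map_zero g
  have hso : IsOpen (g ⁻¹' s) := hs.preimage g.continuous
  have h0' : g 0 ∈ s := by rw [hg]; exact h0
  have h := g.iteratedFDerivWithin_comp_right (n := ∞) hf hs.uniqueDiffOn hso.uniqueDiffOn
    h0' (i := k) (by exact_mod_cast le_top)
  rw [iteratedFDerivWithin_of_isOpen k hso h0', iteratedFDerivWithin_of_isOpen k hs h0', hg] at h
  have h2 := congrArg (fun m => m (fun _ => (1 : ℝ))) h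
  simp only [ContinuousMultilinearMap.compContinuousLinearMap_apply] at h2
  rw [iteratedDeriv_eq_iteratedFDeriv]
  have e : (f ∘ g) = fun τ : ℝ => f (τ • z) := by funext τ; simp [g]
  rw [← e, h2]
  simp [g]

lemma contDiffOn_bm {n : ℕ} (j : Fin n) (ζ : Cn n) :
    ContDiffOn ℝ ∞ (fun w : Cn n => bm j w ζ) {w | w ≠ ζ} := by
  intro w hw
  refine ContDiffAt.contDiffWithinAt ?_
  have hne : ‖ζ - w‖ ≠ 0 := norm_ne_zero_iff.2 (sub_ne_zero.2 (Ne.symm hw))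
  unfold bm
  have h1 : ContDiff ℝ ∞ (fun w : Cn n => (starRingEnd ℂ) (ζ j - w j)) := by
    have : ContDiff ℝ ∞ (fun w : Cn n => ζ j - w j) :=
      contDiff_const.sub ((PiLp.proj (𝕜 := ℝ) 2 (fun _ : Fin n => ℂ) j).contDiff)
    exact Complex.conjCLE.contDiff.comp this
  have h2 : ContDiff ℝ ∞ (fun w : Cn n => ‖ζ - w‖ ^ (2 * n)) := by
    simp_rw [pow_mul]
    exact ((contDiff_const.sub contDiff_id).norm_sq ℝ).pow n
  have h3 : ContDiff ℝ ∞ (fun w : Cn n => ((‖ζ - w‖ ^ (2 * n) : ℝ) : ℂ)) :=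
    Complex.ofRealCLM.contDiff.comp h2
  simp_rw [div_eq_mul_inv]
  refine h1.contDiffAt.mul (h3.contDiffAt.inv ?_)
  exact Complex.ofReal_ne_zero.2 (pow_ne_zero _ hne)

lemma norm_sub_smul_sq {E : Type*} [NormedAddCommGroup E] [InnerProductSpace ℝ E]
    {z ζ : E} (hζ : ζ ≠ 0) (τ : ℝ) :
    ‖ζ - τ • z‖ ^ 2 =
      ‖ζ‖ ^ 2 * (1 - 2 * (inner ℝ z ζ / ‖ζ‖ ^ 2) * τ + (‖z‖ ^ 2 / ‖ζ‖ ^ 2) * τ ^ 2) := by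
  have h : ‖ζ‖ ≠ 0 := norm_ne_zero_iff.2 hζ
  rw [norm_sub_sq_real, real_inner_smul_right, norm_smul, real_inner_comm, mul_pow,
    Real.norm_eq_abs, sq_abs]
  field_simp

/-- The Taylor polynomial of the Bochner-Martinelli kernel in terms of Gegenbauer polynomials. -/
lemma bmTaylor_eq {n : ℕ} (N : ℕ) (j : Fin n) (z : Cn n) {ζ : Cn n} (hζ : ζ ≠ 0) :
    bmTaylor N j z ζ = ((‖ζ‖ ^ (2 * n) : ℝ) : ℂ)⁻¹ * ∑ k ∈ Finset.range N,
      ((starRingEnd ℂ) (ζ j) * (geg n k (inner ℝ z ζ / ‖ζ‖ ^ 2) (‖z‖ ^ 2 / ‖ζ‖ ^ 2) : ℝ) -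
      (starRingEnd ℂ) (z j) *
        (gegS n (k + 1) (inner ℝ z ζ / ‖ζ‖ ^ 2) (‖z‖ ^ 2 / ‖ζ‖ ^ 2) : ℝ)) := by
  set α : ℝ := inner ℝ z ζ / ‖ζ‖ ^ 2 with hα
  set β : ℝ := ‖z‖ ^ 2 / ‖ζ‖ ^ 2 with hβ
  have hopen : IsOpen {w : Cn n | w ≠ ζ} := isOpen_ne
  have key : (fun τ : ℝ => bm j (τ • z) ζ) =
      (fun _ => ((‖ζ‖ ^ (2 * n) : ℝ) : ℂ)⁻¹) *
      ((fun τ : ℝ => (starRingEnd ℂ) (ζ j) + (-(starRingEnd ℂ) (z j)) * (τ : ℂ)) *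
        (fun τ : ℝ => (((1 - 2 * α * τ + β * τ ^ 2 : ℝ) : ℂ))⁻¹) ^ n) := by
    funext τ
    simp only [bm, Pi.mul_apply, Pi.pow_apply]
    rw [pow_mul, norm_sub_smul_sq hζ, ← hα, ← hβ, mul_pow, ← pow_mul]
    simp only [PiLp.smul_apply, Complex.real_smul, map_sub, map_mul, Complex.conj_ofReal]
    push_cast
    rw [div_eq_mul_inv, mul_inv, inv_pow]
    ring
  have c1 : ContDiffAt ℝ ∞ (fun τ : ℝ => (starRingEnd ℂ) (ζ j) +
      (-(starRingEnd ℂ) (z j)) * (τ : ℂ)) 0 :=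
    contDiffAt_const.add (contDiffAt_const.mul contDiffAt_ofReal')
  have c2 := contDiffAt_pow_fun (contDiffAt_quad_inv α β) n
  rw [bmTaylor, Finset.mul_sum]
  refine Finset.sum_congr rfl fun k _ => ?_
  rw [iteratedFDeriv_zero_diag hopen (Ne.symm hζ) (contDiffOn_bm j ζ) z k, key]
  have h : ∀ F : ℝ → ℂ, ((k.factorial : ℂ))⁻¹ * iteratedDeriv k F 0 = coeff k (taylorPS F) := by
    intro F; simp [taylorPS]
  rw [h, taylorPS_mul contDiffAt_const (contDiffAt_mul_fun c1 c2), taylorPS_mul c1 c2,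
    taylorPS_const, taylorPS_linear, taylorPS_quad_inv_pow, coeff_C_mul, add_mul, map_add,
    coeff_C_mul, mul_assoc, coeff_C_mul, coeff_map, ← map_X (algebraMap ℝ ℂ), ← map_mul, coeff_map, coeff_X_mul_geg]
  simp only [Complex.coe_algebraMap, geg]
  ring

/-- The normalized remainder of the Bochner-Martinelli kernel on `s S^{d-1} × t S^{d-1}`. -/
lemma remCoeff_eq {n N : ℕ} (hN : 1 ≤ N) (j : Fin n) {s t : ℝ} (hs : 0 < s)
    (ht : 0 < t) (ξ η : Sph n)
    (hD : quadR (inner ℝ (ξ : Cn n) (η : Cn n)) (s / t) ≠ 0) :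
    remCoeff N j (s • (ξ : Cn n)) (t • (η : Cn n)) =
      (starRingEnd ℂ) ((η : Cn n) j) *
          (rem n N (inner ℝ (ξ : Cn n) (η : Cn n)) (s / t) : ℝ) -
        (starRingEnd ℂ) ((ξ : Cn n) j) *
          (rem n (N - 1) (inner ℝ (ξ : Cn n) (η : Cn n)) (s / t) : ℝ) := by
  set x : ℝ := inner ℝ (ξ : Cn n) (η : Cn n) with hx
  have hξ : ‖(ξ : Cn n)‖ = 1 := by simp
  have hη : ‖(η : Cn n)‖ = 1 := by simp
  have hη0 : (η : Cn n) ≠ 0 := by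
    intro h; rw [h, norm_zero] at hη; exact zero_ne_one hη
  have ht0 : t • (η : Cn n) ≠ 0 := smul_ne_zero ht.ne' hη0
  set u : ℝ := s / t with hu
  have hs' : s = u * t := by rw [hu]; field_simp
  have hu0 : u ≠ 0 := (div_pos hs ht).ne'
  have n1 : ‖s • (ξ : Cn n)‖ = s := by rw [norm_smul, hξ, mul_one, Real.norm_eq_abs, abs_of_pos hs]
  have n2 : ‖t • (η : Cn n)‖ = t := by rw [norm_smul, hη, mul_one, Real.norm_eq_abs, abs_of_pos ht]
  have hα : inner ℝ (s • (ξ : Cn n)) (t • (η : Cn n)) / t ^ 2 = u * x := by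
    rw [real_inner_smul_left, real_inner_smul_right, ← hx, hs']; field_simp
  have hβ : s ^ 2 / t ^ 2 = u ^ 2 := by rw [hu, div_pow]
  have hbm : bm j (s • (ξ : Cn n)) (t • (η : Cn n)) = ((t ^ (2 * n) : ℝ) : ℂ)⁻¹ *
      (((t : ℂ) * (starRingEnd ℂ) ((η : Cn n) j) - (s : ℂ) * (starRingEnd ℂ) ((ξ : Cn n) j)) *
      (((quadR x u)⁻¹ ^ n : ℝ) : ℂ)) := by
    have := norm_sub_smul_sq (z := s • (ξ : Cn n)) ht0 1
    rw [n1, n2, hα, hβ, one_smul] at this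
    rw [bm, pow_mul, this, mul_pow, ← pow_mul, quadR]
    simp only [PiLp.smul_apply, Complex.real_smul, map_sub, map_mul, Complex.conj_ofReal]
    push_cast
    rw [div_eq_mul_inv, mul_inv, inv_pow]
    ring
  have htay : bmTaylor N j (s • (ξ : Cn n)) (t • (η : Cn n)) = ((t ^ (2 * n) : ℝ) : ℂ)⁻¹ *
      ((t : ℂ) * (starRingEnd ℂ) ((η : Cn n) j) *
          ((∑ k ∈ Finset.range N, geg n k x 1 * u ^ k : ℝ) : ℂ) -
        (s : ℂ) * (starRingEnd ℂ) ((ξ : Cn n) j) *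
          ((∑ k ∈ Finset.range (N - 1), geg n k x 1 * u ^ k : ℝ) : ℂ)) := by
    rw [bmTaylor_eq N j _ ht0, n1, n2, hα, hβ, Finset.sum_sub_distrib, ← Finset.mul_sum,
      ← Finset.mul_sum, ← Complex.ofReal_sum, ← Complex.ofReal_sum]
    obtain ⟨M, rfl⟩ : ∃ M, N = M + 1 := ⟨N - 1, by omega⟩
    have e1 : ∑ k ∈ Finset.range (M + 1), geg n k (u * x) (u ^ 2) =
        ∑ k ∈ Finset.range (M + 1), geg n k x 1 * u ^ k :=
      Finset.sum_congr rfl fun k _ => by rw [geg_smul_one, mul_comm]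
    have e2 : ∑ k ∈ Finset.range (M + 1), gegS n (k + 1) (u * x) (u ^ 2) =
        ∑ k ∈ Finset.range M, geg n k x 1 * u ^ k := by
      rw [Finset.sum_range_succ', gegS_one, add_zero]
      refine Finset.sum_congr rfl fun k _ => ?_
      rw [gegS_add_two, geg_smul_one, mul_comm]
    rw [e1, e2, Nat.add_sub_cancel]
    simp only [PiLp.smul_apply, Complex.real_smul, map_mul, Complex.conj_ofReal]
  have r1 := pow_mul_rem n N hD
  have r2 := pow_mul_rem n (N - 1) hD
  obtain ⟨M, rfl⟩ : ∃ M, N = M + 1 := ⟨N - 1, by omega⟩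
  rw [Nat.add_sub_cancel] at *
  rw [remCoeff, hbm, htay, n1, n2]
  have q1 : (((quadR x u)⁻¹ ^ n : ℝ) : ℂ) -
      ((∑ k ∈ Finset.range (M + 1), geg n k x 1 * u ^ k : ℝ) : ℂ) =
      ((u ^ (M + 1) * rem n (M + 1) x u : ℝ) : ℂ) := by rw [r1]; push_cast; ring
  have q2 : (((quadR x u)⁻¹ ^ n : ℝ) : ℂ) - ((∑ k ∈ Finset.range M, geg n k x 1 * u ^ k : ℝ) : ℂ)
      = ((u ^ M * rem n M x u : ℝ) : ℂ) := by rw [r2]; push_cast; ring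
  have hts : t / s = u⁻¹ := by rw [hu, inv_div]
  have hn : 0 < n := j.pos
  have e3 : t ^ (2 * n) = t ^ (2 * n - 1) * t := by
    rw [← pow_succ]; congr 1; omega
  rw [hts, e3, hs']
  have hu0' : (u : ℂ) ≠ 0 := by exact_mod_cast hu0
  have ht0' : (t : ℂ) ≠ 0 := by exact_mod_cast ht.ne'
  calc _ = (((u⁻¹) ^ (M + 1) * t ^ (2 * n - 1) : ℝ) : ℂ) * (((t ^ (2 * n - 1) * t : ℝ) : ℂ)⁻¹ *
        ((t : ℂ) * (starRingEnd ℂ) ((η : Cn n) j) *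
          ((((quadR x u)⁻¹ ^ n : ℝ) : ℂ) -
            ((∑ k ∈ Finset.range (M + 1), geg n k x 1 * u ^ k : ℝ) : ℂ)) -
        ((u * t : ℝ) : ℂ) * (starRingEnd ℂ) ((ξ : Cn n) j) *
          ((((quadR x u)⁻¹ ^ n : ℝ) : ℂ) -
            ((∑ k ∈ Finset.range M, geg n k x 1 * u ^ k : ℝ) : ℂ)))) := by
          push_cast; ring
    _ = _ := by
      rw [q1, q2]
      push_cast
      rw [inv_pow]
      field_simp
      ring

end Taylor

/-! ### Pointwise bounds of the Taylor remainder -/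

/-- The standing assumptions of the pointwise estimates: `ε = ±1` is the sign of `x`,
`r = |η - εξ|`, and `Q = |η - uξ|`. -/
structure GegData (x u ε r Q : ℝ) : Prop where
  abs_x : |x| ≤ 1
  u_pos : 0 < u
  sign_sq : ε ^ 2 = 1
  sign_mul : 0 ≤ ε * x
  r_nonneg : 0 ≤ r
  r_sq : r ^ 2 = 2 - 2 * ε * x
  Q_pos : 0 < Q
  Q_sq : Q ^ 2 = quadR x u

namespace GegData

variable {x u ε r Q : ℝ}

lemma sign_eq (h : GegData x u ε r Q) : ε = 1 ∨ ε = -1 := by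
  have := h.sign_sq
  rwa [sq, mul_self_eq_one_iff] at this

lemma abs_sign (h : GegData x u ε r Q) : |ε| = 1 := by
  rcases h.sign_eq with rfl | rfl <;> simp

lemma sqrt_le (h : GegData x u ε r Q) : √(1 - x ^ 2) ≤ Q := by
  rw [Real.sqrt_le_iff]
  refine ⟨h.Q_pos.le, ?_⟩
  rw [h.Q_sq, quadR]
  nlinarith [sq_nonneg (u - x)]

lemma r_le (h : GegData x u ε r Q) : r ≤ 2 * √(1 - x ^ 2) := by
  have hx := (sq_le_one_iff_abs_le_one x).2 h.abs_x
  refine abs_le_of_sq_le_sq' ?_ (by positivity) |>.2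
  rw [mul_pow, Real.sq_sqrt (by linarith), h.r_sq]
  have h2 : x ^ 2 = (ε * x) ^ 2 := by rw [mul_pow, h.sign_sq, one_mul]
  have h3 : ε * x ≤ 1 := by
    refine (abs_le_of_sq_le_sq' ?_ zero_le_one).2
    rw [← h2]; linarith
  rw [h2]
  nlinarith [mul_nonneg (sub_nonneg.2 h3) h.sign_mul]

lemma r_le' (h : GegData x u ε r Q) : r ≤ 2 * Q := h.r_le.trans (by linarith [h.sqrt_le])

lemma abs_sign_sub (h : GegData x u ε r Q) : |ε - u| ≤ 2 * Q := by
  have hx := abs_le.1 h.abs_x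
  have hm := h.sign_mul
  refine abs_le_of_sq_le_sq (?_ : (ε - u) ^ 2 ≤ _) (by linarith [h.Q_pos])
  rw [mul_pow, h.Q_sq, quadR]
  have hu := h.u_pos
  rcases h.sign_eq with rfl | rfl
  · nlinarith [sq_nonneg (1 - u), mul_nonneg hu.le (sub_nonneg.2 hx.2)]
  · nlinarith [sq_nonneg (1 - u), mul_nonneg hu.le (by linarith : 0 ≤ -x)]

lemma abs_one_sub_le (h : GegData x u ε r Q) : |1 - u| ≤ |ε - u| := by
  have hu := h.u_pos
  rcases h.sign_eq with rfl | rfl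
  · rfl
  · rw [abs_of_neg (by linarith : -1 - u < 0), abs_le]; constructor <;> linarith

lemma abs_one_sub (h : GegData x u ε r Q) : |1 - u| ≤ 2 * Q :=
  h.abs_one_sub_le.trans h.abs_sign_sub

lemma abs_two_mul_sub (h : GegData x u ε r Q) : |2 * x - 2 * ε| = r ^ 2 := by
  have : 2 * x - 2 * ε = -ε * (2 - 2 * ε * x) := by linear_combination (-2 * x) * h.sign_sq
  rw [this, abs_mul, abs_neg, h.abs_sign, one_mul, ← h.r_sq, abs_of_nonneg (sq_nonneg r)]

lemma r_mul_geg (h : GegData x u ε r Q) (m k : ℕ) :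
    r * |geg (m + 1) k x 1| ≤ 2 * ((k : ℝ) + 1) ^ (2 * m) := by
  calc _ ≤ 2 * √(1 - x ^ 2) * |geg (m + 1) k x 1| :=
        mul_le_mul_of_nonneg_right h.r_le (abs_nonneg _)
    _ ≤ _ := by
        rw [mul_assoc]
        exact mul_le_mul_of_nonneg_left (sqrt_mul_abs_geg_le h.abs_x m k) (by norm_num)

lemma abs_geg_le_pow (h : GegData x u ε r Q) (m k : ℕ) (hk : 1 ≤ k) :
    ((k : ℝ) + 1) * |geg m k x 1| ≤ ((k : ℝ) + 1) ^ (2 * m) := by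
  cases m with
  | zero => rw [geg_zero_left, if_neg (by omega)]; simp
  | succ m =>
    calc _ ≤ ((k : ℝ) + 1) * ((k : ℝ) + 1) ^ (2 * m + 1) :=
          mul_le_mul_of_nonneg_left (abs_geg_le h.abs_x m k) (by positivity)
      _ = _ := by ring

lemma rem_succ (h : GegData x u ε r Q) (m k : ℕ) :
    rem (m + 1) (k + 1) x u = (Q ^ 2)⁻¹ *
      ((geg (m + 1) (k + 1) x 1 - ε * geg (m + 1) k x 1) + (ε - u) * geg (m + 1) k x 1
        - geg m (k + 1) x 1 + rem m (k + 1) x u) := by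
  rw [rem, ← h.Q_sq, gegS_add_two]
  ring

lemma rem_diff (h : GegData x u ε r Q) (m k : ℕ) :
    rem (m + 1) (k + 2) x u - ε * rem (m + 1) (k + 1) x u = (Q ^ 2)⁻¹ *
      ((2 * x - 2 * ε) * geg (m + 1) (k + 1) x 1
        + (ε - u) * (geg (m + 1) (k + 1) x 1 - ε * geg (m + 1) k x 1)
        + ε * geg m (k + 1) x 1 + (rem m (k + 2) x u - ε * rem m (k + 1) x u)) := by
  have h1 := geg_rec m k x 1
  rw [h.rem_succ m (k + 1), h.rem_succ m k]
  linear_combination (Q ^ 2)⁻¹ * h1 + (Q ^ 2)⁻¹ * geg (m + 1) k x 1 * h.sign_sq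

end GegData

lemma le_of_inv_sq_mul {Q T B c : ℝ} (hQ : 0 < Q) (h : B ≤ c * Q) (hT : T = (Q ^ 2)⁻¹ * B) :
    T ≤ c * Q⁻¹ := by
  rw [hT]
  calc _ ≤ (Q ^ 2)⁻¹ * (c * Q) := mul_le_mul_of_nonneg_left h (by positivity)
    _ = _ := by field_simp

lemma natCast_add_pow_le (k j e : ℕ) (hj : 1 ≤ j) :
    ((k : ℝ) + (j + 1)) ^ e ≤ 2 ^ e * ((k : ℝ) + j) ^ e := by
  rw [← mul_pow]
  have : (1 : ℝ) ≤ j := by exact_mod_cast hj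
  gcongr
  have : (0 : ℝ) ≤ k := Nat.cast_nonneg k
  linarith

/-- The remainder near the poles. The factor `r = |η - εξ|`, comparable to `sin θ`, saves one power
of `k` in each term of the recursion defining `rem`; the term of lower index is absorbed because
`Q (k + 1)` is bounded from below. -/
lemma exists_r_mul_rem_le (m : ℕ) : ∃ c : ℝ, 0 ≤ c ∧ ∀ (k : ℕ) (x u ε r Q : ℝ),
    GegData x u ε r Q → 1 ≤ 4 * Q * (k + 1) →
    r * |rem m (k + 1) x u| * ((k : ℝ) + 1) ^ 2 ≤ c * ((k : ℝ) + 1) ^ (2 * m) * Q⁻¹ := by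
  induction m with
  | zero => exact ⟨0, le_rfl, fun k x u ε r Q h hk => by simp [rem]⟩
  | succ m ih =>
    obtain ⟨c, hc, ih⟩ := ih
    refine ⟨6 * 2 ^ (2 * m) + 4 + 2 * 2 ^ (2 * m) + 16 * c, by positivity,
      fun k x u ε r Q h hk => ?_⟩
    have ih' := ih k x u ε r Q h hk
    have hQ := h.Q_pos
    have hr := h.r_nonneg
    set K : ℝ := (k : ℝ) + 1 with hK
    have hK1 : (1 : ℝ) ≤ K := by rw [hK]; linarith [(Nat.cast_nonneg k : (0 : ℝ) ≤ k)]
    have b1 : |geg (m + 1) (k + 1) x 1 - ε * geg (m + 1) k x 1| ≤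
        3 * (2 ^ (2 * m) * K ^ (2 * m)) := by
      refine (abs_geg_succ_sub_le h.abs_x h.sign_sq h.sign_mul m k).trans ?_
      have := natCast_add_pow_le k 1 (2 * m) le_rfl
      norm_num at this
      rw [← mul_pow] at this ⊢
      gcongr
    have b2 := h.r_mul_geg m k
    have b3 : |geg m (k + 1) x 1| ≤ 2 ^ (2 * m) * K ^ (2 * m) := by
      have h3 := h.abs_geg_le_pow m (k + 1) (by omega)
      push_cast at h3
      calc _ ≤ ((k : ℝ) + 1 + 1) * |geg m (k + 1) x 1| :=
            le_mul_of_one_le_left (abs_nonneg _) (by linarith)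
        _ ≤ ((k : ℝ) + 1 + 1) ^ (2 * m) := h3
        _ ≤ _ := by rw [← mul_pow]; gcongr; linarith
    have b4 : r * |rem m (k + 1) x u| ≤ 16 * c * K ^ (2 * m) * Q := by
      have e1 : (1 : ℝ) ≤ 16 * Q ^ 2 * K ^ 2 := by nlinarith
      have e2 : r * |rem m (k + 1) x u| ≤ r * |rem m (k + 1) x u| * (16 * Q ^ 2 * K ^ 2) :=
        le_mul_of_one_le_right (by positivity) e1
      calc _ ≤ _ := e2
        _ = 16 * Q ^ 2 * (r * |rem m (k + 1) x u| * K ^ 2) := by ring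
        _ ≤ 16 * Q ^ 2 * (c * K ^ (2 * m) * Q⁻¹) := by gcongr
        _ = _ := by field_simp
    have hb : r * |rem (m + 1) (k + 1) x u| ≤
        ((6 * 2 ^ (2 * m) + 4 + 2 * 2 ^ (2 * m) + 16 * c) * K ^ (2 * m)) * Q⁻¹ := by
      refine le_of_inv_sq_mul hQ (B := r * |(geg (m + 1) (k + 1) x 1 - ε * geg (m + 1) k x 1) +
        (ε - u) * geg (m + 1) k x 1 - geg m (k + 1) x 1 + rem m (k + 1) x u|) ?_ ?_
      · have t1 := abs_add_le (geg (m + 1) (k + 1) x 1 - ε * geg (m + 1) k x 1 +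
          (ε - u) * geg (m + 1) k x 1 - geg m (k + 1) x 1) (rem m (k + 1) x u)
        have t2 := abs_sub (geg (m + 1) (k + 1) x 1 - ε * geg (m + 1) k x 1 +
          (ε - u) * geg (m + 1) k x 1) (geg m (k + 1) x 1)
        have t3 := abs_add_le (geg (m + 1) (k + 1) x 1 - ε * geg (m + 1) k x 1)
          ((ε - u) * geg (m + 1) k x 1)
        rw [abs_mul (ε - u)] at t3
        calc _ ≤ r * (|geg (m + 1) (k + 1) x 1 - ε * geg (m + 1) k x 1| +
              |ε - u| * |geg (m + 1) k x 1| + |geg m (k + 1) x 1| + |rem m (k + 1) x u|) := by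
              gcongr; linarith
          _ = r * |geg (m + 1) (k + 1) x 1 - ε * geg (m + 1) k x 1| +
              |ε - u| * (r * |geg (m + 1) k x 1|) + r * |geg m (k + 1) x 1|
              + r * |rem m (k + 1) x u| := by ring
          _ ≤ (2 * Q) * (3 * (2 ^ (2 * m) * K ^ (2 * m))) + (2 * Q) * (2 * K ^ (2 * m)) +
              (2 * Q) * (2 ^ (2 * m) * K ^ (2 * m)) + 16 * c * K ^ (2 * m) * Q := by
              gcongr
              · exact h.r_le'
              · exact h.abs_sign_sub
              · exact h.r_le'
          _ = _ := by ring
      · rw [h.rem_succ m k, abs_mul, abs_of_nonneg (by positivity : 0 ≤ (Q ^ 2)⁻¹)]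
        ring
    calc _ ≤ ((6 * 2 ^ (2 * m) + 4 + 2 * 2 ^ (2 * m) + 16 * c) * K ^ (2 * m)) * Q⁻¹ * K ^ 2 := by
          gcongr
      _ = _ := by rw [mul_add 2 m 1, pow_add]; ring

/-- Signed differences of consecutive remainders satisfy the same bound as `r` times a remainder. -/
lemma exists_rem_diff_le (m : ℕ) : ∃ c : ℝ, 0 ≤ c ∧ ∀ (k : ℕ) (x u ε r Q : ℝ),
    GegData x u ε r Q → 1 ≤ 2 * Q * (k + 2) →
    |rem m (k + 2) x u - ε * rem m (k + 1) x u| * ((k : ℝ) + 2) ^ 2 ≤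
      c * ((k : ℝ) + 2) ^ (2 * m) * Q⁻¹ := by
  induction m with
  | zero => exact ⟨0, le_rfl, fun k x u ε r Q h hk => by simp [rem]⟩
  | succ m ih =>
    obtain ⟨c, hc, ih⟩ := ih
    refine ⟨4 + 6 + 2 + 4 * c, by positivity, fun k x u ε r Q h hk => ?_⟩
    have ih' := ih k x u ε r Q h hk
    have hQ := h.Q_pos
    have hr := h.r_nonneg
    set K : ℝ := (k : ℝ) + 2 with hK
    have hK1 : (1 : ℝ) ≤ K := by rw [hK]; linarith [(Nat.cast_nonneg k : (0 : ℝ) ≤ k)]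
    have b1 : |geg (m + 1) (k + 1) x 1 - ε * geg (m + 1) k x 1| ≤ 3 * K ^ (2 * m) :=
      abs_geg_succ_sub_le h.abs_x h.sign_sq h.sign_mul m k
    have b2 : r * |geg (m + 1) (k + 1) x 1| ≤ 2 * K ^ (2 * m) := by
      have := h.r_mul_geg m (k + 1)
      push_cast at this
      rwa [add_assoc, one_add_one_eq_two] at this
    have b3 : |geg m (k + 1) x 1| ≤ 2 * Q * K ^ (2 * m) := by
      have h3 := h.abs_geg_le_pow m (k + 1) (by omega)
      push_cast at h3
      rw [add_assoc, one_add_one_eq_two] at h3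
      calc _ ≤ (2 * Q * K) * |geg m (k + 1) x 1| :=
            le_mul_of_one_le_left (abs_nonneg _) hk
        _ = 2 * Q * (K * |geg m (k + 1) x 1|) := by ring
        _ ≤ _ := by gcongr
    have b4 : |rem m (k + 2) x u - ε * rem m (k + 1) x u| ≤ 4 * c * K ^ (2 * m) * Q := by
      have e1 : (1 : ℝ) ≤ 4 * Q ^ 2 * K ^ 2 := by nlinarith
      have e2 : |rem m (k + 2) x u - ε * rem m (k + 1) x u| ≤
          |rem m (k + 2) x u - ε * rem m (k + 1) x u| * (4 * Q ^ 2 * K ^ 2) :=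
        le_mul_of_one_le_right (by positivity) e1
      calc _ ≤ _ := e2
        _ = 4 * Q ^ 2 * (|rem m (k + 2) x u - ε * rem m (k + 1) x u| * K ^ 2) := by ring
        _ ≤ 4 * Q ^ 2 * (c * K ^ (2 * m) * Q⁻¹) := by gcongr
        _ = _ := by field_simp
    have hb : |rem (m + 1) (k + 2) x u - ε * rem (m + 1) (k + 1) x u| ≤
        ((4 + 6 + 2 + 4 * c) * K ^ (2 * m)) * Q⁻¹ := by
      refine le_of_inv_sq_mul hQ (B := |(2 * x - 2 * ε) * geg (m + 1) (k + 1) x 1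
        + (ε - u) * (geg (m + 1) (k + 1) x 1 - ε * geg (m + 1) k x 1)
        + ε * geg m (k + 1) x 1 + (rem m (k + 2) x u - ε * rem m (k + 1) x u)|) ?_ ?_
      · have t1 := abs_add_le ((2 * x - 2 * ε) * geg (m + 1) (k + 1) x 1
          + (ε - u) * (geg (m + 1) (k + 1) x 1 - ε * geg (m + 1) k x 1)
          + ε * geg m (k + 1) x 1) (rem m (k + 2) x u - ε * rem m (k + 1) x u)
        have t2 := abs_add_le ((2 * x - 2 * ε) * geg (m + 1) (k + 1) x 1
          + (ε - u) * (geg (m + 1) (k + 1) x 1 - ε * geg (m + 1) k x 1)) (ε * geg m (k + 1) x 1)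
        have t3 := abs_add_le ((2 * x - 2 * ε) * geg (m + 1) (k + 1) x 1)
          ((ε - u) * (geg (m + 1) (k + 1) x 1 - ε * geg (m + 1) k x 1))
        rw [abs_mul (ε - u), abs_mul (2 * x - 2 * ε), h.abs_two_mul_sub] at t3
        rw [abs_mul ε, h.abs_sign, one_mul] at t2
        calc _ ≤ r * (r * |geg (m + 1) (k + 1) x 1|) +
              |ε - u| * |geg (m + 1) (k + 1) x 1 - ε * geg (m + 1) k x 1| +
              |geg m (k + 1) x 1| + |rem m (k + 2) x u - ε * rem m (k + 1) x u| := by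
              linarith
          _ ≤ (2 * Q) * (2 * K ^ (2 * m)) + (2 * Q) * (3 * K ^ (2 * m)) +
              2 * Q * K ^ (2 * m) + 4 * c * K ^ (2 * m) * Q := by
              gcongr
              · exact h.r_le'
              · exact h.abs_sign_sub
          _ = _ := by ring
      · rw [h.rem_diff m k, abs_mul, abs_of_nonneg (by positivity : 0 ≤ (Q ^ 2)⁻¹)]
    calc _ ≤ ((4 + 6 + 2 + 4 * c) * K ^ (2 * m)) * Q⁻¹ * K ^ 2 := by
          gcongr
      _ = _ := by rw [mul_add 2 m 1, pow_add]; ring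

lemma exists_rem_one_le (m : ℕ) : ∃ c : ℝ, 0 ≤ c ∧ ∀ (x u ε r Q : ℝ),
    GegData x u ε r Q → 1 ≤ 2 * Q → |rem m 1 x u| ≤ c * Q⁻¹ := by
  induction m with
  | zero => exact ⟨0, le_rfl, fun x u ε r Q h hk => by simp [rem]⟩
  | succ m ih =>
    obtain ⟨c, hc, ih⟩ := ih
    refine ⟨8 + 4 * c, by positivity, fun x u ε r Q h hk => ?_⟩
    have hQ := h.Q_pos
    have ih' := ih x u ε r Q h hk
    have h1 := abs_le.1 h.abs_one_sub
    have hu := h.u_pos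
    have h2 := abs_le.1 h.abs_x
    have h3 : |rem m 1 x u| ≤ 4 * c * Q := by
      calc _ ≤ c * Q⁻¹ := ih'
        _ ≤ c * Q⁻¹ * (2 * Q) ^ 2 := le_mul_of_one_le_right (by positivity) (by nlinarith)
        _ = _ := by field_simp; ring
    refine le_of_inv_sq_mul hQ (B := |2 * x - u + rem m 1 x u|) ?_ ?_
    · have h4 : |2 * x - u| ≤ 8 * Q := abs_le.2 ⟨by linarith, by linarith⟩
      linarith [abs_add_le (2 * x - u) (rem m 1 x u)]
    · rw [rem, gegS_add_two, geg_rec_one, geg_zero_right, ← h.Q_sq, abs_mul,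
        abs_of_nonneg (by positivity : 0 ≤ (Q ^ 2)⁻¹)]
      congr 2; ring

lemma rem_zero_right (m : ℕ) (x u : ℝ) : rem m 0 x u = (quadR x u)⁻¹ ^ m := by
  induction m with
  | zero => simp [rem]
  | succ m ih => simp [rem, ih, pow_succ']

/-- The pointwise bound of the kernel away from the diagonal. In `a rem_{k+1} - b rem_k` the two
remainders are first compared up to the sign `ε`; what is left is `(εa - b) rem_k`, and
`|εa - b| ≤ r` compensates the growth of a single remainder. -/
lemma exists_comb_le (m : ℕ) : ∃ c : ℝ, 0 < c ∧ ∀ (k : ℕ) (x u ε r Q : ℝ) (a b : ℂ),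
    GegData x u ε r Q → 1 ≤ 2 * Q * (k + 1) → ‖a‖ ≤ 1 → ‖b‖ ≤ 1 → ‖ε * a - b‖ ≤ r →
    ‖a * (rem (m + 1) (k + 1) x u : ℝ) - b * (rem (m + 1) k x u : ℝ)‖ ≤
      c * ((k : ℝ) + 1) ^ (2 * m) * Q⁻¹ := by
  obtain ⟨c1, hc1, H1⟩ := exists_r_mul_rem_le (m + 1)
  obtain ⟨c2, hc2, H2⟩ := exists_rem_diff_le (m + 1)
  obtain ⟨c3, hc3, H3⟩ := exists_rem_one_le (m + 1)
  refine ⟨4 * c1 + c2 + c3 + 2 ^ (2 * m + 1) , by positivity,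
    fun k x u ε r Q a b h hk ha hb hab => ?_⟩
  have hQ := h.Q_pos
  cases k with
  | zero =>
    have hk' : 1 ≤ 2 * Q := by simpa using hk
    have h3 := H3 x u ε r Q h hk'
    have h0 : |rem (m + 1) 0 x u| ≤ 2 ^ (2 * m + 1) * Q⁻¹ := by
      rw [rem_zero_right, ← h.Q_sq, abs_of_nonneg (by positivity), ← inv_pow, ← pow_mul,
        show 2 * (m + 1) = (2 * m + 1) + 1 by ring, pow_succ]
      gcongr
      rw [inv_le_comm₀ hQ (by norm_num)]
      linarith
    refine (norm_sub_le _ _).trans ?_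
    rw [norm_mul, norm_mul, Complex.norm_real, Complex.norm_real, Real.norm_eq_abs,
      Real.norm_eq_abs, zero_add]
    calc _ ≤ 1 * (c3 * Q⁻¹) + 1 * (2 ^ (2 * m + 1) * Q⁻¹) := by gcongr
      _ ≤ _ := by
        simp only [Nat.cast_zero, zero_add, one_pow, mul_one, one_mul]
        rw [← add_mul]
        gcongr
        linarith
  | succ k =>
    have hk' : 1 ≤ 2 * Q * ((k : ℝ) + 2) := by push_cast at hk; linarith
    have h2 := H2 k x u ε r Q h hk'
    have hk0 : (0 : ℝ) ≤ k := Nat.cast_nonneg k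
    set K : ℝ := (k : ℝ) + 2 with hK
    have hK0 : 0 < K := by rw [hK]; linarith
    have h2' : |rem (m + 1) (k + 2) x u - ε * rem (m + 1) (k + 1) x u| ≤
        c2 * K ^ (2 * m) * Q⁻¹ := by
      refine le_of_mul_le_mul_right (h2.trans_eq ?_) (by positivity : 0 < K ^ 2)
      rw [mul_add 2 m 1, pow_add]; ring
    have h1' : r * |rem (m + 1) (k + 1) x u| ≤ 4 * c1 * K ^ (2 * m) * Q⁻¹ := by
      have hk1 : 1 ≤ 4 * Q * ((k : ℝ) + 1) := by nlinarith
      have h1 := H1 k x u ε r Q h hk1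
      have h3 : r * |rem (m + 1) (k + 1) x u| ≤ c1 * ((k : ℝ) + 1) ^ (2 * m) * Q⁻¹ := by
        refine le_of_mul_le_mul_right (h1.trans_eq ?_) (by positivity : 0 < ((k : ℝ) + 1) ^ 2)
        rw [mul_add 2 m 1, pow_add]; ring
      refine h3.trans ?_
      gcongr
      · linarith
      · rw [hK]; linarith
    have e : a * (rem (m + 1) (k + 1 + 1) x u : ℝ) - b * (rem (m + 1) (k + 1) x u : ℝ) =
        a * ((rem (m + 1) (k + 2) x u - ε * rem (m + 1) (k + 1) x u : ℝ) : ℂ) +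
        (ε * a - b) * (rem (m + 1) (k + 1) x u : ℝ) := by push_cast; ring
    rw [e]
    refine (norm_add_le _ _).trans ?_
    rw [norm_mul, norm_mul, Complex.norm_real, Complex.norm_real, Real.norm_eq_abs,
      Real.norm_eq_abs]
    calc _ ≤ 1 * (c2 * K ^ (2 * m) * Q⁻¹) + r * |rem (m + 1) (k + 1) x u| := by gcongr
      _ ≤ 1 * (c2 * K ^ (2 * m) * Q⁻¹) + 4 * c1 * K ^ (2 * m) * Q⁻¹ := by gcongr
      _ = (4 * c1 + c2) * K ^ (2 * m) * Q⁻¹ := by ring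
      _ ≤ _ := by
        push_cast
        rw [add_assoc (k : ℝ), one_add_one_eq_two, ← hK]
        have : (0 : ℝ) ≤ 2 ^ (2 * m + 1) := by positivity
        exact mul_le_mul_of_nonneg_right (mul_le_mul_of_nonneg_right (by linarith) (by positivity))
          (by positivity)

/-- The pointwise bound of the remainder where `|sin θ| ≥ 1 / (k + 1)`: every factor `sin θ` saves a
power of `k`. -/
lemma exists_sqrt_pow_mul_rem_le (m : ℕ) : ∃ c : ℝ, 0 ≤ c ∧ ∀ (k : ℕ) (x u ε r Q : ℝ),
    GegData x u ε r Q → 1 ≤ √(1 - x ^ 2) * (k + 1) →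
    √(1 - x ^ 2) ^ m * |rem m (k + 1) x u| * ((k : ℝ) + 1) ≤ c * ((k : ℝ) + 1) ^ m * Q⁻¹ := by
  induction m with
  | zero => exact ⟨0, le_rfl, fun k x u ε r Q h hk => by simp [rem]⟩
  | succ m ih =>
    obtain ⟨c, hc, ih⟩ := ih
    refine ⟨3 * 2 ^ m + 2 + 2 ^ m + c, by positivity, fun k x u ε r Q h hk => ?_⟩
    have ih' := ih k x u ε r Q h hk
    have hQ := h.Q_pos
    have hs0 : 0 ≤ √(1 - x ^ 2) := Real.sqrt_nonneg _
    have hsQ := h.sqrt_le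
    have b1 := sqrt_pow_mul_abs_geg_succ_sub_le h.abs_x h.sign_sq h.sign_mul m k
    have b2 := sqrt_pow_mul_abs_geg_le h.abs_x m k
    set s := √(1 - x ^ 2) with hs
    have hk0 : (0 : ℝ) ≤ k := Nat.cast_nonneg k
    set K : ℝ := (k : ℝ) + 1 with hK
    have hK1 : (1 : ℝ) ≤ K := by rw [hK]; linarith
    have hK2 : ((k : ℝ) + 2) ^ m ≤ 2 ^ m * K ^ m := by
      rw [← mul_pow]; gcongr; rw [hK]; linarith
    have b3 : s ^ (m + 1) * |geg m (k + 1) x 1| ≤ s * (2 ^ m * K ^ m) := by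
      rw [pow_succ', mul_assoc]
      refine mul_le_mul_of_nonneg_left ?_ hs0
      cases m with
      | zero => simp [geg_zero_left]
      | succ m =>
        have := sqrt_pow_mul_abs_geg_le h.abs_x m (k + 1)
        push_cast at this
        rw [add_assoc, one_add_one_eq_two] at this
        refine this.trans (le_trans ?_ hK2)
        exact pow_le_pow_right₀ (by linarith) (Nat.le_succ m)
    have b4 : s ^ (m + 1) * |rem m (k + 1) x u| ≤ c * K ^ m * Q := by
      have e1 : 1 ≤ Q * K := hk.trans (by gcongr)
      calc _ = s * (s ^ m * |rem m (k + 1) x u|) := by ring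
        _ ≤ Q * (s ^ m * |rem m (k + 1) x u| * (Q * K)) :=
          mul_le_mul hsQ (le_mul_of_one_le_right (by positivity) e1) (by positivity) hQ.le
        _ = Q ^ 2 * (s ^ m * |rem m (k + 1) x u| * K) := by ring
        _ ≤ Q ^ 2 * (c * K ^ m * Q⁻¹) := by gcongr
        _ = _ := by field_simp
    have hb : s ^ (m + 1) * |rem (m + 1) (k + 1) x u| ≤
        ((3 * 2 ^ m + 2 + 2 ^ m + c) * K ^ m) * Q⁻¹ := by
      refine le_of_inv_sq_mul hQ (B := s ^ (m + 1) *
        |(geg (m + 1) (k + 1) x 1 - ε * geg (m + 1) k x 1) +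
        (ε - u) * geg (m + 1) k x 1 - geg m (k + 1) x 1 + rem m (k + 1) x u|) ?_ ?_
      · have t1 := abs_add_le (geg (m + 1) (k + 1) x 1 - ε * geg (m + 1) k x 1 +
          (ε - u) * geg (m + 1) k x 1 - geg m (k + 1) x 1) (rem m (k + 1) x u)
        have t2 := abs_sub (geg (m + 1) (k + 1) x 1 - ε * geg (m + 1) k x 1 +
          (ε - u) * geg (m + 1) k x 1) (geg m (k + 1) x 1)
        have t3 := abs_add_le (geg (m + 1) (k + 1) x 1 - ε * geg (m + 1) k x 1)
          ((ε - u) * geg (m + 1) k x 1)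
        rw [abs_mul (ε - u)] at t3
        calc _ ≤ s ^ (m + 1) * (|geg (m + 1) (k + 1) x 1 - ε * geg (m + 1) k x 1| +
              |ε - u| * |geg (m + 1) k x 1| + |geg m (k + 1) x 1| + |rem m (k + 1) x u|) := by
              gcongr; linarith
          _ = s ^ (m + 1) * |geg (m + 1) (k + 1) x 1 - ε * geg (m + 1) k x 1| +
              |ε - u| * (s ^ (m + 1) * |geg (m + 1) k x 1|) +
              s ^ (m + 1) * |geg m (k + 1) x 1| + s ^ (m + 1) * |rem m (k + 1) x u| := by ring
          _ ≤ (3 * Q) * (2 ^ m * K ^ m) + (2 * Q) * K ^ m + Q * (2 ^ m * K ^ m)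
              + c * K ^ m * Q := by
              have b1' := b1.trans (mul_le_mul (mul_le_mul_of_nonneg_left hsQ
                (by norm_num : (0 : ℝ) ≤ 3)) hK2 (by positivity) (by positivity))
              have b2' := mul_le_mul h.abs_sign_sub b2 (by positivity) (by positivity)
              have b3' := b3.trans (mul_le_mul_of_nonneg_right hsQ
                (by positivity : 0 ≤ 2 ^ m * K ^ m))
              linarith
          _ = _ := by ring
      · rw [h.rem_succ m k, abs_mul, abs_of_nonneg (by positivity : 0 ≤ (Q ^ 2)⁻¹)]
        ring
    calc _ ≤ ((3 * 2 ^ m + 2 + 2 ^ m + c) * K ^ m) * Q⁻¹ * K := by gcongr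
      _ = _ := by ring

/-! ### Bounded kernels and their norms on `L²` -/

section Kernels

variable {X : Type*} [MeasurableSpace X] (μ : Measure X)

/-- A bounded measurable kernel. -/
structure BddKernel {X : Type*} [MeasurableSpace X] (K : X → X → ℂ) : Prop where
  meas : Measurable (Function.uncurry K)
  bdd : ∃ B : ℝ, 0 ≤ B ∧ ∀ ξ η, ‖K ξ η‖ ≤ B

/-- The scalar integral operator with kernel `K`. -/
def kop (K : X → X → ℂ) (f : X → ℂ) (ξ : X) : ℂ := ∫ η, K ξ η * f η ∂μ

/-- The `L²` norm as a real number. -/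
def l2 (f : X → ℂ) : ℝ := √(∫ x, ‖f x‖ ^ 2 ∂μ)

/-- The bilinear form of a kernel. -/
def kform (K : X → X → ℂ) (f g : X → ℂ) : ℂ := ∫ ξ, kop μ K f ξ * g ξ ∂μ

/-- The bounded kernel `K` has norm at most `M` on `L²`, expressed through its bilinear form. -/
structure OpBound (K : X → X → ℂ) (M : ℝ) : Prop extends BddKernel K where
  nonneg : 0 ≤ M
  le : ∀ f g : X → ℂ, MemLp f 2 μ → MemLp g 2 μ → ‖kform μ K f g‖ ≤ M * l2 μ f * l2 μ g

variable {μ}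

lemma l2_nonneg (f : X → ℂ) : 0 ≤ l2 μ f := Real.sqrt_nonneg _

lemma l2_sq (f : X → ℂ) : l2 μ f ^ 2 = ∫ x, ‖f x‖ ^ 2 ∂μ :=
  Real.sq_sqrt (integral_nonneg fun _ => sq_nonneg _)

lemma integrable_norm_sq {f : X → ℂ} (hf : MemLp f 2 μ) : Integrable (fun x => ‖f x‖ ^ 2) μ :=
  (memLp_two_iff_integrable_sq_norm hf.1).1 hf

lemma memLp_mul_bdd {f c : X → ℂ} (hf : MemLp f 2 μ) (hc : AEStronglyMeasurable c μ) {A : ℝ}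
    (hA : ∀ x, ‖c x‖ ≤ A) : MemLp (fun x => c x * f x) 2 μ := by
  refine MemLp.of_le_mul (c := A) hf (hc.mul hf.1) (Filter.Eventually.of_forall fun x => ?_)
  rw [norm_mul]
  exact mul_le_mul_of_nonneg_right (hA x) (norm_nonneg _)

lemma l2_mul_le {f c : X → ℂ} (hf : MemLp f 2 μ) {A : ℝ} (hA0 : 0 ≤ A)
    (hA : ∀ x, ‖c x‖ ≤ A) : l2 μ (fun x => c x * f x) ≤ A * l2 μ f := by
  refine Real.sqrt_le_iff.2 ⟨mul_nonneg hA0 (l2_nonneg f), ?_⟩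
  rw [mul_pow, l2_sq, ← integral_const_mul]
  refine integral_mono_of_nonneg (Filter.Eventually.of_forall fun x => sq_nonneg _)
    ((integrable_norm_sq hf).const_mul _) (Filter.Eventually.of_forall fun x => ?_)
  simp only [norm_mul, mul_pow]
  have := hA x
  gcongr

lemma BddKernel.integrable {K : X → X → ℂ} (hK : BddKernel K) {f : X → ℂ} (hf : Integrable f μ)
    (ξ : X) : Integrable (fun η => K ξ η * f η) μ := by
  obtain ⟨B, hB0, hB⟩ := hK.bdd
  refine hf.bdd_mul (c := B) ?_ (Filter.Eventually.of_forall fun η => hB ξ η)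
  exact (hK.meas.comp measurable_prodMk_left).aestronglyMeasurable

lemma kop_congr {K : X → X → ℂ} {f f' : X → ℂ} (h : f =ᵐ[μ] f') : kop μ K f = kop μ K f' := by
  funext ξ
  refine integral_congr_ae ?_
  filter_upwards [h] with η hη
  rw [hη]

lemma BddKernel.stronglyMeasurable_kop [SFinite μ] {K : X → X → ℂ} (hK : BddKernel K) {f : X → ℂ}
    (hf : AEStronglyMeasurable f μ) : StronglyMeasurable (kop μ K f) := by
  rw [kop_congr hf.ae_eq_mk]
  refine StronglyMeasurable.integral_prod_right (f := fun ξ η => K ξ η * hf.mk f η) ?_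
  exact (hK.meas.stronglyMeasurable).mul
    (hf.stronglyMeasurable_mk.comp_measurable measurable_snd)

lemma norm_kop_le {K : X → X → ℂ} {B : ℝ} (hB : ∀ ξ η, ‖K ξ η‖ ≤ B)
    {f : X → ℂ} (hf : Integrable f μ) (ξ : X) : ‖kop μ K f ξ‖ ≤ B * ∫ η, ‖f η‖ ∂μ := by
  rw [kop, ← integral_const_mul]
  refine norm_integral_le_of_norm_le (hf.norm.const_mul B) (Filter.Eventually.of_forall fun η => ?_)
  rw [norm_mul]
  exact mul_le_mul_of_nonneg_right (hB ξ η) (norm_nonneg _)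

variable [IsFiniteMeasure μ]

lemma integrable_of_memLp_two {f : X → ℂ} (hf : MemLp f 2 μ) : Integrable f μ :=
  hf.integrable (by norm_num)

lemma BddKernel.memLp_kop {K : X → X → ℂ} (hK : BddKernel K) {f : X → ℂ}
    (hf : Integrable f μ) (p : ℝ≥0∞) : MemLp (kop μ K f) p μ := by
  obtain ⟨B, hB0, hB⟩ := hK.bdd
  exact MemLp.of_bound (hK.stronglyMeasurable_kop hf.1).aestronglyMeasurable _
    (Filter.Eventually.of_forall (norm_kop_le hB hf))

lemma BddKernel.integrable_form {K : X → X → ℂ} (hK : BddKernel K) {f g : X → ℂ}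
    (hf : Integrable f μ) (hg : Integrable g μ) : Integrable (fun ξ => kop μ K f ξ * g ξ) μ := by
  obtain ⟨B, hB0, hB⟩ := hK.bdd
  exact hg.bdd_mul (hK.stronglyMeasurable_kop hf.1).aestronglyMeasurable
    (Filter.Eventually.of_forall (norm_kop_le hB hf))

lemma BddKernel.integrable_prod {K : X → X → ℂ} (hK : BddKernel K) {f g : X → ℂ}
    (hf : Integrable f μ) (hg : Integrable g μ) :
    Integrable (fun p : X × X => K p.1 p.2 * (f p.2 * g p.1)) (μ.prod μ) := by
  obtain ⟨B, hB0, hB⟩ := hK.bdd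
  have h := (hg.mul_prod hf).congr (Filter.Eventually.of_forall fun p => mul_comm _ _)
  exact h.bdd_mul (c := B) hK.meas.aestronglyMeasurable
    (Filter.Eventually.of_forall fun p => hB p.1 p.2)

lemma kform_eq_prod {K : X → X → ℂ} (hK : BddKernel K) {f g : X → ℂ}
    (hf : Integrable f μ) (hg : Integrable g μ) :
    kform μ K f g = ∫ p : X × X, K p.1 p.2 * (f p.2 * g p.1) ∂(μ.prod μ) := by
  rw [integral_prod _ (hK.integrable_prod hf hg)]
  refine integral_congr_ae (Filter.Eventually.of_forall fun ξ => ?_)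
  simp only [kop]
  rw [← integral_mul_const]
  simp only [mul_assoc]

lemma BddKernel.add {K L : X → X → ℂ} (hK : BddKernel K) (hL : BddKernel L) :
    BddKernel (fun ξ η => K ξ η + L ξ η) := by
  obtain ⟨B, hB0, hB⟩ := hK.bdd
  obtain ⟨C, hC0, hC⟩ := hL.bdd
  exact ⟨hK.meas.add hL.meas, B + C, by positivity, fun ξ η =>
    (norm_add_le _ _).trans (add_le_add (hB ξ η) (hC ξ η))⟩

lemma BddKernel.mul {K L : X → X → ℂ} (hK : BddKernel K) (hL : BddKernel L) :
    BddKernel (fun ξ η => K ξ η * L ξ η) := by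
  obtain ⟨B, hB0, hB⟩ := hK.bdd
  obtain ⟨C, hC0, hC⟩ := hL.bdd
  exact ⟨hK.meas.mul hL.meas, B * C, by positivity, fun ξ η =>
    (norm_mul_le _ _).trans (mul_le_mul (hB ξ η) (hC ξ η) (norm_nonneg _) hB0)⟩

lemma BddKernel.of_left {c : X → ℂ} (hc : Measurable c) {A : ℝ} (hA0 : 0 ≤ A)
    (hA : ∀ x, ‖c x‖ ≤ A) : BddKernel (fun ξ _ : X => c ξ) :=
  ⟨hc.comp measurable_fst, A, hA0, fun ξ _ => hA ξ⟩

lemma BddKernel.of_right {c : X → ℂ} (hc : Measurable c) {A : ℝ} (hA0 : 0 ≤ A)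
    (hA : ∀ x, ‖c x‖ ≤ A) : BddKernel (fun _ η : X => c η) :=
  ⟨hc.comp measurable_snd, A, hA0, fun _ η => hA η⟩

lemma OpBound.mono {K : X → X → ℂ} {M M' : ℝ} (h : OpBound μ K M) (hM : M ≤ M') :
    OpBound μ K M' where
  toBddKernel := h.toBddKernel
  nonneg := h.nonneg.trans hM
  le f g hf hg := (h.le f g hf hg).trans (by
    have := l2_nonneg (μ := μ) f
    have := l2_nonneg (μ := μ) g
    gcongr)

lemma OpBound.congr {K K' : X → X → ℂ} {M : ℝ} (h : OpBound μ K M)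
    (he : ∀ ξ η, K ξ η = K' ξ η) : OpBound μ K' M := by
  have : K = K' := by funext ξ η; exact he ξ η
  rwa [← this]

lemma OpBound.add {K L : X → X → ℂ} {M M' : ℝ} (hK : OpBound μ K M) (hL : OpBound μ L M') :
    OpBound μ (fun ξ η => K ξ η + L ξ η) (M + M') where
  toBddKernel := hK.toBddKernel.add hL.toBddKernel
  nonneg := add_nonneg hK.nonneg hL.nonneg
  le f g hf hg := by
    have hf1 := integrable_of_memLp_two hf
    have hg1 := integrable_of_memLp_two hg
    have e : kform μ (fun ξ η => K ξ η + L ξ η) f g = kform μ K f g + kform μ L f g := by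
      rw [kform_eq_prod (hK.toBddKernel.add hL.toBddKernel) hf1 hg1,
        kform_eq_prod hK.toBddKernel hf1 hg1, kform_eq_prod hL.toBddKernel hf1 hg1,
        ← integral_add (hK.integrable_prod hf1 hg1) (hL.integrable_prod hf1 hg1)]
      simp only [add_mul]
    rw [e]
    refine (norm_add_le _ _).trans ?_
    have h1 := hK.le f g hf hg
    have h2 := hL.le f g hf hg
    linarith

/-- Multiplying a kernel by bounded functions of each variable. -/
lemma OpBound.mul_both {K : X → X → ℂ} {M : ℝ} (hK : OpBound μ K M) {a b : X → ℂ}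
    (ha : Measurable a) (hb : Measurable b) {A B : ℝ} (hA0 : 0 ≤ A) (hB0 : 0 ≤ B)
    (hA : ∀ x, ‖a x‖ ≤ A) (hB : ∀ x, ‖b x‖ ≤ B) :
    OpBound μ (fun ξ η => a ξ * b η * K ξ η) (A * B * M) where
  toBddKernel := ((BddKernel.of_left ha hA0 hA).mul (BddKernel.of_right hb hB0 hB)).mul
    hK.toBddKernel
  nonneg := by have := hK.nonneg; positivity
  le f g hf hg := by
    have e : kform μ (fun ξ η => a ξ * b η * K ξ η) f g =
        kform μ K (fun x => b x * f x) (fun x => a x * g x) := by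
      simp only [kform, kop]
      refine integral_congr_ae (Filter.Eventually.of_forall fun ξ => ?_)
      have : ∀ η, a ξ * b η * K ξ η * f η = a ξ * (K ξ η * (b η * f η)) := fun η => by ring
      simp only [this]
      rw [integral_const_mul]
      ring
    rw [e]
    refine (hK.le _ _ (memLp_mul_bdd hf hb.aestronglyMeasurable hB)
      (memLp_mul_bdd hg ha.aestronglyMeasurable hA)).trans ?_
    have h1 := l2_mul_le hf hB0 hB
    have h2 := l2_mul_le hg hA0 hA
    have := hK.nonneg
    calc _ ≤ M * (B * l2 μ f) * (A * l2 μ g) := by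
          have := l2_nonneg (μ := μ) f
          have := l2_nonneg (μ := μ) (fun x => a x * g x)
          gcongr
      _ = _ := by ring

lemma OpBound.const_mul {K : X → X → ℂ} {M : ℝ} (hK : OpBound μ K M) (c : ℂ) :
    OpBound μ (fun ξ η => c * K ξ η) (‖c‖ * M) := by
  have := hK.mul_both (a := fun _ => c) (b := fun _ => 1) measurable_const measurable_const
    (norm_nonneg c) zero_le_one (fun _ => le_rfl) (fun _ => by simp)
  simpa using this

lemma OpBound.sub {K L : X → X → ℂ} {M M' : ℝ} (hK : OpBound μ K M) (hL : OpBound μ L M') :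
    OpBound μ (fun ξ η => K ξ η - L ξ η) (M + M') := by
  have := hK.add (hL.const_mul (-1))
  simpa [sub_eq_add_neg] using this

lemma opBound_zero : OpBound μ (fun _ _ => 0) 0 where
  meas := measurable_const
  bdd := ⟨0, le_rfl, fun _ _ => by simp⟩
  nonneg := le_rfl
  le f g _ _ := by simp [kform, kop]

lemma OpBound.sum {K : ℕ → X → X → ℂ} {M : ℝ} (m : ℕ) (hK : ∀ i < m, OpBound μ (K i) M) :
    OpBound μ (fun ξ η => ∑ i ∈ Finset.range m, K i ξ η) (m * M) := by
  induction m with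
  | zero => simpa using opBound_zero
  | succ m ih =>
    have := (ih fun i hi => hK i (by omega)).add (hK m (by omega))
    simp only [Finset.sum_range_succ]
    convert this using 1
    push_cast; ring

lemma OpBound.of_forall_add {K : X → X → ℂ} {M : ℝ} (hM : 0 ≤ M)
    (h : ∀ δ : ℝ, 0 < δ → OpBound μ K (M + δ)) : OpBound μ K M where
  toBddKernel := (h 1 one_pos).toBddKernel
  nonneg := hM
  le f g hf hg := by
    have hc : Filter.Tendsto (fun δ : ℝ => (M + δ) * l2 μ f * l2 μ g) (nhdsWithin 0 (Set.Ioi 0))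
        (nhds ((M + 0) * l2 μ f * l2 μ g)) := by
      have : Continuous (fun δ : ℝ => (M + δ) * l2 μ f * l2 μ g) := by fun_prop
      exact this.continuousAt.tendsto.mono_left nhdsWithin_le_nhds
    rw [add_zero] at hc
    refine ge_of_tendsto hc ?_
    filter_upwards [self_mem_nhdsWithin] with δ hδ
    exact (h δ hδ).le f g hf hg

/-- Schur's test, from the arithmetic-geometric mean inequality with an optimized weight. -/
lemma opBound_of_schur {K : X → X → ℂ} (hK : BddKernel K) {A : ℝ} (hA : 0 ≤ A)
    (h1 : ∀ ξ, ∫ η, ‖K ξ η‖ ∂μ ≤ A) (h2 : ∀ η, ∫ ξ, ‖K ξ η‖ ∂μ ≤ A) : OpBound μ K A where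
  toBddKernel := hK
  nonneg := hA
  le f g hf hg := by
    obtain ⟨B, hB0, hB⟩ := hK.bdd
    have hf1 := integrable_of_memLp_two hf
    have hg1 := integrable_of_memLp_two hg
    have hf2 := integrable_norm_sq hf
    have hg2 := integrable_norm_sq hg
    have hKn : AEStronglyMeasurable (fun p : X × X => ‖K p.1 p.2‖) (μ.prod μ) :=
      hK.meas.norm.aestronglyMeasurable
    have i1 : Integrable (fun p : X × X => ‖K p.1 p.2‖ * ‖f p.2‖ ^ 2) (μ.prod μ) :=
      (hf2.comp_snd μ).bdd_mul (c := B) hKn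
        (Filter.Eventually.of_forall fun p => by simpa using hB p.1 p.2)
    have i2 : Integrable (fun p : X × X => ‖K p.1 p.2‖ * ‖g p.1‖ ^ 2) (μ.prod μ) :=
      (hg2.comp_fst μ).bdd_mul (c := B) hKn
        (Filter.Eventually.of_forall fun p => by simpa using hB p.1 p.2)
    have e1 : ∫ p : X × X, ‖K p.1 p.2‖ * ‖f p.2‖ ^ 2 ∂(μ.prod μ) ≤ A * l2 μ f ^ 2 := by
      rw [integral_prod_symm _ i1, l2_sq, ← integral_const_mul]
      refine integral_mono_of_nonneg (Filter.Eventually.of_forall fun η =>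
        integral_nonneg fun ξ => by positivity) (hf2.const_mul A)
        (Filter.Eventually.of_forall fun η => ?_)
      simp only [integral_mul_const]
      exact mul_le_mul_of_nonneg_right (h2 η) (by positivity)
    have e2 : ∫ p : X × X, ‖K p.1 p.2‖ * ‖g p.1‖ ^ 2 ∂(μ.prod μ) ≤ A * l2 μ g ^ 2 := by
      rw [integral_prod _ i2, l2_sq, ← integral_const_mul]
      refine integral_mono_of_nonneg (Filter.Eventually.of_forall fun ξ =>
        integral_nonneg fun η => by positivity) (hg2.const_mul A)
        (Filter.Eventually.of_forall fun ξ => ?_)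
      simp only [integral_mul_const]
      exact mul_le_mul_of_nonneg_right (h1 ξ) (by positivity)
    -- the arithmetic-geometric mean inequality with a weight `τ`
    have main : ∀ τ : ℝ, 0 < τ →
        ‖kform μ K f g‖ ≤ A * (τ * l2 μ f ^ 2 + τ⁻¹ * l2 μ g ^ 2) / 2 := by
      intro τ hτ
      rw [kform_eq_prod hK hf1 hg1]
      calc _ ≤ ∫ p : X × X, (τ / 2 * (‖K p.1 p.2‖ * ‖f p.2‖ ^ 2) +
            τ⁻¹ / 2 * (‖K p.1 p.2‖ * ‖g p.1‖ ^ 2)) ∂(μ.prod μ) := by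
            refine norm_integral_le_of_norm_le ((i1.const_mul _).add (i2.const_mul _))
              (Filter.Eventually.of_forall fun p => ?_)
            rw [norm_mul, norm_mul]
            have h3 : ‖f p.2‖ * ‖g p.1‖ ≤ τ / 2 * ‖f p.2‖ ^ 2 + τ⁻¹ / 2 * ‖g p.1‖ ^ 2 := by
              have h4 : 0 ≤ τ⁻¹ / 2 * (τ * ‖f p.2‖ - ‖g p.1‖) ^ 2 := by positivity
              have h5 : τ⁻¹ / 2 * (τ * ‖f p.2‖ - ‖g p.1‖) ^ 2 =
                  τ / 2 * ‖f p.2‖ ^ 2 + τ⁻¹ / 2 * ‖g p.1‖ ^ 2 - ‖f p.2‖ * ‖g p.1‖ := by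
                field_simp; ring
              linarith
            calc _ ≤ ‖K p.1 p.2‖ * (τ / 2 * ‖f p.2‖ ^ 2 + τ⁻¹ / 2 * ‖g p.1‖ ^ 2) :=
                  mul_le_mul_of_nonneg_left h3 (norm_nonneg _)
              _ = _ := by ring
        _ = τ / 2 * ∫ p : X × X, ‖K p.1 p.2‖ * ‖f p.2‖ ^ 2 ∂(μ.prod μ) +
            τ⁻¹ / 2 * ∫ p : X × X, ‖K p.1 p.2‖ * ‖g p.1‖ ^ 2 ∂(μ.prod μ) := by
            rw [integral_add (i1.const_mul _) (i2.const_mul _), integral_const_mul,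
              integral_const_mul]
        _ ≤ τ / 2 * (A * l2 μ f ^ 2) + τ⁻¹ / 2 * (A * l2 μ g ^ 2) := by gcongr
        _ = _ := by ring
    have hF := l2_nonneg (μ := μ) f
    have hG := l2_nonneg (μ := μ) g
    refine le_of_forall_pos_le_add fun δ hδ => ?_
    set F := l2 μ f
    set G := l2 μ g
    have hcont : Filter.Tendsto (fun κ : ℝ => A * ((F + κ) * (G + κ)))
        (nhdsWithin 0 (Set.Ioi 0)) (nhds (A * ((F + 0) * (G + 0)))) := by
      have : Continuous (fun κ : ℝ => A * ((F + κ) * (G + κ))) := by fun_prop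
      exact this.continuousAt.tendsto.mono_left nhdsWithin_le_nhds
    have hle : ‖kform μ K f g‖ ≤ A * ((F + 0) * (G + 0)) := by
      refine ge_of_tendsto hcont ?_
      filter_upwards [self_mem_nhdsWithin] with κ hκ
      have hκ' : 0 < κ := hκ
      refine (main ((G + κ) / (F + κ)) (by positivity)).trans ?_
      have t1 : (G + κ) / (F + κ) * F ^ 2 ≤ (G + κ) * (F + κ) := by
        rw [div_mul_eq_mul_div, div_le_iff₀ (by positivity)]
        have : F ^ 2 ≤ (F + κ) ^ 2 := by gcongr; linarith
        calc _ ≤ (G + κ) * (F + κ) ^ 2 := by gcongr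
          _ = _ := by ring
      have t2 : ((G + κ) / (F + κ))⁻¹ * G ^ 2 ≤ (G + κ) * (F + κ) := by
        rw [inv_div, div_mul_eq_mul_div, div_le_iff₀ (by positivity)]
        have : G ^ 2 ≤ (G + κ) ^ 2 := by gcongr; linarith
        calc _ ≤ (F + κ) * (G + κ) ^ 2 := by gcongr
          _ = _ := by ring
      nlinarith
    rw [add_zero, add_zero] at hle
    linarith

/-- The bilinear bound controls the `L²` norm of the operator. -/
lemma OpBound.l2_kop_le {K : X → X → ℂ} {M : ℝ} (hK : OpBound μ K M) {f : X → ℂ}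
    (hf : MemLp f 2 μ) : l2 μ (kop μ K f) ≤ M * l2 μ f := by
  have hT : MemLp (kop μ K f) 2 μ := hK.memLp_kop (integrable_of_memLp_two hf) 2
  set g : X → ℂ := fun ξ => (starRingEnd ℂ) (kop μ K f ξ) with hg
  have hgm : MemLp g 2 μ := hT.star
  have h := hK.le f g hf hgm
  have e1 : kform μ K f g = ((l2 μ (kop μ K f) ^ 2 : ℝ) : ℂ) := by
    rw [l2_sq, kform, ← integral_complex_ofReal]
    refine integral_congr_ae (Filter.Eventually.of_forall fun ξ => ?_)
    simp only [hg]
    rw [Complex.mul_conj, Complex.normSq_eq_norm_sq]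
  have e2 : l2 μ g = l2 μ (kop μ K f) := by simp [l2, hg]
  rw [e1, e2, Complex.norm_real, Real.norm_eq_abs, abs_of_nonneg (sq_nonneg _)] at h
  by_cases h0 : l2 μ (kop μ K f) = 0
  · rw [h0]; exact mul_nonneg hK.nonneg (l2_nonneg f)
  · have hpos : 0 < l2 μ (kop μ K f) := lt_of_le_of_ne (l2_nonneg _) (Ne.symm h0)
    refine le_of_mul_le_mul_right ?_ hpos
    rw [← sq]; exact h

end Kernels

/-! ### Interpolation between `L¹ → L^∞` and `L² → L²` -/

section Interpolation

variable {X : Type*} [MeasurableSpace X] {μ : Measure X} [IsFiniteMeasure μ]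

lemma eLpNorm_two_eq {f : X → ℂ} (hf : MemLp f 2 μ) :
    eLpNorm f 2 μ = ENNReal.ofReal (l2 μ f) := by
  rw [hf.eLpNorm_eq_integral_rpow_norm (by norm_num) (by norm_num), l2, Real.sqrt_eq_rpow]
  norm_num

lemma lintegral_norm_sq {f : X → ℂ} (hf : MemLp f 2 μ) :
    ∫⁻ x, ENNReal.ofReal (‖f x‖ ^ 2) ∂μ = ENNReal.ofReal (l2 μ f ^ 2) := by
  rw [l2_sq, ofReal_integral_eq_lintegral_ofReal (integrable_norm_sq hf)
    (Filter.Eventually.of_forall fun x => sq_nonneg _)]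

/-- Distribution function of `Tf` from the splitting of `f` at the level where the large part of
`f` contributes at most `α / 2` to the supremum of `Tf`. -/
lemma meas_kop_gt_le {K : X → X → ℂ} {M₁ M₂ : ℝ} (hM₁ : 0 < M₁) (hsup : ∀ ξ η, ‖K ξ η‖ ≤ M₁)
    (hK : OpBound μ K M₂) {P : ℝ} (hP : 1 < P) {f : X → ℂ} (hf : Measurable f)
    (hfP : Integrable (fun x => ‖f x‖ ^ P) μ) (hf1 : Integrable f μ) {F : ℝ} (hF : 0 < F)
    (hFe : ∫ x, ‖f x‖ ^ P ∂μ = F) {α : ℝ} (hα : 0 < α) :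
    μ {ξ | α < ‖kop μ K f ξ‖} ≤ ENNReal.ofReal (4 * M₂ ^ 2 / α ^ 2) *
      ∫⁻ x, ENNReal.ofReal ({x | α * ‖f x‖ ^ (P - 1) ≤ 2 * M₁ * F}.indicator
        (fun x => ‖f x‖ ^ 2) x) ∂μ := by
  set E : Set X := {x | α * ‖f x‖ ^ (P - 1) ≤ 2 * M₁ * F} with hE
  have hEm : MeasurableSet E := measurableSet_le (by fun_prop) measurable_const
  have hP1 : 0 < P - 1 := by linarith
  -- the small part is bounded
  have hbd : ∀ x, ‖E.indicator f x‖ ≤ (2 * M₁ * F / α) ^ (P - 1)⁻¹ := by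
    intro x
    by_cases hx : x ∈ E
    · rw [Set.indicator_of_mem hx]
      have hx' : α * ‖f x‖ ^ (P - 1) ≤ 2 * M₁ * F := hx
      rw [Real.le_rpow_inv_iff_of_pos (norm_nonneg _) (by positivity) hP1, le_div_iff₀ hα]
      linarith
    · rw [Set.indicator_of_notMem hx, norm_zero]
      positivity
  have hf2 : MemLp (E.indicator f) 2 μ :=
    MemLp.of_bound (hf.indicator hEm).aestronglyMeasurable _ (Filter.Eventually.of_forall hbd)
  have hfc : Integrable (Eᶜ.indicator f) μ := hf1.indicator hEm.compl
  have hsplit : ∀ ξ, kop μ K f ξ = kop μ K (E.indicator f) ξ + kop μ K (Eᶜ.indicator f) ξ := by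
    intro ξ
    rw [kop, kop, kop, ← integral_add (hK.integrable (integrable_of_memLp_two hf2) ξ)
      (hK.integrable hfc ξ)]
    refine integral_congr_ae (Filter.Eventually.of_forall fun η => ?_)
    simp only [← mul_add]
    rw [← Pi.add_apply, Set.indicator_self_add_compl]
  have hlarge : ∀ ξ, ‖kop μ K (Eᶜ.indicator f) ξ‖ ≤ α / 2 := by
    intro ξ
    refine (norm_kop_le hsup hfc ξ).trans ?_
    have h1 : ∫ x, ‖Eᶜ.indicator f x‖ ∂μ ≤ ∫ x, α / (2 * M₁ * F) * ‖f x‖ ^ P ∂μ := by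
      refine integral_mono_of_nonneg (Filter.Eventually.of_forall fun x => norm_nonneg _)
        (hfP.const_mul _) (Filter.Eventually.of_forall fun x => ?_)
      by_cases hx : x ∈ E
      · simp only
        rw [Set.indicator_of_notMem (by simpa using hx), norm_zero]
        positivity
      · simp only
        rw [Set.indicator_of_mem (by simpa using hx)]
        have hx' : 2 * M₁ * F < α * ‖f x‖ ^ (P - 1) := not_le.1 hx
        have e : ‖f x‖ ^ P = ‖f x‖ * ‖f x‖ ^ (P - 1) := by
          rcases (norm_nonneg (f x)).eq_or_lt with h0 | h0
          · rw [← h0, Real.zero_rpow (by linarith), zero_mul]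
          · rw [Real.rpow_sub_one h0.ne']; field_simp
        rw [e, div_mul_eq_mul_div, le_div_iff₀ (by positivity)]
        nlinarith [norm_nonneg (f x)]
    rw [integral_const_mul, hFe] at h1
    calc _ ≤ M₁ * (α / (2 * M₁ * F) * F) := by gcongr
      _ = _ := by field_simp
  have hT2 := hK.memLp_kop (integrable_of_memLp_two hf2) 2
  calc μ {ξ | α < ‖kop μ K f ξ‖}
      ≤ μ {ξ | ENNReal.ofReal ((α / 2) ^ 2) ≤
          ENNReal.ofReal (‖kop μ K (E.indicator f) ξ‖ ^ 2)} := by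
        refine measure_mono fun ξ (hξ : α < _) => ?_
        refine ENNReal.ofReal_le_ofReal ?_
        have h1 := norm_add_le (kop μ K (E.indicator f) ξ) (kop μ K (Eᶜ.indicator f) ξ)
        rw [← hsplit] at h1
        have := hlarge ξ
        have h2 : α / 2 ≤ ‖kop μ K (E.indicator f) ξ‖ := by linarith
        gcongr
    _ ≤ (∫⁻ ξ, ENNReal.ofReal (‖kop μ K (E.indicator f) ξ‖ ^ 2) ∂μ) /
          ENNReal.ofReal ((α / 2) ^ 2) := by
        refine meas_ge_le_lintegral_div ?_ ?_ ENNReal.ofReal_ne_top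
        · exact (hT2.1.norm.aemeasurable.pow_const 2).ennreal_ofReal
        · rw [Ne, ENNReal.ofReal_eq_zero, not_le]; positivity
    _ ≤ ENNReal.ofReal (M₂ ^ 2 * l2 μ (E.indicator f) ^ 2) / ENNReal.ofReal ((α / 2) ^ 2) := by
        rw [lintegral_norm_sq hT2, ← mul_pow]
        gcongr
        · exact l2_nonneg _
        · exact hK.l2_kop_le hf2
    _ = ENNReal.ofReal (4 * M₂ ^ 2 / α ^ 2) * ENNReal.ofReal (l2 μ (E.indicator f) ^ 2) := by
        rw [← ENNReal.ofReal_div_of_pos (by positivity), ← ENNReal.ofReal_mul (by positivity)]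
        congr 1
        field_simp
        norm_num
    _ = _ := by
        rw [← lintegral_norm_sq hf2]
        congr 1
        refine lintegral_congr fun x => ?_
        by_cases hx : x ∈ E
        · rw [Set.indicator_of_mem hx, Set.indicator_of_mem hx]
        · rw [Set.indicator_of_notMem hx, Set.indicator_of_notMem hx]; simp

/-- `∫_0^A α^{r-1} dα = A^r / r`. -/
lemma lintegral_rpow_Ioc {A r : ℝ} (hA : 0 ≤ A) (hr : 0 < r) :
    ∫⁻ α in Set.Ioc 0 A, ENNReal.ofReal (α ^ (r - 1)) = ENNReal.ofReal (A ^ r / r) := by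
  rw [← ofReal_integral_eq_lintegral_ofReal]
  · rw [← intervalIntegral.integral_of_le hA, integral_rpow (Or.inl (by linarith))]
    rw [sub_add_cancel, Real.zero_rpow hr.ne', sub_zero]
  · exact (intervalIntegral.intervalIntegrable_rpow' (by linarith)).1
  · filter_upwards [ae_restrict_mem measurableSet_Ioc] with α hα
    exact Real.rpow_nonneg hα.1.le _

/-- Marcinkiewicz interpolation between `L¹ → L^∞` and `L² → L²`, in integrated form. -/
lemma lintegral_kop_rpow_le {K : X → X → ℂ} {M₁ M₂ : ℝ} (hM₁ : 0 < M₁)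
    (hsup : ∀ ξ η, ‖K ξ η‖ ≤ M₁) (hK : OpBound μ K M₂) {P P' : ℝ} (hP : 1 < P)
    (hP' : 2 < P') (hPP : (P - 1) * (P' - 1) = 1) {f : X → ℂ} (hf : Measurable f)
    (hfP : Integrable (fun x => ‖f x‖ ^ P) μ) (hf1 : Integrable f μ) {F : ℝ} (hF : 0 < F)
    (hFe : ∫ x, ‖f x‖ ^ P ∂μ = F) :
    ∫⁻ ξ, ENNReal.ofReal (‖kop μ K f ξ‖ ^ P') ∂μ ≤
      ENNReal.ofReal (P' * (4 * M₂ ^ 2) * ((2 * M₁ * F) ^ (P' - 2) / (P' - 2)) * F) := by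
  have hT : AEMeasurable (fun ξ => ‖kop μ K f ξ‖) μ :=
    (hK.stronglyMeasurable_kop hf.aestronglyMeasurable).norm.measurable.aemeasurable
  rw [lintegral_rpow_eq_lintegral_meas_lt_mul μ (Filter.Eventually.of_forall fun ξ =>
    norm_nonneg _) hT (by linarith : 0 < P')]
  have hpr : P' * (4 * M₂ ^ 2) * ((2 * M₁ * F) ^ (P' - 2) / (P' - 2)) * F =
      P' * ((4 * M₂ ^ 2) * ((2 * M₁ * F) ^ (P' - 2) / (P' - 2) * F)) := by ring
  rw [hpr, ENNReal.ofReal_mul (by linarith : 0 ≤ P')]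
  gcongr
  set c : ℝ := 4 * M₂ ^ 2 with hc
  have hc0 : 0 ≤ c := by positivity
  let G : ℝ → X → ℝ≥0∞ := fun α x => ENNReal.ofReal c * (ENNReal.ofReal (α ^ (P' - 2 - 1)) *
    ENNReal.ofReal ({x | α * ‖f x‖ ^ (P - 1) ≤ 2 * M₁ * F}.indicator (fun x => ‖f x‖ ^ 2) x))
  have hGm : Measurable (Function.uncurry G) := by
    have h1 : MeasurableSet {p : ℝ × X | p.1 * ‖f p.2‖ ^ (P - 1) ≤ 2 * M₁ * F} :=
      measurableSet_le (by fun_prop) measurable_const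
    have h2 : Measurable ({p : ℝ × X | p.1 * ‖f p.2‖ ^ (P - 1) ≤ 2 * M₁ * F}.indicator
        (fun p => ‖f p.2‖ ^ 2)) := Measurable.indicator (by fun_prop) h1
    have h3 : Measurable (fun p : ℝ × X => p.1 ^ (P' - 2 - 1)) := by fun_prop
    exact (h3.ennreal_ofReal.mul h2.ennreal_ofReal).const_mul _
  calc _ ≤ ∫⁻ α in Set.Ioi (0 : ℝ), ∫⁻ x, G α x ∂μ := by
        refine setLIntegral_mono' measurableSet_Ioi fun α (hα : 0 < α) => ?_
        refine (mul_le_mul_left (meas_kop_gt_le hM₁ hsup hK hP hf hfP hf1 hF hFe hα) _).trans ?_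
        simp only [G]
        have e : ENNReal.ofReal (4 * M₂ ^ 2 / α ^ 2) * ENNReal.ofReal (α ^ (P' - 1)) =
            ENNReal.ofReal c * ENNReal.ofReal (α ^ (P' - 2 - 1)) := by
          rw [← ENNReal.ofReal_mul (by positivity), ← ENNReal.ofReal_mul (by positivity)]
          congr 1
          rw [div_mul_eq_mul_div, mul_div_assoc]
          congr 1
          rw [← Real.rpow_natCast α 2, ← Real.rpow_sub hα]
          norm_num
          ring_nf
        rw [lintegral_const_mul' _ _ ENNReal.ofReal_ne_top,
          lintegral_const_mul' _ _ ENNReal.ofReal_ne_top, mul_right_comm, ← mul_assoc, e]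
    -- for fixed `x` the level `α` ranges over a bounded interval ending at `A`
    _ = ∫⁻ x, (∫⁻ α in Set.Ioi (0 : ℝ), G α x) ∂μ := lintegral_lintegral_swap hGm.aemeasurable
    _ ≤ ∫⁻ x, ENNReal.ofReal (c * ((2 * M₁ * F) ^ (P' - 2) / (P' - 2)) * ‖f x‖ ^ P) ∂μ := by
        refine lintegral_mono fun x => ?_
        simp only [G]
        rw [lintegral_const_mul' _ _ ENNReal.ofReal_ne_top]
        by_cases hx : f x = 0
        · have h0 : ∀ α : ℝ, {x | α * ‖f x‖ ^ (P - 1) ≤ 2 * M₁ * F}.indicator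
              (fun x => ‖f x‖ ^ 2) x = 0 := by
            intro α
            by_cases hx' : x ∈ {x | α * ‖f x‖ ^ (P - 1) ≤ 2 * M₁ * F}
            · rw [Set.indicator_of_mem hx', hx]; simp
            · rw [Set.indicator_of_notMem hx']
          simp [h0]
        · have hpos : 0 < ‖f x‖ := norm_pos_iff.2 hx
          set A : ℝ := 2 * M₁ * F / ‖f x‖ ^ (P - 1) with hA
          have hA0 : 0 < A := by positivity
          have hset : ∀ α ∈ Set.Ioi (0 : ℝ), ENNReal.ofReal (α ^ (P' - 2 - 1)) *
              ENNReal.ofReal ({x | α * ‖f x‖ ^ (P - 1) ≤ 2 * M₁ * F}.indicator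
                (fun x => ‖f x‖ ^ 2) x) =
              (Set.Ioc 0 A).indicator (fun α => ENNReal.ofReal (‖f x‖ ^ 2) *
                ENNReal.ofReal (α ^ (P' - 2 - 1))) α := by
            intro α hα
            by_cases h : α * ‖f x‖ ^ (P - 1) ≤ 2 * M₁ * F
            · rw [Set.indicator_of_mem (show x ∈ {x | α * ‖f x‖ ^ (P - 1) ≤ 2 * M₁ * F} from h),
                Set.indicator_of_mem (show α ∈ Set.Ioc 0 A from
                  ⟨hα, by rw [hA, le_div_iff₀ (by positivity)]; exact h⟩), mul_comm]
            · rw [Set.indicator_of_notMem (show x ∉ {x | α * ‖f x‖ ^ (P - 1) ≤ 2 * M₁ * F} from h),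
                Set.indicator_of_notMem]
              · simp
              · intro h'
                refine h ?_
                have := h'.2
                rwa [hA, le_div_iff₀ (by positivity)] at this
          rw [setLIntegral_congr_fun measurableSet_Ioi hset,
            setLIntegral_indicator measurableSet_Ioc,
            (Set.inter_eq_left.2 fun α hα => Set.mem_Ioi.2 hα.1 :
              Set.Ioc (0 : ℝ) A ∩ Set.Ioi 0 = Set.Ioc 0 A),
            lintegral_const_mul' _ _ ENNReal.ofReal_ne_top,
            lintegral_rpow_Ioc hA0.le (by linarith : 0 < P' - 2),
            ← ENNReal.ofReal_mul (by positivity), ← ENNReal.ofReal_mul hc0]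
          refine ENNReal.ofReal_le_ofReal (le_of_eq ?_)
          have e1 : A ^ (P' - 2) = (2 * M₁ * F) ^ (P' - 2) / ‖f x‖ ^ (2 - P) := by
            rw [hA, Real.div_rpow (by positivity) (by positivity), ← Real.rpow_mul hpos.le]
            congr 2
            linear_combination hPP
          have e2 : ‖f x‖ ^ P = ‖f x‖ ^ 2 / ‖f x‖ ^ (2 - P) := by
            rw [← Real.rpow_natCast, ← Real.rpow_sub hpos]
            norm_num
          rw [e1, e2]
          ring
    _ = _ := by
        have hd : 0 ≤ c * ((2 * M₁ * F) ^ (P' - 2) / (P' - 2)) := by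
          have : 0 < P' - 2 := by linarith
          positivity
        rw [← ofReal_integral_eq_lintegral_ofReal (hfP.const_mul _)
          (Filter.Eventually.of_forall fun x => mul_nonneg hd (by positivity)),
          integral_const_mul, hFe, mul_assoc]

/-- Interpolation between `L¹ → L^∞` and `L² → L²`. -/
lemma exists_interpolation (p p' q : ℝ≥0∞) (hp1 : 1 ≤ p) (hp2 : p ≤ 2)
    (hp' : p⁻¹ + p'⁻¹ = 1) (hq : p⁻¹ = p'⁻¹ + q⁻¹) :
    ∃ c : ℝ, 0 < c ∧ ∀ (K : X → X → ℂ) (M₁ M₂ : ℝ), 0 < M₁ → 0 < M₂ → (∀ ξ η, ‖K ξ η‖ ≤ M₁) →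
      OpBound μ K M₂ → ∀ f : X → ℂ, MemLp f p μ →
      eLpNorm (kop μ K f) p' μ ≤
        ENNReal.ofReal (c * (M₁ ^ (q⁻¹).toReal * M₂ ^ (1 - (q⁻¹).toReal))) * eLpNorm f p μ := by
  have hptop : p ≠ ⊤ := (hp2.trans_lt (by norm_num)).ne
  have hp0 : p ≠ 0 := (zero_lt_one.trans_le hp1).ne'
  -- the endpoint `p = 1` is the pointwise bound
  rcases hp1.eq_or_lt with rfl | hp1'
  · have h0 : p'⁻¹ = 0 := by
      have h1 : (1 : ℝ≥0∞) + p'⁻¹ = 1 + 0 := by simpa using hp'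
      exact (ENNReal.add_right_inj ENNReal.one_ne_top).1 h1
    have hp'' : p' = ⊤ := ENNReal.inv_eq_zero.1 h0
    have hq1 : q⁻¹ = 1 := by rw [h0, inv_one, zero_add] at hq; exact hq.symm
    refine ⟨1, one_pos, fun K M₁ M₂ hM₁ hM₂ hsup hK f hf => ?_⟩
    have hf1 : Integrable f μ := memLp_one_iff_integrable.1 hf
    rw [hp'', hq1]
    simp only [ENNReal.toReal_one, Real.rpow_one, sub_self, Real.rpow_zero, mul_one, one_mul]
    rw [eLpNorm_exponent_top]
    refine eLpNormEssSup_le_of_ae_enorm_bound (Filter.Eventually.of_forall fun ξ => ?_)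
    rw [eLpNorm_one_eq_lintegral_enorm, ← ofReal_integral_norm_eq_lintegral_enorm hf1,
      ← ENNReal.ofReal_mul hM₁.le, ← ofReal_norm]
    exact ENNReal.ofReal_le_ofReal (norm_kop_le hsup hf1 ξ)
  -- the endpoint `p = 2` is the `L²` bound
  rcases hp2.eq_or_lt with rfl | hp2'
  · have h0 : p'⁻¹ = 2⁻¹ := by
      have h1 : (2 : ℝ≥0∞)⁻¹ + p'⁻¹ = 2⁻¹ + 2⁻¹ := by rw [hp', ENNReal.inv_two_add_inv_two]
      exact (ENNReal.add_right_inj (by simp)).1 h1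
    have hp'' : p' = 2 := by rw [← inv_inv p', h0, inv_inv]
    have hq1 : q⁻¹ = 0 := by
      rw [h0] at hq
      have h1 : (2 : ℝ≥0∞)⁻¹ + 0 = 2⁻¹ + q⁻¹ := by rw [add_zero]; exact hq
      exact ((ENNReal.add_right_inj (by simp)).1 h1).symm
    refine ⟨1, one_pos, fun K M₁ M₂ hM₁ hM₂ hsup hK f hf => ?_⟩
    rw [hp'', hq1]
    simp only [ENNReal.toReal_zero, Real.rpow_one, sub_zero, Real.rpow_zero, one_mul]
    rw [eLpNorm_two_eq (hK.memLp_kop (integrable_of_memLp_two hf) 2), eLpNorm_two_eq hf,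
      ← ENNReal.ofReal_mul hM₂.le]
    exact ENNReal.ofReal_le_ofReal (hK.l2_kop_le hf)
  -- for `1 < p < 2` the distribution function of `Tf` is integrated
  have hp'0 : p' ≠ 0 := by
    rintro rfl
    simp at hp'
  have hp'top : p' ≠ ⊤ := by
    rintro rfl
    rw [ENNReal.inv_top, add_zero] at hp'
    rw [← inv_inv p, hp', inv_one] at hp1'
    exact lt_irrefl _ hp1'
  set P := p.toReal with hPdef
  set P' := p'.toReal with hP'def
  have hP1 : 1 < P := by
    have := (ENNReal.toReal_lt_toReal ENNReal.one_ne_top hptop).2 hp1'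
    simpa using this
  have hP2 : P < 2 := by
    have := (ENNReal.toReal_lt_toReal hptop (by norm_num)).2 hp2'
    simpa using this
  have hP'0 : 0 < P' := ENNReal.toReal_pos hp'0 hp'top
  have hsum : P⁻¹ + P'⁻¹ = 1 := by
    have := congrArg ENNReal.toReal hp'
    rwa [ENNReal.toReal_add (ENNReal.inv_ne_top.2 hp0) (ENNReal.inv_ne_top.2 hp'0),
      ENNReal.toReal_inv, ENNReal.toReal_inv, ENNReal.toReal_one] at this
  have hqle : q⁻¹ ≠ ⊤ := by
    intro h
    rw [h, add_top] at hq
    exact ENNReal.inv_ne_top.2 hp0 hq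
  have hθ : (q⁻¹).toReal = 1 - 2 / P' := by
    have := congrArg ENNReal.toReal hq
    rw [ENNReal.toReal_add (ENNReal.inv_ne_top.2 hp'0) hqle,
      ENNReal.toReal_inv, ENNReal.toReal_inv] at this
    rw [div_eq_mul_inv]
    linarith
  have hPP : (P - 1) * (P' - 1) = 1 := by
    field_simp at hsum
    linarith
  have hP'2 : 2 < P' := by nlinarith
  have hP'2' : 0 < P' - 2 := by linarith
  set c₀ : ℝ := P' * 4 * (2 ^ (P' - 2) / (P' - 2)) with hc₀
  have hc₀pos : 0 < c₀ := by positivity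
  refine ⟨c₀ ^ P'⁻¹, by positivity, fun K M₁ M₂ hM₁ hM₂ hsup hK f hf => ?_⟩
  have hf1 : Integrable f μ := hf.integrable hp1
  set g := hf.1.mk f with hgdef
  have hfg : f =ᵐ[μ] g := hf.1.ae_eq_mk
  have hgm : Measurable g := hf.1.stronglyMeasurable_mk.measurable
  have hg : MemLp g p μ := (memLp_congr_ae hfg).1 hf
  have hg1 : Integrable g μ := hg.integrable hp1
  have hgP : Integrable (fun x => ‖g x‖ ^ P) μ := hg.integrable_norm_rpow hp0 hptop
  rw [kop_congr hfg, eLpNorm_congr_ae hfg]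
  rcases (integral_nonneg (fun x => Real.rpow_nonneg (norm_nonneg (g x)) P) :
    0 ≤ ∫ x, ‖g x‖ ^ P ∂μ).eq_or_lt with h0 | hF
  · have hz : g =ᵐ[μ] 0 := by
      have := (integral_eq_zero_iff_of_nonneg
        (fun x => Real.rpow_nonneg (norm_nonneg (g x)) P) hgP).1 h0.symm
      filter_upwards [this] with x hx
      have hx' : ‖g x‖ ^ P = 0 := hx
      rw [Real.rpow_eq_zero (norm_nonneg _) (by linarith)] at hx'
      simpa using hx'
    have : kop μ K g = 0 := by
      rw [kop_congr hz]
      funext ξ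
      simp [kop]
    rw [this, eLpNorm_zero]
    exact zero_le
  set F := ∫ x, ‖g x‖ ^ P ∂μ with hFdef
  have key := lintegral_kop_rpow_le hM₁ hsup hK hP1 hP'2 hPP hgm hgP hg1 hF rfl
  rw [eLpNorm_eq_lintegral_rpow_enorm_toReal hp'0 hp'top, ← hP'def,
    hg.eLpNorm_eq_integral_rpow_norm hp0 hptop, ← hPdef, ← hFdef, one_div]
  have e1 : ∀ ξ, ‖kop μ K g ξ‖ₑ ^ P' = ENNReal.ofReal (‖kop μ K g ξ‖ ^ P') := fun ξ => by
    rw [← ofReal_norm, ENNReal.ofReal_rpow_of_nonneg (norm_nonneg _) hP'0.le]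
  simp only [e1]
  refine (ENNReal.rpow_le_rpow key (by positivity)).trans ?_
  rw [ENNReal.ofReal_rpow_of_nonneg (by positivity) (by positivity),
    ← ENNReal.ofReal_mul (by positivity)]
  refine ENNReal.ofReal_le_ofReal (le_of_eq ?_)
  have e2 : P' * (4 * M₂ ^ 2) * ((2 * M₁ * F) ^ (P' - 2) / (P' - 2)) * F =
      c₀ * (M₁ ^ (P' - 2) * M₂ ^ 2) * F ^ (P' - 1) := by
    rw [Real.mul_rpow (by positivity) hF.le, Real.mul_rpow (by norm_num) hM₁.le, hc₀,
      show P' - 1 = (P' - 2) + 1 by ring, Real.rpow_add_one hF.ne']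
    ring
  clear_value c₀
  have e3 : P⁻¹ = (P' - 1) * P'⁻¹ := by field_simp; field_simp at hsum; linarith
  rw [e2, Real.mul_rpow (by positivity) (by positivity), Real.mul_rpow (by positivity)
    (by positivity), Real.mul_rpow (by positivity) (by positivity), ← Real.rpow_mul hF.le, ← e3,
    ← Real.rpow_mul hM₁.le, ← Real.rpow_natCast M₂ 2, ← Real.rpow_mul hM₂.le, hθ]
  congr 3
  · congr 1
    field_simp
  · congr 1
    push_cast
    field_simp
    ring

end Interpolation

/-! ### Orthogonality of solid harmonics -/

section Harmonic

variable {E : Type*} [NormedAddCommGroup E] [InnerProductSpace ℝ E]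

/-- `f` is a harmonic function, homogeneous of degree `k`, with gradient `F`; the derivative of the
gradient is `F'`. -/
structure SolidHarmonic (f : E → ℝ) (F : E → E) (F' : E → E →L[ℝ] E) (k : ℕ) : Prop where
  grad : ∀ y, HasFDerivAt f (innerSL ℝ (F y)) y
  hess : ∀ y, HasFDerivAt F (F' y) y
  hess_cont : ∀ v, Continuous fun y => F' y v
  trace : ∀ y, LinearMap.trace ℝ E (F' y : E →ₗ[ℝ] E) = 0
  euler : ∀ y, inner ℝ (F y) y = k * f y
  homog : ∀ (r : ℝ) y, f (r • y) = r ^ k * f y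

lemma gegS_homog (a k : ℕ) (r α β : ℝ) :
    gegS a (k + 2) (r * α) (r ^ 2 * β) = r ^ k * gegS a (k + 2) α β := by
  induction a generalizing k with
  | zero => cases k <;> simp [geg_zero_left]
  | succ a iha =>
    induction k using Nat.strong_induction_on with
    | _ k ihk =>
      match k with
      | 0 => simp
      | 1 =>
        have := iha 1
        simp only [gegS_add_two, geg_rec_one, pow_one] at this ⊢
        rw [this]; ring
      | k + 2 =>
        have h1 := ihk (k + 1) (by omega)
        have h2 := ihk k (by omega)
        rw [gegS_rec a (k + 2), gegS_rec a (k + 2), iha (k + 2), h1, h2]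
        ring

/-- The zonal function `y ↦ gegS a k ⟪ξ, y⟫ ‖y‖²`, a homogeneous polynomial of degree `k - 2`. The
shift by two keeps the derivative formulas free of case distinctions. -/
def zon (a k : ℕ) (ξ y : E) : ℝ := gegS a k (inner ℝ ξ y) (‖y‖ ^ 2)

lemma hasFDerivAt_zon (a k : ℕ) (ξ y : E) :
    HasFDerivAt (zon a k ξ) (innerSL ℝ ((2 * a * zon (a + 1) (k - 1) ξ y) • ξ -
      (2 * a * zon (a + 1) (k - 2) ξ y) • y)) y := by
  have h1 : HasFDerivAt (fun y : E => inner ℝ ξ y) (innerSL ℝ ξ) y :=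
    (innerSL ℝ ξ).hasFDerivAt
  have h2 : HasFDerivAt (fun y : E => ‖y‖ ^ 2) (2 • innerSL ℝ y) y :=
    (hasStrictFDerivAt_norm_sq y).hasFDerivAt
  refine (hasFDerivAt_gegS h1 h2 a k).congr_fderiv ?_
  ext v
  simp only [zon, sub_apply, smul_apply, innerSL_apply_apply, inner_sub_left, inner_smul_left,
    smul_eq_mul, RCLike.conj_to_real, nsmul_eq_mul]
  push_cast
  ring

lemma continuous_zon (a k : ℕ) (ξ : E) : Continuous (zon a k ξ) :=
  continuous_iff_continuousAt.2 fun y => (hasFDerivAt_zon a k ξ y).continuousAt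

variable [FiniteDimensional ℝ E]

/-- In dimension `2 (m + 1)`, the homogenized Gegenbauer polynomials of index `m` are harmonic. -/
lemma solidHarmonic_zon (m k : ℕ) (hdim : Module.finrank ℝ E = 2 * (m + 1)) {ξ : E}
    (hξ : ‖ξ‖ = 1) :
    ∃ F F', SolidHarmonic (zon m (k + 2) ξ) F F' k := by
  refine ⟨fun y => (2 * m * zon (m + 1) (k + 1) ξ y) • ξ - (2 * m * zon (m + 1) k ξ y) • y,
    fun y => (2 * (m : ℝ)) • ((innerSL ℝ ((2 * (m + 1 : ℕ) * zon (m + 1 + 1) k ξ y) • ξ -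
      (2 * (m + 1 : ℕ) * zon (m + 1 + 1) (k - 1) ξ y) • y)).smulRight ξ) -
      ((2 * m * zon (m + 1) k ξ y) • ContinuousLinearMap.id ℝ E +
      (2 * (m : ℝ)) • ((innerSL ℝ ((2 * (m + 1 : ℕ) * zon (m + 1 + 1) (k - 1) ξ y) • ξ -
      (2 * (m + 1 : ℕ) * zon (m + 1 + 1) (k - 2) ξ y) • y)).smulRight y)), ?_⟩
  have hrec : ∀ y : E, zon (m + 1 + 1) k ξ y = 2 * inner ℝ ξ y * zon (m + 1 + 1) (k - 1) ξ y
      - ‖y‖ ^ 2 * zon (m + 1 + 1) (k - 2) ξ y + zon (m + 1) k ξ y := by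
    intro y
    match k with
    | 0 => simp [zon]
    | 1 => simp [zon]
    | k + 2 => simpa [zon] using gegS_rec (m + 1) k (inner ℝ ξ y) (‖y‖ ^ 2)
  refine ⟨fun y => hasFDerivAt_zon m (k + 2) ξ y, fun y => ?_, fun v => ?_, fun y => ?_,
    fun y => ?_, fun r y => ?_⟩
  · have h1 := ((hasFDerivAt_zon (m + 1) (k + 1) ξ y).const_mul (2 * (m : ℝ))).smul
      (hasFDerivAt_const ξ y)
    have h2 := ((hasFDerivAt_zon (m + 1) k ξ y).const_mul (2 * (m : ℝ))).smul (hasFDerivAt_id y)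
    refine (h1.sub h2).congr_fderiv ?_
    ext v
    simp [show k + 1 - 2 = k - 1 by omega, mul_smul, two_mul, add_smul]
  · have := continuous_zon (m + 1) k ξ
    have := continuous_zon (m + 1 + 1) k ξ
    have := continuous_zon (m + 1 + 1) (k - 1) ξ
    have := continuous_zon (m + 1 + 1) (k - 2) ξ
    simp only [sub_apply, add_apply, smul_apply, ContinuousLinearMap.smulRight_apply,
      innerSL_apply_apply, ContinuousLinearMap.id_apply]
    fun_prop
  · simp only [ContinuousLinearMap.toLinearMap_sub, ContinuousLinearMap.toLinearMap_add,
      ContinuousLinearMap.toLinearMap_smul, map_sub, map_add, map_smul,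
      ContinuousLinearMap.coe_smulRight, LinearMap.trace_smulRight,
      ContinuousLinearMap.coe_id, LinearMap.trace_id, hdim, ContinuousLinearMap.coe_coe,
      innerSL_apply_apply, smul_eq_mul,
      real_inner_self_eq_norm_sq, hξ, real_inner_comm ξ y, LinearMap.sub_apply,
      LinearMap.smul_apply]
    rw [hrec y]
    push_cast
    ring
  · have h := geg_euler m k (inner ℝ ξ y) (‖y‖ ^ 2)
    simp only [zon, gegS_add_two, inner_sub_left, inner_smul_left, RCLike.conj_to_real,
      real_inner_self_eq_norm_sq]
    rw [h]; ring
  · simp only [zon, inner_smul_right, norm_smul, mul_pow, Real.norm_eq_abs, sq_abs]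
    exact gegS_homog m k r _ _

variable [MeasurableSpace E] [BorelSpace E] {μ : Measure E} [μ.IsAddHaarMeasure]

/-- The radial weight `(1 - s)_+²`, `s = ‖y‖²`, is continuously differentiable; it makes the
boundary term in Green's identity disappear. -/
lemma hasDerivAt_posPart_sq (s : ℝ) :
    HasDerivAt (fun s : ℝ => max (1 - s) 0 ^ 2) (-(2 * max (1 - s) 0)) s := by
  refine hasDerivAt_of_hasDerivAt_of_ne' (x := 1) (g := fun s => -(2 * max (1 - s) 0)) ?_
    (by fun_prop) (by fun_prop) s
  intro y hy
  rcases lt_or_gt_of_ne hy with h | h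
  · have h1 : HasDerivAt (fun s : ℝ => (1 - s) ^ 2) (-(2 * (1 - y))) y := by
      refine (((hasDerivAt_id y).const_sub 1).pow 2).congr_deriv ?_
      simp
    rw [max_eq_left (by linarith)]
    refine h1.congr_of_eventuallyEq ?_
    filter_upwards [Iio_mem_nhds h] with z hz
    rw [max_eq_left (by linarith [Set.mem_Iio.1 hz])]
  · rw [max_eq_right (by linarith), mul_zero, neg_zero]
    refine (hasDerivAt_const y (0 : ℝ)).congr_of_eventuallyEq ?_
    filter_upwards [Ioi_mem_nhds h] with z hz
    rw [max_eq_right (by linarith [Set.mem_Ioi.1 hz])]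
    simp

lemma integral_fderiv_apply_eq_zero {X : E → E} {X' : E → E →L[ℝ] E}
    (hX : ∀ y, HasFDerivAt X (X' y) y) (hX' : ∀ v, Continuous fun y => X' y v)
    (h0 : ∀ y, 1 < ‖y‖ → X y = 0) (h0' : ∀ y, 1 < ‖y‖ → X' y = 0) (v : E) :
    Integrable (fun y => X' y v) μ ∧ ∫ y, X' y v ∂μ = 0 := by
  have hc : Continuous X := continuous_iff_continuousAt.2 fun y => (hX y).continuousAt
  have i1 : Integrable X μ := hc.integrable_of_hasCompactSupport
    (HasCompactSupport.intro (isCompact_closedBall (0 : E) 1) fun y hy => h0 y (by simpa using hy))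
  have i2 : Integrable (fun y => X' y v) μ := (hX' v).integrable_of_hasCompactSupport
    (HasCompactSupport.intro (isCompact_closedBall (0 : E) 1) fun y hy => by
      rw [h0' y (by simpa using hy)]; rfl)
  have e : ∀ y, fderiv ℝ X y = X' y := fun y => (hX y).fderiv
  have := integral_smul_fderiv_eq_neg_fderiv_smul_of_integrable (μ := μ) (𝕜 := ℝ)
    (f := fun _ : E => (1 : ℝ)) (g := X) (v := v) (by simp) (by simpa [e] using i2)
    (by simpa using i1) (fun _ _ => by fun_prop) (fun y _ => (hX y).differentiableAt)
  exact ⟨i2, by simpa [e] using this⟩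

/-- Green's identity for two solid harmonics of different degrees: the divergence of
`w (f ∇h - h ∇f)`, with `w` a compactly supported radial weight, has integral zero, and by Euler's
identity it equals `(k - l) f h` times a radial function. -/
lemma SolidHarmonic.integral_mul_eq_zero {f h : E → ℝ} {F H : E → E} {F' H' : E → E →L[ℝ] E}
    {k l : ℕ} (hf : SolidHarmonic f F F' k) (hh : SolidHarmonic h H H' l) (hkl : k ≠ l) :
    ∫ y : E, max (1 - ‖y‖ ^ 2) 0 * (f y * h y) ∂μ = 0 := by
  have cf : Continuous f := continuous_iff_continuousAt.2 fun y => (hf.grad y).continuousAt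
  have ch : Continuous h := continuous_iff_continuousAt.2 fun y => (hh.grad y).continuousAt
  have cF : Continuous F := continuous_iff_continuousAt.2 fun y => (hf.hess y).continuousAt
  have cH : Continuous H := continuous_iff_continuousAt.2 fun y => (hh.hess y).continuousAt
  set X : E → E := fun y => (max (1 - ‖y‖ ^ 2) 0 ^ 2) • (f y • H y - h y • F y) with hXdef
  set X' : E → E →L[ℝ] E := fun y => (max (1 - ‖y‖ ^ 2) 0 ^ 2) •
      ((f y • H' y + (innerSL ℝ (F y)).smulRight (H y)) -
        (h y • F' y + (innerSL ℝ (H y)).smulRight (F y))) +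
      ((-(2 * max (1 - ‖y‖ ^ 2) 0)) • (2 • innerSL ℝ y)).smulRight (f y • H y - h y • F y)
    with hX'def
  have hX : ∀ y, HasFDerivAt X (X' y) y := by
    intro y
    have hW : HasFDerivAt (fun y : E => max (1 - ‖y‖ ^ 2) 0 ^ 2)
        ((-(2 * max (1 - ‖y‖ ^ 2) 0)) • (2 • innerSL ℝ y)) y := by
      have := (hasDerivAt_posPart_sq (‖y‖ ^ 2)).comp_hasFDerivAt y
        (hasStrictFDerivAt_norm_sq y).hasFDerivAt
      exact this
    exact hW.smul (((hf.grad y).smul (hh.hess y)).sub ((hh.grad y).smul (hf.hess y)))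
  have hX'c : ∀ v, Continuous fun y => X' y v := by
    intro v
    have := hf.hess_cont v
    have := hh.hess_cont v
    simp only [hX'def, add_apply, sub_apply, smul_apply, ContinuousLinearMap.smulRight_apply,
      innerSL_apply_apply]
    fun_prop
  have hz : ∀ y : E, 1 < ‖y‖ → max (1 - ‖y‖ ^ 2) 0 = 0 := fun y hy =>
    max_eq_right (by nlinarith)
  have hint := integral_fderiv_apply_eq_zero (μ := μ) hX hX'c
    (fun y hy => by simp [hXdef, hz y hy]) (fun y hy => by
      ext v
      simp [hX'def, hz y hy])
  have htr : ∀ y, LinearMap.trace ℝ E (X' y : E →ₗ[ℝ] E) =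
      4 * ((k : ℝ) - l) * (max (1 - ‖y‖ ^ 2) 0 * (f y * h y)) := by
    intro y
    have e1 := hf.euler y
    have e2 := hh.euler y
    simp only [hX'def, ContinuousLinearMap.toLinearMap_sub, ContinuousLinearMap.toLinearMap_add,
      ContinuousLinearMap.toLinearMap_smul, map_sub, map_add, map_smul,
      ContinuousLinearMap.coe_smulRight, LinearMap.trace_smulRight, hf.trace, hh.trace,
      ContinuousLinearMap.coe_coe, innerSL_apply_apply, smul_eq_mul, nsmul_eq_mul, LinearMap.smul_apply]
    rw [real_inner_comm (H y) (F y), real_inner_comm (F y) y, real_inner_comm (H y) y, e1, e2]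
    push_cast
    ring
  set b := stdOrthonormalBasis ℝ E
  have h0 : ∫ y, LinearMap.trace ℝ E (X' y : E →ₗ[ℝ] E) ∂μ = 0 := by
    simp only [LinearMap.trace_eq_sum_inner _ b, ContinuousLinearMap.coe_coe]
    rw [integral_finsetSum _ fun i _ => ((hint (b i)).1.const_inner (b i))]
    refine Finset.sum_eq_zero fun i _ => ?_
    rw [integral_inner (hint (b i)).1, (hint (b i)).2, inner_zero_right]
  simp only [htr] at h0
  rw [integral_const_mul] at h0
  refine (mul_eq_zero.1 h0).resolve_left ?_
  have : (k : ℝ) ≠ l := by exact_mod_cast hkl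
  have := sub_ne_zero.2 this
  positivity

/-- Integration in polar coordinates of a product of a radial and an angular function. -/
lemma integral_polar [Nontrivial E] (h : ℝ → ℝ) (F : E → ℝ) :
    ∫ y : E, h ‖y‖ * F (‖y‖⁻¹ • y) ∂μ =
      (∫ ξ : Metric.sphere (0 : E) 1, F ξ ∂μ.toSphere) *
        ∫ r : Set.Ioi (0 : ℝ), h r ∂(Measure.volumeIoiPow (Module.finrank ℝ E - 1)) := by
  calc _ = ∫ y : ({(0)}ᶜ : Set E), h ‖y.1‖ * F (‖y.1‖⁻¹ • y.1) ∂(μ.comap Subtype.val) := by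
        rw [integral_subtype_comap (measurableSet_singleton _).compl
          fun x : E ↦ h ‖x‖ * F (‖x‖⁻¹ • x), restrict_compl_singleton]
    _ = ∫ x : Metric.sphere (0 : E) 1 × Set.Ioi (0 : ℝ), F x.1 * h x.2 ∂μ.toSphere.prod
          (.volumeIoiPow (Module.finrank ℝ E - 1)) := by
        have := μ.measurePreserving_homeomorphUnitSphereProd.integral_comp
          (Homeomorph.measurableEmbedding _)
          (fun x : Metric.sphere (0 : E) 1 × Set.Ioi (0 : ℝ) => F x.1 * h x.2)
        rw [← this]
        refine integral_congr_ae (Filter.Eventually.of_forall fun y => ?_)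
        simp [mul_comm]
    _ = _ := integral_prod_mul (fun ξ : Metric.sphere (0 : E) 1 => F ξ)
          (fun r : Set.Ioi (0 : ℝ) => h r)

/-- Solid harmonics of different degrees are orthogonal on the sphere: the weighted orthogonality in
the ball factors in polar coordinates. -/
lemma SolidHarmonic.integral_sphere_eq_zero [Nontrivial E] {f h : E → ℝ} {F H : E → E}
    {F' H' : E → E →L[ℝ] E}
    {k l : ℕ} (hf : SolidHarmonic f F F' k) (hh : SolidHarmonic h H H' l) (hkl : k ≠ l) :
    ∫ ξ : Metric.sphere (0 : E) 1, f ξ * h ξ ∂μ.toSphere = 0 := by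
  set w : ℝ → ℝ := fun r => max (1 - r ^ 2) 0 * r ^ (k + l) with hw
  have e1 := integral_polar (μ := μ) w (fun y : E => f y * h y)
  have e2 := integral_polar (μ := μ) w (fun _ : E => 1)
  have h1 : ∫ y : E, w ‖y‖ * (f (‖y‖⁻¹ • y) * h (‖y‖⁻¹ • y)) ∂μ = 0 := by
    rw [← hf.integral_mul_eq_zero (μ := μ) hh hkl]
    refine integral_congr_ae ?_
    have : ∀ᵐ y : E ∂μ, y ≠ 0 := by
      simp [ae_iff, measure_singleton]
    filter_upwards [this] with y hy
    have hy' : ‖y‖ ≠ 0 := norm_ne_zero_iff.2 hy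
    rw [hf.homog, hh.homog]
    simp only [hw]
    rw [pow_add, inv_pow, inv_pow]
    field_simp
  have h2 : 0 < ∫ y : E, w ‖y‖ * 1 ∂μ := by
    obtain ⟨z, hz⟩ := exists_norm_eq E (show (0 : ℝ) ≤ 1 / 2 by norm_num)
    refine Continuous.integral_pos_of_hasCompactSupport_nonneg_nonzero (x := z)
      (by simp only [hw]; fun_prop)
      (HasCompactSupport.intro (isCompact_closedBall (0 : E) 1) fun y hy => ?_) (fun y => ?_) ?_
    · have : 1 < ‖y‖ := by simpa using hy
      simp only [hw]
      rw [max_eq_right (by nlinarith)]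
      simp
    · simp only [hw, Pi.zero_apply]; positivity
    · simp only [hw, hz]; norm_num
  rw [h1] at e1
  rw [e2] at h2
  exact (mul_eq_zero.1 e1.symm).resolve_right fun h => by rw [h, mul_zero] at h2; exact h2.false

end Harmonic

/-! ### Gegenbauer kernels on the sphere -/

lemma continuous_gegS (a k : ℕ) : Continuous fun x : ℝ => gegS a k x 1 :=
  continuous_iff_continuousAt.2 fun x =>
    (hasFDerivAt_gegS (hasFDerivAt_id x) (hasFDerivAt_const (1 : ℝ) x) a k).continuousAt

lemma continuous_geg (a k : ℕ) : Continuous fun x : ℝ => geg a k x 1 := by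
  simpa using continuous_gegS a (k + 2)

lemma summable_geometric_mul_pow {u : ℝ} (hu0 : 0 ≤ u) (hu1 : u < 1) (e : ℕ) :
    Summable fun k : ℕ => ((k : ℝ) + 1) ^ e * u ^ k := by
  have h := summable_pow_mul_geometric_of_norm_lt_one (R := ℝ) e
    (r := u) (by rwa [Real.norm_eq_abs, abs_of_nonneg hu0])
  by_cases hu : u = 0
  · refine summable_of_ne_finset_zero (s := {0}) fun k hk => ?_
    rw [hu, zero_pow (by simpa using hk), mul_zero]
  · have h2 := ((summable_nat_add_iff 1).2 h).mul_left u⁻¹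
    refine h2.congr fun k => ?_
    push_cast
    field_simp
    ring

/-- A symmetric kernel has a symmetric bilinear form. -/
lemma kform_symm {X : Type*} [MeasurableSpace X] {μ : Measure X} [IsFiniteMeasure μ]
    {K : X → X → ℂ} (hK : BddKernel K) (hs : ∀ ξ η, K ξ η = K η ξ) {f g : X → ℂ}
    (hf : Integrable f μ) (hg : Integrable g μ) : kform μ K f g = kform μ K g f := by
  rw [kform_eq_prod hK hf hg, kform_eq_prod hK hg hf, ← integral_prod_swap]
  refine integral_congr_ae (Filter.Eventually.of_forall fun p => ?_)
  simp only [Prod.fst_swap, Prod.snd_swap]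
  rw [hs p.2 p.1, mul_comm (f p.1)]

/-- The Cauchy-Schwarz inequality. -/
lemma norm_integral_mul_le_l2 {X : Type*} [MeasurableSpace X] {μ : Measure X} {f g : X → ℂ}
    (hf : MemLp f 2 μ) (hg : MemLp g 2 μ) : ‖∫ x, f x * g x ∂μ‖ ≤ l2 μ f * l2 μ g := by
  refine (norm_integral_le_integral_norm _).trans ?_
  simp only [norm_mul]
  have h := integral_mul_norm_le_Lp_mul_Lq (μ := μ) (f := f) (g := g) (p := 2) (q := 2)
    Real.HolderConjugate.two_two (by simpa using hf) (by simpa using hg)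
  simpa [l2, Real.sqrt_eq_rpow] using h

lemma summable_geg {x u : ℝ} (hx : |x| ≤ 1) (hu0 : 0 ≤ u) (hu1 : u < 1) (a : ℕ) :
    Summable fun k => |geg a k x 1| * u ^ k := by
  have h1 := summable_geometric_mul_pow hu0 hu1 (2 * a)
  refine Summable.of_nonneg_of_le (fun k => by positivity) (fun k => ?_) h1
  refine mul_le_mul_of_nonneg_right ?_ (by positivity)
  cases a with
  | zero => rw [geg_zero_left]; split_ifs <;> simp
  | succ a =>
    refine (abs_geg_le hx a k).trans (pow_le_pow_right₀ ?_ (by omega))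
    have : (0 : ℝ) ≤ k := Nat.cast_nonneg k
    linarith

lemma summable_geg' {x u : ℝ} (hx : |x| ≤ 1) (hu0 : 0 ≤ u) (hu1 : u < 1) (a : ℕ) :
    Summable fun k => geg a k x 1 * u ^ k := by
  refine Summable.of_norm ((summable_geg hx hu0 hu1 a).congr fun k => ?_)
  rw [norm_mul, norm_pow, Real.norm_eq_abs, Real.norm_eq_abs, abs_of_nonneg hu0]

lemma quadR_pos {x u : ℝ} (hx : |x| ≤ 1) (hu0 : 0 ≤ u) (hu1 : u < 1) : 0 < quadR x u := by
  rw [quadR]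
  nlinarith [abs_le.1 hx, mul_le_mul_of_nonneg_left (abs_le.1 hx).2 hu0]

lemma hasSum_gegS {S x u : ℝ} {a : ℕ} (h : HasSum (fun k => geg a k x 1 * u ^ k) S) :
    HasSum (fun k => gegS a (k + 1) x 1 * u ^ k) (u * S) ∧
    HasSum (fun k => gegS a k x 1 * u ^ k) (u ^ 2 * S) := by
  constructor
  · have := (hasSum_nat_add_iff (f := fun k => gegS a (k + 1) x 1 * u ^ k) (g := u * S) 1).1
      ((h.mul_left u).congr_fun fun k => ?_)
    · simpa using this
    · simp only [gegS_add_two]; ring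
  · have := (hasSum_nat_add_iff (f := fun k => gegS a k x 1 * u ^ k) (g := u ^ 2 * S) 2).1
      ((h.mul_left (u ^ 2)).congr_fun fun k => ?_)
    · simpa [Finset.sum_range_succ] using this
    · simp only [gegS_add_two]; ring

/-- The generating function of the Gegenbauer polynomials. -/
lemma hasSum_geg {x u : ℝ} (hx : |x| ≤ 1) (hu0 : 0 ≤ u) (hu1 : u < 1) (a : ℕ) :
    HasSum (fun k => geg a k x 1 * u ^ k) ((quadR x u)⁻¹ ^ a) := by
  induction a with
  | zero =>
    have := hasSum_ite_eq (0 : ℕ) (1 : ℝ)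
    refine (by simpa using this : HasSum (fun k : ℕ => if k = 0 then (1 : ℝ) else 0)
      ((quadR x u)⁻¹ ^ 0)).congr_fun fun k => ?_
    rw [geg_zero_left]
    by_cases hk : k = 0 <;> simp [hk]
  | succ a ih =>
    have hS := (summable_geg' hx hu0 hu1 (a + 1)).hasSum
    set S := ∑' k, geg (a + 1) k x 1 * u ^ k
    obtain ⟨h1, h2⟩ := hasSum_gegS hS
    have h3 := (hS.sub (h1.mul_left (2 * x))).add h2
    have h4 := h3.unique (ih.congr_fun fun k => by rw [quad_inv_pow_eq a k x 1]; ring)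
    have hD := (quadR_pos hx hu0 hu1).ne'
    have : S = (quadR x u)⁻¹ ^ (a + 1) := by
      rw [pow_succ, ← h4, quadR]
      rw [quadR] at hD
      field_simp
    rwa [← this]

/-- The zonal polynomial of degree `k` in dimension `2 n`, with generating function the Poisson
kernel; it is a multiple of `C_k^{(n-1)}`, and `zonal n 0 = 1`. -/
def zonal (n k : ℕ) (x : ℝ) : ℝ := geg n k x 1 - gegS n k x 1

lemma continuous_zonal (n k : ℕ) : Continuous (zonal n k) :=
  (continuous_geg n k).sub (continuous_gegS n k)

lemma exists_geg_eq_sum (n k : ℕ) : ∃ s : Finset ℕ, ∀ x, geg n k x 1 = ∑ j ∈ s, zonal n j x := by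
  suffices h : ∃ s : Finset ℕ, (∀ j ∈ s, j ≤ k) ∧ ∀ x, geg n k x 1 = ∑ j ∈ s, zonal n j x from
    h.imp fun s hs => hs.2
  induction k using Nat.strong_induction_on with
  | _ k ih =>
    match k with
    | 0 => exact ⟨{0}, by simp, fun x => by simp [zonal]⟩
    | 1 => exact ⟨{1}, by simp, fun x => by simp [zonal]⟩
    | k + 2 =>
      obtain ⟨s, hs, h⟩ := ih k (by omega)
      have hk : k + 2 ∉ s := fun hk => by have := hs _ hk; omega
      refine ⟨insert (k + 2) s, fun j hj => ?_, fun x => ?_⟩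
      · rcases Finset.mem_insert.1 hj with rfl | hj
        · exact le_rfl
        · have := hs j hj; omega
      · rw [Finset.sum_insert hk, ← h, zonal, gegS_add_two]; ring

lemma hasSum_zonal {x u : ℝ} (hx : |x| ≤ 1) (hu0 : 0 ≤ u) (hu1 : u < 1) (n : ℕ) :
    HasSum (fun k => zonal n k x * u ^ k) ((1 - u ^ 2) * (quadR x u)⁻¹ ^ n) := by
  have h := hasSum_geg hx hu0 hu1 n
  have := h.sub (hasSum_gegS h).2
  rw [sub_mul, one_mul]
  exact this.congr_fun fun k => by rw [zonal]; ring

lemma abs_zonal_le {x : ℝ} (hx : |x| ≤ 1) (n k : ℕ) :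
    |zonal n k x| ≤ 2 * ((k : ℝ) + 1) ^ (2 * n) := by
  have hg : ∀ k, |geg n k x 1| ≤ ((k : ℝ) + 1) ^ (2 * n) := by
    intro k
    cases n with
    | zero => rw [geg_zero_left]; split_ifs <;> simp
    | succ a =>
      refine (abs_geg_le hx a k).trans (pow_le_pow_right₀ ?_ (by omega))
      have : (0 : ℝ) ≤ k := Nat.cast_nonneg k
      linarith
  have hS : |gegS n k x 1| ≤ ((k : ℝ) + 1) ^ (2 * n) := by
    match k with
    | 0 => simp
    | 1 => simp
    | k + 2 =>
      rw [gegS_add_two]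
      refine (hg k).trans ?_
      push_cast
      gcongr
      linarith
  rw [zonal]
  have := abs_sub (geg n k x 1) (gegS n k x 1)
  linarith [hg k]

section Sphere

variable {n : ℕ}

/-- The inner product of two points of the sphere. -/
def sip (ξ η : Sph n) : ℝ := inner ℝ (ξ : Cn n) (η : Cn n)

lemma continuous_sip : Continuous fun p : Sph n × Sph n => sip p.1 p.2 := by
  unfold sip; fun_prop

lemma abs_sip_le (ξ η : Sph n) : |sip ξ η| ≤ 1 := by
  have := abs_real_inner_le_norm (ξ : Cn n) (η : Cn n)
  simpa [sip] using this

lemma sip_comm (ξ η : Sph n) : sip ξ η = sip η ξ := real_inner_comm _ _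

instance : IsFiniteMeasure (surf n) := by unfold surf; infer_instance

lemma bddKernel_sip {F : ℝ → ℝ} (hF : Continuous F) :
    BddKernel (fun ξ η : Sph n => (F (sip ξ η) : ℂ)) := by
  obtain ⟨B, hB⟩ := (isCompact_Icc (a := (-1 : ℝ)) (b := 1)).exists_bound_of_continuousOn
    hF.continuousOn
  refine ⟨(Complex.continuous_ofReal.comp (hF.comp continuous_sip)).measurable, |B|, abs_nonneg _,
    fun ξ η => ?_⟩
  rw [Complex.norm_real]
  exact (hB _ (abs_le.1 (abs_sip_le ξ η))).trans (le_abs_self B)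

lemma finrank_Cn : Module.finrank ℝ (Cn n) = 2 * n := by
  rw [← Module.finrank_mul_finrank ℝ ℂ (Cn n)]
  simp

/-- The zonal kernel of degree `k` on the sphere, a multiple of the reproducing kernel of the
spherical harmonics of degree `k`. -/
def zker (n k : ℕ) (ξ η : Sph n) : ℂ := (zonal n k (sip ξ η) : ℝ)

lemma bddKernel_zker (k : ℕ) : BddKernel (zker n k) := bddKernel_sip (continuous_zonal n k)

lemma zonal_mul (m k : ℕ) (ξ η : Sph (m + 1)) :
    (m : ℝ) * zonal (m + 1) k (sip ξ η) =
      (k + m) * zon m (k + 2) (ξ : Cn (m + 1)) (η : Cn (m + 1)) := by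
  have h := geg_contig m k (sip ξ η) 1
  have h1 : ‖(η : Cn (m + 1))‖ = 1 := by simp
  rw [zon, gegS_add_two, h1, one_pow]
  change _ = _ * geg m k (sip ξ η) 1
  rw [h, zonal]
  ring

/-- Zonal polynomials of different degrees, even with different poles, are orthogonal: they are
restrictions of solid harmonics. -/
lemma integral_zonal_mul_zonal (hn : 2 ≤ n) {k l : ℕ} (hkl : k ≠ l) (ξ ζ : Sph n) :
    ∫ η, zonal n k (sip ξ η) * zonal n l (sip η ζ) ∂(surf n) = 0 := by
  obtain ⟨m, rfl⟩ : ∃ m, n = m + 1 := ⟨n - 1, by omega⟩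
  have hm : (m : ℝ) ≠ 0 := by
    have : m ≠ 0 := by omega
    exact_mod_cast this
  have hnorm : ∀ ξ : Sph (m + 1), ‖(ξ : Cn (m + 1))‖ = 1 := fun ξ => by simp
  obtain ⟨F, F', hF⟩ := solidHarmonic_zon m k finrank_Cn (hnorm ξ)
  obtain ⟨H, H', hH⟩ := solidHarmonic_zon m l finrank_Cn (hnorm ζ)
  have : Nontrivial (Cn (m + 1)) :=
    Module.nontrivial_of_finrank_pos (R := ℝ) (by rw [finrank_Cn]; omega)
  have h := hF.integral_sphere_eq_zero (μ := volume) hH hkl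
  have e : ∀ η : Sph (m + 1), zonal (m + 1) k (sip ξ η) * zonal (m + 1) l (sip η ζ) =
      ((k + m) / m * ((l + m) / m) : ℝ) * (zon m (k + 2) (ξ : Cn (m + 1)) η *
        zon m (l + 2) (ζ : Cn (m + 1)) η) := by
    intro η
    have h1 := zonal_mul m k ξ η
    have h2 := zonal_mul m l ζ η
    rw [sip_comm η ζ]
    field_simp
    linear_combination (m * zonal (m + 1) l (sip ζ η)) * h1 +
      ((k + m) * zon m (k + 2) (ξ : Cn (m + 1)) (η : Cn (m + 1))) * h2
  simp only [e]
  rw [integral_const_mul]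
  unfold surf
  rw [h, mul_zero]

/-- The operators of different degrees annihilate each other. -/
lemma kop_zker_kop_zker (hn : 2 ≤ n) {k l : ℕ} (hkl : k ≠ l) {f : Sph n → ℂ}
    (hf : Integrable f (surf n)) (ξ : Sph n) :
    kop (surf n) (zker n k) (kop (surf n) (zker n l) f) ξ = 0 := by
  obtain ⟨A, hA0, hA⟩ := (bddKernel_zker (n := n) k).bdd
  obtain ⟨B, hB0, hB⟩ := (bddKernel_zker (n := n) l).bdd
  have hint : Integrable (Function.uncurry fun η ζ => zker n k ξ η * (zker n l η ζ * f ζ))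
      ((surf n).prod (surf n)) := by
    have h1 : Integrable (fun p : Sph n × Sph n => zker n l p.1 p.2 * f p.2)
        ((surf n).prod (surf n)) :=
      (hf.comp_snd (surf n)).bdd_mul (c := B) (bddKernel_zker l).meas.aestronglyMeasurable
        (Filter.Eventually.of_forall fun p => hB p.1 p.2)
    exact h1.bdd_mul (c := A) (((bddKernel_zker k).meas.comp
      (measurable_const.prodMk measurable_fst)).aestronglyMeasurable)
      (Filter.Eventually.of_forall fun p => hA ξ p.1)
  calc _ = ∫ η, ∫ ζ, zker n k ξ η * (zker n l η ζ * f ζ) ∂(surf n) ∂(surf n) := by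
        simp only [kop, integral_const_mul]
    _ = ∫ ζ, ∫ η, zker n k ξ η * (zker n l η ζ * f ζ) ∂(surf n) ∂(surf n) :=
        integral_integral_swap hint
    _ = ∫ ζ : Sph n, (0 : ℂ) ∂(surf n) := by
        refine integral_congr_ae (Filter.Eventually.of_forall fun ζ => ?_)
        simp only [← mul_assoc]
        rw [integral_mul_const]
        have := integral_zonal_mul_zonal hn hkl ξ ζ
        have h2 : ∫ η, zker n k ξ η * zker n l η ζ ∂(surf n) = 0 := by
          simp only [zker, ← Complex.ofReal_mul]
          rw [integral_complex_ofReal, this, Complex.ofReal_zero]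
        rw [h2, zero_mul]
    _ = 0 := integral_zero _ _

/-- The Poisson kernel of the ball. -/
def poisson (n : ℕ) (u : ℝ) (ξ η : Sph n) : ℂ :=
  ((1 - u ^ 2) * (quadR (sip ξ η) u)⁻¹ ^ n : ℝ)

lemma bddKernel_poisson {u : ℝ} (hu0 : 0 ≤ u) (hu1 : u < 1) : BddKernel (poisson n u) := by
  have hpos : ∀ x : ℝ, 0 < quadR (min x 1) u := fun x => by
    rw [quadR]
    nlinarith [mul_le_mul_of_nonneg_left (min_le_right x 1) hu0]
  have hc : Continuous fun x : ℝ => (1 - u ^ 2) * (quadR (min x 1) u)⁻¹ ^ n := by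
    refine continuous_const.mul (Continuous.pow (Continuous.inv₀ ?_ fun x => (hpos x).ne') n)
    unfold quadR; fun_prop
  have h := bddKernel_sip (n := n) hc
  have e : poisson n u = fun ξ η : Sph n =>
      (((1 - u ^ 2) * (quadR (min (sip ξ η) 1) u)⁻¹ ^ n : ℝ) : ℂ) := by
    funext ξ η
    rw [min_eq_left (abs_le.1 (abs_sip_le ξ η)).2, poisson]
  rwa [e]

/-- The Poisson operator is the Abel sum of the zonal operators. -/
lemma hasSum_kop_zker {u : ℝ} (hu0 : 0 ≤ u) (hu1 : u < 1) {f : Sph n → ℂ}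
    (hf : Integrable f (surf n)) (ξ : Sph n) :
    HasSum (fun k => (u : ℂ) ^ k * kop (surf n) (zker n k) f ξ)
      (kop (surf n) (poisson n u) f ξ) := by
  have hint : ∀ k : ℕ, Integrable (fun η => (u : ℂ) ^ k * (zker n k ξ η * f η)) (surf n) :=
    fun k => ((bddKernel_zker k).integrable hf ξ).const_mul _
  have hle : ∀ k : ℕ, ∫ η, ‖(u : ℂ) ^ k * (zker n k ξ η * f η)‖ ∂(surf n) ≤
      u ^ k * (2 * ((k : ℝ) + 1) ^ (2 * n)) * ∫ η, ‖f η‖ ∂(surf n) := by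
    intro k
    rw [← integral_const_mul]
    refine integral_mono (hint k).norm (hf.norm.const_mul _) fun η => ?_
    have := abs_zonal_le (abs_sip_le ξ η) n k
    simp only [norm_mul, norm_pow, Complex.norm_real, Real.norm_eq_abs, abs_of_nonneg hu0, zker]
    rw [mul_assoc]
    gcongr
  have hsum : Summable fun k : ℕ => ∫ η, ‖(u : ℂ) ^ k * (zker n k ξ η * f η)‖ ∂(surf n) := by
    refine Summable.of_nonneg_of_le (fun k => integral_nonneg fun η => norm_nonneg _) hle ?_
    refine Summable.mul_right _ ?_
    have h := summable_geometric_mul_pow hu0 hu1 (2 * n)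
    exact (h.mul_left 2).congr fun k => by ring
  have h := hasSum_integral_of_summable_integral_norm hint hsum
  have e1 : ∀ k : ℕ, ∫ η, (u : ℂ) ^ k * (zker n k ξ η * f η) ∂(surf n) =
      (u : ℂ) ^ k * kop (surf n) (zker n k) f ξ := fun k => integral_const_mul _ _
  have e2 : ∫ η, ∑' k : ℕ, (u : ℂ) ^ k * (zker n k ξ η * f η) ∂(surf n) =
      kop (surf n) (poisson n u) f ξ := by
    refine integral_congr_ae (Filter.Eventually.of_forall fun η => ?_)
    have h1 := Complex.hasSum_ofReal.2 (hasSum_zonal (abs_sip_le ξ η) hu0 hu1 n)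
    refine HasSum.tsum_eq ((h1.mul_right (f η)).congr_fun fun k => ?_)
    simp only [zker]; push_cast; ring
  rw [e2] at h
  exact h.congr_fun fun k => (e1 k).symm

lemma poisson_symm (u : ℝ) (ξ η : Sph n) : poisson n u ξ η = poisson n u η ξ := by
  rw [poisson, poisson, sip_comm]

lemma integral_poisson (hn : 2 ≤ n) {u : ℝ} (hu0 : 0 ≤ u) (hu1 : u < 1) (ξ : Sph n) :
    ∫ η, ‖poisson n u ξ η‖ ∂(surf n) = (surf n).real Set.univ := by
  have h := hasSum_kop_zker hu0 hu1 (f := fun _ => 1) (integrable_const (1 : ℂ)) ξ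
  have hz : ∀ η ζ : Sph n, zker n 0 η ζ = 1 := fun η ζ => by simp [zker, zonal]
  have h0 : ∀ k ≠ 0, (u : ℂ) ^ k * kop (surf n) (zker n k) (fun _ => 1) ξ = 0 := by
    intro k hk
    have := integral_zonal_mul_zonal hn hk ξ ξ
    have e : kop (surf n) (zker n k) (fun _ => 1) ξ = 0 := by
      simp only [kop, mul_one, zker]
      rw [integral_complex_ofReal]
      have e2 : ∀ η, zonal n 0 (sip η ξ) = 1 := fun η => by simp [zonal]
      simp only [e2, mul_one] at this
      rw [this, Complex.ofReal_zero]
    rw [e, mul_zero]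
  have h1 := (hasSum_single 0 h0).unique h
  simp only [kop, mul_one, hz, pow_zero, one_mul] at h1
  have e3 : ∀ η, poisson n u ξ η = ((‖poisson n u ξ η‖ : ℝ) : ℂ) := fun η => by
    rw [poisson, Complex.norm_real, Real.norm_of_nonneg]
    have := (quadR_pos (abs_sip_le ξ η) hu0 hu1)
    have : u ^ 2 ≤ 1 := by nlinarith
    have := sub_nonneg.2 this
    positivity
  rw [integral_congr_ae (Filter.Eventually.of_forall e3), integral_complex_ofReal] at h1
  simp only [integral_const] at h1
  exact_mod_cast (by simpa using h1.symm)

lemma opBound_poisson (hn : 2 ≤ n) {u : ℝ} (hu0 : 0 ≤ u) (hu1 : u < 1) :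
    OpBound (surf n) (poisson n u) ((surf n).real Set.univ) := by
  refine opBound_of_schur (bddKernel_poisson hu0 hu1) measureReal_nonneg
    (fun ξ => (integral_poisson hn hu0 hu1 ξ).le) fun η => ?_
  rw [← integral_poisson hn hu0 hu1 η]
  simp only [poisson_symm u _ η]
  exact le_rfl

/-- The kernel `C_k^{(n)}(ξ · η)` has `L²` norm bounded independently of `k`: it is the sum of the
mutually orthogonal zonal kernels of degrees `k, k - 2, …`, and each of those is controlled
by the Poisson kernel as its parameter tends to `1`. -/
lemma opBound_geg (hn : 2 ≤ n) (k : ℕ) :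
    OpBound (surf n) (fun ξ η : Sph n => (geg n k (sip ξ η) 1 : ℂ)) ((surf n).real Set.univ) := by
  have hT : BddKernel (fun ξ η : Sph n => ((geg n k (sip ξ η) 1 : ℝ) : ℂ)) :=
    bddKernel_sip (continuous_geg n k)
  set T : Sph n → Sph n → ℂ := fun ξ η => ((geg n k (sip ξ η) 1 : ℝ) : ℂ) with hTdef
  obtain ⟨s, hs⟩ := exists_geg_eq_sum n k
  have hTs : ∀ {f : Sph n → ℂ}, Integrable f (surf n) → ∀ ξ, kop (surf n) T f ξ =
      ∑ j ∈ s, kop (surf n) (zker n j) f ξ := by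
    intro f hf ξ
    simp only [kop]
    rw [← integral_finsetSum _ fun j _ => (bddKernel_zker j).integrable hf ξ]
    refine integral_congr_ae (Filter.Eventually.of_forall fun η => ?_)
    simp only [hTdef, hs, zker]
    push_cast
    rw [Finset.sum_mul]
  have hle : ∀ f : Sph n → ℂ, MemLp f 2 (surf n) →
      l2 (surf n) (kop (surf n) T f) ≤ (surf n).real Set.univ * l2 (surf n) f := by
    intro f hf
    have hf1 := integrable_of_memLp_two hf
    set h := kop (surf n) T f with hh
    have hh2 : MemLp h 2 (surf n) := hT.memLp_kop hf1 2
    have hh1 := integrable_of_memLp_two hh2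
    set g : Sph n → ℂ := fun ξ => (starRingEnd ℂ) (f ξ) with hg
    have hg2 : MemLp g 2 (surf n) := hf.star
    have hg1 := integrable_of_memLp_two hg2
    -- the Abel sum of the zonal operators at `h = T f` is finite, by orthogonality
    have hzero : ∀ j ∉ s, ∀ ξ, kop (surf n) (zker n j) h ξ = 0 := by
      intro j hj ξ
      have e : h = fun ξ => ∑ i ∈ s, kop (surf n) (zker n i) f ξ := funext (hTs hf1)
      have : kop (surf n) (zker n j) h ξ =
          ∑ i ∈ s, kop (surf n) (zker n j) (kop (surf n) (zker n i) f) ξ := by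
        rw [e]
        simp only [kop]
        rw [← integral_finsetSum]
        · simp only [Finset.mul_sum]
        · exact fun i _ => (bddKernel_zker j).integrable
            (memLp_one_iff_integrable.1 ((bddKernel_zker i).memLp_kop hf1 1)) ξ
      rw [this]
      refine Finset.sum_eq_zero fun i hi => kop_zker_kop_zker hn ?_ hf1 ξ
      rintro rfl; exact hj hi
    have hform : ∀ u : ℝ, 0 ≤ u → u < 1 → kform (surf n) (poisson n u) h g =
        ∑ j ∈ s, (u : ℂ) ^ j * kform (surf n) (zker n j) h g := by
      intro u hu0 hu1
      have e : ∀ ξ, kop (surf n) (poisson n u) h ξ =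
          ∑ j ∈ s, (u : ℂ) ^ j * kop (surf n) (zker n j) h ξ := fun ξ =>
        (hasSum_kop_zker hu0 hu1 hh1 ξ).unique
          (hasSum_sum_of_ne_finset_zero fun j hj => by rw [hzero j hj ξ, mul_zero])
      simp only [kform, e, Finset.sum_mul, ← integral_const_mul, ← mul_assoc]
      refine integral_finsetSum _ fun j _ => ?_
      simp only [mul_assoc]
      exact ((bddKernel_zker j).integrable_form hh1 hg1).const_mul _
    -- in the limit `u → 1` the Poisson kernel acts on `h` like `T`
    have hlim : ‖∑ j ∈ s, kform (surf n) (zker n j) h g‖ ≤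
        (surf n).real Set.univ * l2 (surf n) h * l2 (surf n) g := by
      have hc : Continuous fun u : ℝ => ‖∑ j ∈ s, (u : ℂ) ^ j * kform (surf n) (zker n j) h g‖ := by
        fun_prop
      have ht : Filter.Tendsto
          (fun u : ℝ => ‖∑ j ∈ s, (u : ℂ) ^ j * kform (surf n) (zker n j) h g‖)
          (nhdsWithin 1 (Set.Iio 1)) (nhds ‖∑ j ∈ s, kform (surf n) (zker n j) h g‖) := by
        have := hc.continuousAt (x := 1)
        simpa using this.tendsto.mono_left nhdsWithin_le_nhds
      refine le_of_tendsto ht ?_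
      filter_upwards [Ioo_mem_nhdsLT (show (0 : ℝ) < 1 by norm_num)] with u hu
      rw [← hform u hu.1.le hu.2]
      exact (opBound_poisson hn hu.1.le hu.2).le h g hh2 hg2
    have e1 : ∑ j ∈ s, kform (surf n) (zker n j) h g = kform (surf n) T h g := by
      simp only [kform, hTs hh1, Finset.sum_mul]
      exact (integral_finsetSum _ fun j _ => (bddKernel_zker j).integrable_form hh1 hg1).symm
    -- `T` is symmetric with a real kernel, so that its form at `T f` and `conj f` is `‖T f‖²`
    have e2 : kform (surf n) T h g = ((l2 (surf n) h ^ 2 : ℝ) : ℂ) := by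
      rw [kform_symm hT (fun ξ η => by simp only [hTdef, sip_comm ξ η]) hh1 hg1, l2_sq, kform,
        ← integral_complex_ofReal]
      refine integral_congr_ae (Filter.Eventually.of_forall fun ξ => ?_)
      have e3 : kop (surf n) T g ξ = (starRingEnd ℂ) (h ξ) := by
        rw [hh, kop, kop, ← integral_conj]
        simp [hTdef, hg]
      simp only [e3]
      rw [mul_comm, Complex.mul_conj, Complex.normSq_eq_norm_sq]
    have e4 : l2 (surf n) g = l2 (surf n) f := by simp [l2, hg]
    rw [e1, e2, e4, Complex.norm_real, Real.norm_eq_abs, abs_of_nonneg (sq_nonneg _)] at hlim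
    by_cases h0 : l2 (surf n) h = 0
    · rw [h0]; exact mul_nonneg measureReal_nonneg (l2_nonneg f)
    · have hpos : 0 < l2 (surf n) h := lt_of_le_of_ne (l2_nonneg _) (Ne.symm h0)
      refine le_of_mul_le_mul_right ?_ hpos
      rw [← sq]; linarith
  refine ⟨hT, measureReal_nonneg, fun f g hf hg => ?_⟩
  have hh2 : MemLp (kop (surf n) T f) 2 (surf n) := hT.memLp_kop (integrable_of_memLp_two hf) 2
  refine (norm_integral_mul_le_l2 hh2 hg).trans ?_
  exact mul_le_mul_of_nonneg_right (hle f hf) (l2_nonneg g)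

end Sphere

/-! ### Smooth Schur multipliers -/

section Multiplier

open FourierTransform
open scoped Pointwise

variable {n : ℕ}

/-- The caps of radius `R l` have surface measure `O(l^{2n-1})`: the truncated cone over the
cap, of height `l`, lies in a ball of radius `(R + 1) l`. -/
lemma surf_cap_le (hn : 1 ≤ n) (v : Cn n) {R l : ℝ} (hR : 0 ≤ R) (hl0 : 0 < l) (hl1 : l ≤ 1) :
    (surf n).real {η : Sph n | ‖(η : Cn n) - v‖ ≤ R * l} ≤
      2 * n * (R + 1) ^ (2 * n) * (volume : Measure (Cn n)).real (Metric.ball 0 1) *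
        l ^ (2 * n - 1) := by
  set s := {η : Sph n | ‖(η : Cn n) - v‖ ≤ R * l} with hs
  have hsm : MeasurableSet s := by
    refine (isClosed_le ?_ continuous_const).measurableSet
    fun_prop
  set c : Set (Cn n) := Set.Ioo (0 : ℝ) 1 • (Subtype.val '' s) with hc
  have hcb : c ⊆ Metric.ball (0 : Cn n) 1 := by
    rintro _ ⟨r, hr, _, ⟨η, -, rfl⟩, rfl⟩
    have : ‖(η : Cn n)‖ = 1 := by simp
    simp only [mem_ball_zero_iff, norm_smul, this, mul_one, Real.norm_eq_abs, abs_of_pos hr.1]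
    exact hr.2
  have hfin : volume c ≠ ⊤ := ((measure_mono hcb).trans_lt measure_ball_lt_top).ne
  have hcov : c ⊆ (1 - l) • c ∪ Metric.closedBall v ((R + 1) * l) := by
    rintro _ ⟨r, hr, _, ⟨η, hη, rfl⟩, rfl⟩
    by_cases h : r < 1 - l
    · left
      have h1 : 0 < 1 - l := hr.1.trans h
      refine ⟨(r / (1 - l)) • (η : Cn n), ⟨r / (1 - l), ⟨div_pos hr.1 h1, ?_⟩, _, ⟨η, hη, rfl⟩,
        rfl⟩, ?_⟩
      · rwa [div_lt_one h1]
      · simp only [smul_smul]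
        rw [mul_div_cancel₀ _ h1.ne']
    · right
      have h1 : ‖(η : Cn n)‖ = 1 := by simp
      have h2 : ‖(η : Cn n) - v‖ ≤ R * l := hη
      rw [Metric.mem_closedBall, dist_eq_norm]
      have e : r • (η : Cn n) - v = ((η : Cn n) - v) - (1 - r) • (η : Cn n) := by module
      show ‖r • (η : Cn n) - v‖ ≤ _
      rw [e]
      refine (norm_sub_le _ _).trans ?_
      rw [norm_smul, h1, Real.norm_eq_abs, abs_of_nonneg (by linarith [hr.2])]
      linarith [not_lt.1 h]
  have hvol : volume.real c ≤ (1 - l) ^ (2 * n) * volume.real c +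
      ((R + 1) * l) ^ (2 * n) * volume.real (Metric.ball (0 : Cn n) 1) := by
    have h1 : volume.real c ≤ volume.real ((1 - l) • c) +
        volume.real (Metric.closedBall v ((R + 1) * l)) := by
      refine (measureReal_mono hcov ?_).trans (measureReal_union_le _ _)
      refine ((measure_union_le _ _).trans_lt (ENNReal.add_lt_top.2 ⟨?_, ?_⟩)).ne
      · rw [Measure.addHaar_smul]
        exact ENNReal.mul_lt_top ENNReal.ofReal_lt_top hfin.lt_top
      · exact measure_closedBall_lt_top
    have h2 : volume.real ((1 - l) • c) = (1 - l) ^ (2 * n) * volume.real c := by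
      rw [measureReal_def, Measure.addHaar_smul, ENNReal.toReal_mul, finrank_Cn,
        ENNReal.toReal_ofReal (abs_nonneg _), abs_of_nonneg (by
          rw [pow_mul]; positivity), measureReal_def]
    have h3 : volume.real (Metric.closedBall v ((R + 1) * l)) =
        ((R + 1) * l) ^ (2 * n) * volume.real (Metric.ball (0 : Cn n) 1) := by
      rw [measureReal_def, Measure.addHaar_closedBall _ _ (by positivity), ENNReal.toReal_mul,
        finrank_Cn, ENNReal.toReal_ofReal (by positivity), measureReal_def]
    rw [h2, h3] at h1
    exact h1
  have hpow : (1 - l) ^ (2 * n) ≤ 1 - l :=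
    pow_le_of_le_one (by linarith) (by linarith) (by omega)
  have hc0 : 0 ≤ volume.real c := measureReal_nonneg
  have hl : l * volume.real c ≤
      l * ((R + 1) ^ (2 * n) * volume.real (Metric.ball (0 : Cn n) 1) * l ^ (2 * n - 1)) := by
    have h1 := mul_le_mul_of_nonneg_right hpow hc0
    have h2 : l ^ (2 * n) = l * l ^ (2 * n - 1) := by rw [← pow_succ']; congr 1; omega
    rw [mul_pow, h2] at hvol
    nlinarith
  have hle := le_of_mul_le_mul_left hl hl0
  -- the surface measure of `s` is `d` times the volume of the cone over it
  have e : (surf n).real s = 2 * n * volume.real c := by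
    rw [surf, measureReal_def, Measure.toSphere_apply' _ hsm, finrank_Cn, ENNReal.toReal_mul,
      measureReal_def]
    simp [hc]
  rw [e]
  calc _ ≤ 2 * n * ((R + 1) ^ (2 * n) * volume.real (Metric.ball (0 : Cn n) 1) *
        l ^ (2 * n - 1)) := by gcongr
    _ = _ := by ring

/-- A family of smooth functions `G ξ`, supported in a fixed ball, with derivatives up to order
`d + 1` bounded by `A`; this order makes the Fourier transforms integrable, uniformly in `ξ`. -/
structure IsSymbol (R A : ℝ) (G : Sph n → Cn n → ℂ) : Prop where
  meas : Measurable (Function.uncurry G)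
  smooth : ∀ ξ, ContDiff ℝ ∞ (G ξ)
  supp : ∀ ξ v, R < ‖v‖ → G ξ v = 0
  deriv_le : ∀ ξ, ∀ k ≤ 2 * n + 1, ∀ v, ‖iteratedFDeriv ℝ k (G ξ) v‖ ≤ A

lemma iteratedFDeriv_eq_zero_of_norm {R : ℝ} {f : Cn n → ℂ} (h : ∀ v, R < ‖v‖ → f v = 0)
    (k : ℕ) {v : Cn n} (hv : R < ‖v‖) : iteratedFDeriv ℝ k f v = 0 := by
  have hs : v ∉ tsupport f := by
    intro hmem
    have : tsupport f ⊆ Metric.closedBall 0 R := by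
      refine closure_minimal (fun w hw => ?_) Metric.isClosed_closedBall
      rw [mem_closedBall_zero_iff]
      by_contra hw'
      exact hw (h w (not_le.1 hw'))
    have := mem_closedBall_zero_iff.1 (this hmem)
    linarith
  by_contra h0
  exact hs (support_iteratedFDeriv_subset k h0)

lemma IsSymbol.iteratedFDeriv_eq_zero {R A : ℝ} {G : Sph n → Cn n → ℂ} (h : IsSymbol R A G)
    (ξ : Sph n) (k : ℕ) {v : Cn n} (hv : R < ‖v‖) : iteratedFDeriv ℝ k (G ξ) v = 0 :=
  iteratedFDeriv_eq_zero_of_norm (h.supp ξ) k hv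

lemma IsSymbol.norm_le {R A : ℝ} {G : Sph n → Cn n → ℂ} (h : IsSymbol R A G) (ξ : Sph n)
    (v : Cn n) : ‖G ξ v‖ ≤ A := by
  simpa using h.deriv_le ξ 0 (by omega) v

lemma IsSymbol.integrable {R A : ℝ} {G : Sph n → Cn n → ℂ} (h : IsSymbol R A G)
    (ξ : Sph n) (k : ℕ) : Integrable (iteratedFDeriv ℝ k (G ξ)) :=
  ((h.smooth ξ).continuous_iteratedFDeriv (m := k)
    (by exact_mod_cast le_top)).integrable_of_hasCompactSupport
    (HasCompactSupport.intro (isCompact_closedBall (0 : Cn n) R) fun v hv =>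
      h.iteratedFDeriv_eq_zero ξ k (by simpa using hv))

lemma IsSymbol.norm_fourier_le {R A : ℝ} (hA : 0 ≤ A) {G : Sph n → Cn n → ℂ}
    (h : IsSymbol R A G) (ξ : Sph n) (w : Cn n) :
    ‖𝓕 (G ξ) w‖ ≤ 2 ^ (2 * n + 1) * ((1 + 2 ^ (2 * n + 1) * (2 * n + 2)) *
      (A * (volume : Measure (Cn n)).real (Metric.closedBall 0 R))) *
        (1 + ‖w‖) ^ (-((2 * n + 1 : ℕ) : ℝ)) := by
  set V := (volume : Measure (Cn n)).real (Metric.closedBall 0 R) with hV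
  have hV0 : 0 ≤ V := measureReal_nonneg
  have hint : ∀ k ≤ 2 * n + 1, ∫ v, ‖iteratedFDeriv ℝ k (G ξ) v‖ ≤ A * V := by
    intro k hk
    have e : ∫ v, ‖iteratedFDeriv ℝ k (G ξ) v‖ =
        ∫ v in Metric.closedBall (0 : Cn n) R, ‖iteratedFDeriv ℝ k (G ξ) v‖ := by
      refine (setIntegral_eq_integral_of_forall_compl_eq_zero fun v hv => ?_).symm
      rw [h.iteratedFDeriv_eq_zero ξ k (by simpa using hv), norm_zero]
    rw [e]
    calc _ ≤ ∫ v in Metric.closedBall (0 : Cn n) R, A :=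
          setIntegral_mono ((h.integrable ξ k).norm.integrableOn)
            (integrableOn_const (measure_closedBall_lt_top).ne) fun v => h.deriv_le ξ k hk v
      _ = A * V := by rw [setIntegral_const, smul_eq_mul, mul_comm]
  have hkey : ∀ m ≤ 2 * n + 1, ‖w‖ ^ m * ‖𝓕 (G ξ) w‖ ≤ 2 ^ m * ((m + 1) * (A * V)) := by
    intro m hm
    have := Real.pow_mul_norm_iteratedFDeriv_fourier_le (f := G ξ) (K := 0) (N := m) (k := 0)
      (n := m) ((h.smooth ξ).of_le (by exact_mod_cast le_top)) (fun k j hk hj => by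
        have : k = 0 := by simpa using hk
        subst this
        simpa using (h.integrable ξ j).norm) le_rfl le_rfl w
    simp only [norm_iteratedFDeriv_zero, pow_zero, one_mul, Nat.cast_zero, mul_zero, zero_add,
      Finset.range_one, Finset.singleton_product, Finset.sum_map,
      Function.Embedding.coeFn_mk] at this
    refine this.trans ?_
    gcongr
    calc _ ≤ ∑ j ∈ Finset.range (m + 1), A * V := Finset.sum_le_sum fun j hj =>
          hint j (by have := Finset.mem_range.1 hj; omega)
      _ = _ := by simp
  have h0 := hkey 0 (by omega)
  have h1 := hkey (2 * n + 1) le_rfl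
  have hw : 0 < 1 + ‖w‖ := by positivity
  rw [Real.rpow_neg hw.le, Real.rpow_natCast, ← div_eq_mul_inv, le_div_iff₀ (by positivity)]
  have h2 : (1 + ‖w‖) ^ (2 * n + 1) ≤ 2 ^ (2 * n + 1) * (1 + ‖w‖ ^ (2 * n + 1)) := by
    have := add_pow_le (zero_le_one) (norm_nonneg w) (2 * n + 1)
    rw [one_pow] at this
    refine this.trans ?_
    have : (2 : ℝ) ^ (2 * n + 1 - 1) ≤ 2 ^ (2 * n + 1) := by gcongr <;> norm_num
    gcongr
  calc _ ≤ ‖𝓕 (G ξ) w‖ * (2 ^ (2 * n + 1) * (1 + ‖w‖ ^ (2 * n + 1))) := by gcongr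
    _ = 2 ^ (2 * n + 1) * (‖w‖ ^ 0 * ‖𝓕 (G ξ) w‖ + ‖w‖ ^ (2 * n + 1) * ‖𝓕 (G ξ) w‖) := by ring
    _ ≤ 2 ^ (2 * n + 1) * (2 ^ 0 * (((0 : ℕ) + 1) * (A * V)) +
          2 ^ (2 * n + 1) * (((2 * n + 1 : ℕ) + 1) * (A * V))) := by gcongr
    _ = _ := by push_cast; ring

/-- A smooth function of `(η - ε ξ) / l` is a Schur multiplier: by Fourier inversion it is a
superposition of products of unimodular functions of `ξ` and of `η`. -/
lemma exists_opBound_mul_symbol (n : ℕ) (R : ℝ) : ∃ C : ℝ, 0 ≤ C ∧ ∀ (A : ℝ)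
    (G : Sph n → Cn n → ℂ), 0 ≤ A → IsSymbol R A G → ∀ (ε l : ℝ) (K : Sph n → Sph n → ℂ) (M : ℝ),
    OpBound (surf n) K M →
    OpBound (surf n) (fun ξ η => G ξ (l⁻¹ • ((η : Cn n) - ε • (ξ : Cn n))) * K ξ η)
      (C * A * M) := by
  set B : ℝ := 2 ^ (2 * n + 1) * ((1 + 2 ^ (2 * n + 1) * (2 * n + 2)) *
      (volume : Measure (Cn n)).real (Metric.closedBall 0 R)) with hB
  have hB0 : 0 ≤ B := by positivity
  have hJ : Integrable (fun w : Cn n => (1 + ‖w‖) ^ (-((2 * n + 1 : ℕ) : ℝ))) :=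
    integrable_one_add_norm (by rw [finrank_Cn]; push_cast; linarith)
  set J := ∫ w : Cn n, (1 + ‖w‖) ^ (-((2 * n + 1 : ℕ) : ℝ)) with hJdef
  have hJ0 : 0 ≤ J := integral_nonneg fun w => by positivity
  refine ⟨B * J, by positivity, fun A G hA hG ε l K M hK => ?_⟩
  have hF : ∀ ξ w, ‖𝓕 (G ξ) w‖ ≤ B * A * (1 + ‖w‖) ^ (-((2 * n + 1 : ℕ) : ℝ)) := by
    intro ξ w
    refine (hG.norm_fourier_le hA ξ w).trans_eq ?_
    rw [hB]; ring
  have hFm : Measurable (fun p : Sph n × Cn n => 𝓕 (G p.1) p.2) := by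
    have : StronglyMeasurable (fun p : Sph n × Cn n => ∫ v : Cn n,
        Complex.exp ((↑(-2 * Real.pi * inner ℝ v p.2) * Complex.I)) • G p.1 v) := by
      refine StronglyMeasurable.integral_prod_right
        (f := fun (p : Sph n × Cn n) (v : Cn n) =>
          Complex.exp ((↑(-2 * Real.pi * inner ℝ v p.2) * Complex.I)) • G p.1 v) ?_
      refine (Measurable.stronglyMeasurable ?_)
      have h1 : Measurable fun q : (Sph n × Cn n) × Cn n =>
          Complex.exp ((↑(-2 * Real.pi * inner ℝ q.2 q.1.2) * Complex.I)) :=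
        Continuous.measurable (by fun_prop)
      exact h1.mul (hG.meas.comp
        ((measurable_fst.comp measurable_fst).prodMk measurable_snd))
    simpa only [Real.fourier_eq'] using this.measurable
  have hFi : ∀ ξ, Integrable (𝓕 (G ξ)) := fun ξ =>
    (hJ.const_mul (B * A)).mono' (hFm.comp measurable_prodMk_left).aestronglyMeasurable
      (Filter.Eventually.of_forall fun w => hF ξ w)
  have hGi : ∀ ξ, Integrable (G ξ) := fun ξ =>
    (hG.smooth ξ).continuous.integrable_of_hasCompactSupport
      (HasCompactSupport.intro (isCompact_closedBall (0 : Cn n) R) fun v hv =>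
        hG.supp ξ v (by simpa using hv))
  -- the two unimodular factors
  set e : Cn n → Cn n → ℂ := fun w v =>
    Complex.exp ((↑(2 * Real.pi * inner ℝ w (l⁻¹ • v)) * Complex.I)) with he
  have hinv : ∀ ξ η : Sph n, G ξ (l⁻¹ • ((η : Cn n) - ε • (ξ : Cn n))) =
      ∫ w : Cn n, 𝓕 (G ξ) w * e w (-(ε • (ξ : Cn n))) * e w (η : Cn n) := by
    intro ξ η
    have h1 := (hGi ξ).fourierInv_fourier_eq (hFi ξ) (hG.smooth ξ).continuous.continuousAt
      (v := l⁻¹ • ((η : Cn n) - ε • (ξ : Cn n)))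
    rw [← h1, Real.fourierInv_eq']
    refine integral_congr_ae (Filter.Eventually.of_forall fun w => ?_)
    simp only [he]
    rw [smul_eq_mul, mul_assoc (𝓕 (G ξ) w), ← Complex.exp_add, mul_comm]
    congr 2
    rw [← add_mul, ← Complex.ofReal_add, ← mul_add, ← inner_add_right, ← smul_add,
      neg_add_eq_sub]
  have henorm : ∀ w v, ‖e w v‖ = 1 := fun w v => Complex.norm_exp_ofReal_mul_I _
  have hec : Continuous fun p : Cn n × Cn n => e p.1 p.2 := by
    simp only [he]; fun_prop
  have hKG : BddKernel (fun ξ η => G ξ (l⁻¹ • ((η : Cn n) - ε • (ξ : Cn n))) * K ξ η) := by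
    refine BddKernel.mul (K := fun ξ η : Sph n => G ξ (l⁻¹ • ((η : Cn n) - ε • (ξ : Cn n))))
      ⟨?_, A, hA, fun ξ η => hG.norm_le ξ _⟩ hK.toBddKernel
    refine hG.meas.comp (measurable_fst.prodMk (Continuous.measurable ?_))
    fun_prop
  refine ⟨hKG, by have := hK.nonneg; positivity, fun f g hf hg => ?_⟩
  have hf1 := integrable_of_memLp_two hf
  have hg1 := integrable_of_memLp_two hg
  set H : Sph n × Sph n → Cn n → ℂ := fun p w =>
    (𝓕 (G p.1) w * e w (-(ε • (p.1 : Cn n))) * e w (p.2 : Cn n)) *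
      (K p.1 p.2 * (f p.2 * g p.1)) with hH
  have hHi : Integrable (Function.uncurry H) (((surf n).prod (surf n)).prod volume) := by
    have h1 : Integrable (fun q : (Sph n × Sph n) × Cn n =>
        (K q.1.1 q.1.2 * (f q.1.2 * g q.1.1)) *
          (((B * A * (1 + ‖q.2‖) ^ (-((2 * n + 1 : ℕ) : ℝ)) : ℝ)) : ℂ))
        (((surf n).prod (surf n)).prod volume) :=
      (hK.integrable_prod hf1 hg1).mul_prod ((hJ.const_mul (B * A)).ofReal)
    refine h1.mono ?_ (Filter.Eventually.of_forall fun q => ?_)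
    · refine AEStronglyMeasurable.mul (Measurable.aestronglyMeasurable ?_)
        (hK.integrable_prod hf1 hg1).1.comp_fst
      refine (Measurable.mul (hFm.comp
        ((measurable_fst.comp measurable_fst).prodMk measurable_snd)) ?_).mul ?_
      · exact (hec.comp (by fun_prop : Continuous fun q : (Sph n × Sph n) × Cn n =>
          (q.2, -(ε • (q.1.1 : Cn n))))).measurable
      · exact (hec.comp (by fun_prop : Continuous fun q : (Sph n × Sph n) × Cn n =>
          (q.2, (q.1.2 : Cn n)))).measurable
    · simp only [Function.uncurry, hH, norm_mul, henorm, mul_one]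
      rw [mul_comm]
      refine mul_le_mul_of_nonneg_left ?_ (by positivity)
      rw [Complex.norm_real]
      exact (hF _ _).trans (le_abs_self _)
  have e1 : kform (surf n) (fun ξ η => G ξ (l⁻¹ • ((η : Cn n) - ε • (ξ : Cn n))) * K ξ η) f g =
      ∫ w, ∫ p, H p w ∂((surf n).prod (surf n)) := by
    rw [kform_eq_prod hKG hf1 hg1, ← integral_integral_swap hHi]
    refine integral_congr_ae (Filter.Eventually.of_forall fun p => ?_)
    simp only [hH]
    rw [integral_mul_const, ← hinv]
    ring
  rw [e1]
  have hle : ∀ w, ‖∫ p, H p w ∂((surf n).prod (surf n))‖ ≤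
      (B * A * M * l2 (surf n) f * l2 (surf n) g) * (1 + ‖w‖) ^ (-((2 * n + 1 : ℕ) : ℝ)) := by
    intro w
    have hb : Measurable fun η : Sph n => e w (η : Cn n) :=
      (hec.comp (by fun_prop : Continuous fun η : Sph n => (w, (η : Cn n)))).measurable
    have ha : Measurable fun ξ : Sph n => 𝓕 (G ξ) w * e w (-(ε • (ξ : Cn n))) :=
      (hFm.comp measurable_prodMk_right).mul
        (hec.comp (by fun_prop : Continuous fun ξ : Sph n => (w, -(ε • (ξ : Cn n))))).measurable
    have hop := hK.mul_both ha hb (A := B * A * (1 + ‖w‖) ^ (-((2 * n + 1 : ℕ) : ℝ)))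
      (by positivity) zero_le_one (fun ξ => by
        rw [norm_mul, henorm, mul_one]; exact hF ξ w) (fun η => (henorm w _).le)
    have h1 := hop.le f g hf hg
    rw [kform_eq_prod hop.toBddKernel hf1 hg1] at h1
    calc _ = ‖∫ p : Sph n × Sph n, 𝓕 (G p.1) w * e w (-(ε • (p.1 : Cn n))) *
          e w (p.2 : Cn n) * K p.1 p.2 * (f p.2 * g p.1) ∂((surf n).prod (surf n))‖ := by
            simp only [hH, mul_assoc]
      _ ≤ _ := h1
      _ = _ := by ring
  refine (norm_integral_le_of_norm_le (hJ.const_mul _)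
    (Filter.Eventually.of_forall hle)).trans_eq ?_
  rw [integral_const_mul, ← hJdef]
  ring

end Multiplier

/-! ### Cutoffs at a fixed distance and Landau's inequality -/

section Cutoffs

variable {n : ℕ}

/-- Symbols that depend smoothly on a parameter in a compact set are uniformly bounded. -/
lemma exists_iteratedFDeriv_le_of_compact {P : Type*} [NormedAddCommGroup P] [NormedSpace ℝ P]
    {Ψ : P × Cn n → ℂ} (hΨ : ContDiff ℝ ∞ Ψ) {S : Set P} (hS : IsCompact S) {R : ℝ}
    (h0 : ∀ p v, R < ‖v‖ → Ψ (p, v) = 0) (m : ℕ) :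
    ∃ A : ℝ, 0 ≤ A ∧ ∀ p ∈ S, ∀ k ≤ m, ∀ v, ‖iteratedFDeriv ℝ k (fun v => Ψ (p, v)) v‖ ≤ A := by
  have hk : ∀ k : ℕ, ∃ A : ℝ, 0 ≤ A ∧ ∀ p ∈ S, ∀ v,
      ‖iteratedFDeriv ℝ k (fun v => Ψ (p, v)) v‖ ≤ A := by
    intro k
    have hc : Continuous (iteratedFDeriv ℝ k Ψ) :=
      hΨ.continuous_iteratedFDeriv (by exact_mod_cast le_top)
    obtain ⟨A, hA⟩ := (hS.prod (isCompact_closedBall (0 : Cn n) R)).exists_bound_of_continuousOn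
      hc.continuousOn
    refine ⟨|A|, abs_nonneg _, fun p hp v => ?_⟩
    rcases lt_or_ge R ‖v‖ with hv | hv
    · rw [iteratedFDeriv_eq_zero_of_norm (h0 p) k hv, norm_zero]; exact abs_nonneg A
    · have e : (fun v => Ψ (p, v)) =
          (fun q => Ψ ((p, 0) + q)) ∘ (ContinuousLinearMap.inr ℝ P (Cn n)) := by
        funext v; simp
      have hΨ' : ContDiff ℝ ∞ (fun q => Ψ ((p, 0) + q)) := hΨ.comp (contDiff_const.add contDiff_id)
      rw [e, ContinuousLinearMap.iteratedFDeriv_comp_right _ hΨ' _ (i := k)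
        (by exact_mod_cast le_top), iteratedFDeriv_comp_add_left]
      refine (ContinuousMultilinearMap.norm_compContinuousLinearMap_le _ _).trans ?_
      rw [Finset.prod_const]
      have h1 : ‖ContinuousLinearMap.inr ℝ P (Cn n)‖ ≤ 1 := ContinuousLinearMap.norm_inr_le_one ..
      have h2 := hA (p, v) ⟨hp, by simpa using hv⟩
      calc _ ≤ ‖iteratedFDeriv ℝ k Ψ ((p, 0) + ContinuousLinearMap.inr ℝ P (Cn n) v)‖ * 1 := by
            gcongr
            exact pow_le_one₀ (norm_nonneg _) h1
        _ ≤ |A| := by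
            rw [mul_one]
            simpa using h2.trans (le_abs_self A)
  choose A hA0 hA using hk
  refine ⟨∑ k ∈ Finset.range (m + 1), A k, Finset.sum_nonneg fun k _ => hA0 k,
    fun p hp k hkm v => (hA k p hp v).trans ?_⟩
  exact Finset.single_le_sum (f := A) (fun i _ => hA0 i) (Finset.mem_range.2 (by omega))

/-- A smooth function with compact support in `(0, ∞)`. -/
structure IsBump (φ : ℝ → ℝ) : Prop where
  smooth : ContDiff ℝ ∞ φ
  supp : ∃ a b : ℝ, 0 < a ∧ ∀ s, φ s ≠ 0 → a ≤ s ∧ s ≤ b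

lemma exists_isBump_eq_one {a b : ℝ} (ha : 0 < a) : ∃ φ : ℝ → ℝ, IsBump φ ∧
    (∀ s, φ s ≠ 0 → a / 2 ≤ s ∧ s ≤ b + a) ∧ ∀ s, a ≤ s → s ≤ b → φ s = 1 := by
  by_cases hab : b < a
  · refine ⟨fun _ => 0, ⟨contDiff_const, 1, 1, one_pos, fun s hs => absurd rfl hs⟩,
      fun s hs => absurd rfl hs, fun s h1 h2 => ?_⟩
    linarith
  · have hab := not_lt.1 hab
    let f : ContDiffBump ((a + b) / 2) :=
      ⟨(b - a) / 2 + a / 4, (b - a) / 2 + a / 2, by linarith, by linarith⟩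
    have hs : ∀ s, f s ≠ 0 → a / 2 ≤ s ∧ s ≤ b + a := by
      intro s hs
      have : s ∈ Metric.ball ((a + b) / 2) ((b - a) / 2 + a / 2) := by
        rw [← f.support_eq]; exact hs
      rw [Real.ball_eq_Ioo] at this
      constructor <;> linarith [this.1, this.2]
    refine ⟨f, ⟨f.contDiff, a / 2, b + a, by linarith, hs⟩, hs, fun s h1 h2 => ?_⟩
    refine f.one_of_mem_closedBall ?_
    rw [Real.closedBall_eq_Icc]
    constructor <;> simp only [f] <;> linarith

lemma IsBump.exists_eq_one {φ : ℝ → ℝ} (h : IsBump φ) :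
    ∃ φ' : ℝ → ℝ, IsBump φ' ∧ ∀ s, φ s * φ' s = φ s := by
  obtain ⟨a, b, ha, hab⟩ := h.supp
  obtain ⟨φ', h1, -, h2⟩ := exists_isBump_eq_one (b := b) ha
  refine ⟨φ', h1, fun s => ?_⟩
  by_cases hs : φ s = 0
  · rw [hs, zero_mul]
  · rw [h2 s (hab s hs).1 (hab s hs).2, mul_one]

/-- The square `‖η - ε ξ‖²` of the distance, for `ε = ± 1`. -/
def sqDist (ε : ℝ) (ξ η : Sph n) : ℝ := 2 - 2 * ε * sip ξ η

lemma norm_sub_sq {ε : ℝ} (hε : ε ^ 2 = 1) (ξ η : Sph n) :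
    ‖(η : Cn n) - ε • (ξ : Cn n)‖ ^ 2 = sqDist ε ξ η := by
  have h1 : ‖(η : Cn n)‖ = 1 := by simp
  have h2 : ‖(ξ : Cn n)‖ = 1 := by simp
  rw [norm_sub_sq_real, norm_smul, mul_pow, h1, h2, inner_smul_right, real_inner_comm, sqDist, sip,
    Real.norm_eq_abs, sq_abs, hε]
  ring

lemma quadR_sip {ε : ℝ} (hε : ε ^ 2 = 1) (u : ℝ) (ξ η : Sph n) :
    quadR (sip ξ η) u = (1 - ε * u) ^ 2 + ε * u * sqDist ε ξ η := by
  rw [quadR, sqDist]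
  linear_combination (2 * sip ξ η * u - u ^ 2) * hε

/-- A smooth positive function that is the identity on `[c, ∞)`. -/
def posExt (c t : ℝ) : ℝ :=
  t * Real.smoothTransition (t / c) + (1 - Real.smoothTransition (t / c))

lemma posExt_pos {c : ℝ} (hc : 0 < c) (t : ℝ) : 0 < posExt c t := by
  rw [posExt]
  rcases le_or_gt t 0 with h | h
  · rw [Real.smoothTransition.zero_of_nonpos (div_nonpos_of_nonpos_of_nonneg h hc.le)]
    norm_num
  · have h0 := Real.smoothTransition.nonneg (t / c)
    have h1 := Real.smoothTransition.le_one (t / c)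
    rcases h1.eq_or_lt with h2 | h2
    · rw [h2]; linarith
    · nlinarith

lemma posExt_eq {c t : ℝ} (hc : 0 < c) (h : c ≤ t) : posExt c t = t := by
  rw [posExt, Real.smoothTransition.one_of_one_le ((one_le_div hc).2 h)]
  ring

lemma contDiff_posExt (c : ℝ) : ContDiff ℝ ∞ (posExt c) := by
  have h : ContDiff ℝ ∞ fun t : ℝ => Real.smoothTransition (t / c) :=
    Real.smoothTransition.contDiff.comp (contDiff_id.div_const c)
  exact (contDiff_id.mul h).add (contDiff_const.sub h)

/-- The Schur multipliers `φ(ρ / l²) (p + q ρ / l²)^{-b}`, uniformly in the parameters. -/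
lemma exists_opBound_cut_mul_inv_pow {φ : ℝ → ℝ} (hφ : IsBump φ) {c : ℝ} (hc : 0 < c) (b : ℕ) :
    ∃ C : ℝ, 0 ≤ C ∧ ∀ (ε l p q : ℝ), ε ^ 2 = 1 → 0 < l → |p| ≤ 2 → |q| ≤ 2 →
      (∀ s, φ s ≠ 0 → s * l ^ 2 ≤ 4 → c ≤ p + q * s) → ∀ (K : Sph n → Sph n → ℂ) (M : ℝ),
      OpBound (surf n) K M →
      OpBound (surf n) (fun ξ η => ((φ (sqDist ε ξ η / l ^ 2) *
        (p + q * (sqDist ε ξ η / l ^ 2))⁻¹ ^ b : ℝ) : ℂ) * K ξ η) (C * M) := by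
  obtain ⟨a₀, b₀, ha₀, hab⟩ := hφ.supp
  set R : ℝ := √ (|b₀|) with hR
  -- `posExt` agrees with the identity where `φ` does not vanish, and avoids the poles elsewhere
  set Ψ : (ℝ × ℝ) × Cn n → ℂ := fun x =>
    ((φ (‖x.2‖ ^ 2) * (posExt c (x.1.1 + x.1.2 * ‖x.2‖ ^ 2))⁻¹ ^ b : ℝ) : ℂ) with hΨdef
  have hn2 : ContDiff ℝ ∞ fun x : (ℝ × ℝ) × Cn n => ‖x.2‖ ^ 2 := contDiff_snd.norm_sq ℝ
  have hΨ : ContDiff ℝ ∞ Ψ := by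
    refine Complex.ofRealCLM.contDiff.comp ((hφ.smooth.comp hn2).mul (ContDiff.pow ?_ b))
    refine ContDiff.inv ((contDiff_posExt c).comp ?_) fun x => (posExt_pos hc _).ne'
    exact (contDiff_fst.comp contDiff_fst).add ((contDiff_snd.comp contDiff_fst).mul hn2)
  have h0 : ∀ (p : ℝ × ℝ) (v : Cn n), R < ‖v‖ → Ψ (p, v) = 0 := by
    intro p v hv
    have : φ (‖v‖ ^ 2) = 0 := by
      by_contra h
      have h1 := (hab _ h).2
      have h2 := (Real.sqrt_lt' (by
        have := Real.sqrt_nonneg |b₀|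
        linarith)).1 hv
      linarith [le_abs_self b₀]
    simp [hΨdef, this]
  obtain ⟨A, hA0, hA⟩ := exists_iteratedFDeriv_le_of_compact hΨ
    ((isCompact_Icc (a := (-2 : ℝ)) (b := 2)).prod (isCompact_Icc (a := (-2 : ℝ)) (b := 2))) h0
    (2 * n + 1)
  obtain ⟨C, hC0, hC⟩ := exists_opBound_mul_symbol n R
  refine ⟨C * A, by positivity, fun ε l p q hε hl hp hq hpq K M hK => ?_⟩
  have hsym : IsSymbol R A (fun (_ : Sph n) v => Ψ ((p, q), v)) := by
    refine ⟨?_, fun ξ => hΨ.comp (contDiff_const.prodMk contDiff_id), fun ξ v => h0 _ v,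
      fun ξ k hk v => hA (p, q) ⟨abs_le.1 hp, abs_le.1 hq⟩ k hk v⟩
    exact (hΨ.continuous.comp (continuous_const.prodMk continuous_snd)).measurable
  refine (hC A _ hA0 hsym ε l K M hK).congr fun ξ η => ?_
  have e : ‖l⁻¹ • ((η : Cn n) - ε • (ξ : Cn n))‖ ^ 2 = sqDist ε ξ η / l ^ 2 := by
    rw [norm_smul, mul_pow, norm_sub_sq hε, Real.norm_eq_abs, sq_abs]
    field_simp
  have hle : sqDist ε ξ η ≤ 4 := by
    rw [← norm_sub_sq hε]
    have h1 : ‖(η : Cn n)‖ = 1 := by simp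
    have h2 : ‖ε • (ξ : Cn n)‖ = 1 := by
      have : |ε| = 1 := by rw [← sq_eq_sq₀ (abs_nonneg _) zero_le_one, sq_abs, hε, one_pow]
      simp [norm_smul, this]
    have := norm_sub_le (η : Cn n) (ε • (ξ : Cn n))
    rw [h1, h2] at this
    nlinarith [norm_nonneg ((η : Cn n) - ε • (ξ : Cn n))]
  simp only [hΨdef, e]
  by_cases hs : φ (sqDist ε ξ η / l ^ 2) = 0
  · simp [hs]
  · rw [posExt_eq hc (hpq _ hs (by field_simp; linarith))]

/-- The localization of a kernel to `‖η - ε ξ‖ ≈ l`. -/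
def cut (φ : ℝ → ℝ) (ε l : ℝ) (ξ η : Sph n) : ℂ := (φ (sqDist ε ξ η / l ^ 2) : ℝ)

lemma exists_opBound_cut {φ : ℝ → ℝ} (hφ : IsBump φ) : ∃ C : ℝ, 0 ≤ C ∧ ∀ (ε l : ℝ),
    ε ^ 2 = 1 → 0 < l → ∀ (K : Sph n → Sph n → ℂ) (M : ℝ), OpBound (surf n) K M →
    OpBound (surf n) (fun ξ η => cut φ ε l ξ η * K ξ η) (C * M) := by
  obtain ⟨C, hC0, hC⟩ := exists_opBound_cut_mul_inv_pow (n := n) hφ one_pos 0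
  refine ⟨C, hC0, fun ε l hε hl K M hK => ?_⟩
  have := hC ε l 1 0 hε hl (by norm_num) (by norm_num) (fun s _ _ => by norm_num) K M hK
  simpa [cut] using this

/-- Landau's inequality for first differences, in a form adapted to the three-term recurrence: if
the localized `V j` are bounded by `Y` and the localized `ρ V j` by `δ`, then the recurrence
bounds the second differences, and as long as `M b ≤ 1 / 4` the first differences gain a factor
`1 / M`, up to a term `M δ`. -/
lemma opBound_landau {V : ℕ → Sph n → Sph n → ℂ} {W ρ : Sph n → Sph n → ℂ} {β : ℕ → ℝ}
    {k M : ℕ} {Y δ b : ℝ} (hM : 1 ≤ M) (hδ : 0 ≤ δ) (hb0 : 0 ≤ b) (hMb : M * b ≤ 1 / 4)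
    (hV : ∀ j ≥ k, OpBound (surf n) (fun ξ η => W ξ η * V j ξ η) Y)
    (hρ : ∀ j ≥ k, OpBound (surf n) (fun ξ η => W ξ η * (ρ ξ η * V j ξ η)) δ)
    (hβ : ∀ j ≥ k, |β j| ≤ b)
    (hrec : ∀ j ≥ k, ∀ ξ η, (V (j + 2) ξ η - V (j + 1) ξ η) - (V (j + 1) ξ η - V j ξ η) =
      β j * ((V (j + 2) ξ η - V (j + 1) ξ η) + (V (j + 1) ξ η - V j ξ η)) -
        ρ ξ η * V (j + 1) ξ η) :
    ∀ j ≥ k, OpBound (surf n) (fun ξ η => W ξ η * (V (j + 1) ξ η - V j ξ η))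
      (4 * Y / M + 2 * M * δ) := by
  have hM0 : (0 : ℝ) < M := by exact_mod_cast hM
  have hY : 0 ≤ Y := (hV k le_rfl).nonneg
  set D : ℕ → Sph n → Sph n → ℂ := fun j ξ η => V (j + 1) ξ η - V j ξ η with hD
  set T : ℝ := 2 * Y / M + M * δ with hT
  have hT0 : 0 ≤ T := by positivity
  -- one improvement of a bound `Z` for the first differences; it is iterated below
  have step : ∀ Z : ℝ, (∀ j ≥ k, OpBound (surf n) (fun ξ η => W ξ η * D j ξ η) Z) →
      ∀ j ≥ k, OpBound (surf n) (fun ξ η => W ξ η * D j ξ η) (T + Z / 2) := by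
    intro Z hZ j hj
    have hZ0 : 0 ≤ Z := (hZ k le_rfl).nonneg
    -- second differences, from the recurrence and the bound `Z`
    have h2 : ∀ i ≥ k, OpBound (surf n) (fun ξ η => W ξ η * (D (i + 1) ξ η - D i ξ η))
        (b * (Z + Z) + δ) := by
      intro i hi
      have h3 := (((hZ (i + 1) (by omega)).add (hZ i hi)).const_mul (β i)).sub
        (hρ (i + 1) (by omega))
      refine (h3.congr fun ξ η => ?_).mono ?_
      · simp only [hD]
        rw [hrec i hi ξ η]
        ring
      · have h4 := hβ i hi
        rw [Complex.norm_real, Real.norm_eq_abs]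
        gcongr
    have h3 : ∀ i, OpBound (surf n) (fun ξ η => W ξ η * (D (j + i) ξ η - D j ξ η))
        (i * (b * (Z + Z) + δ)) := by
      intro i
      refine (OpBound.sum i fun l _ => h2 (j + l) (by omega)).congr fun ξ η => ?_
      have := Finset.sum_range_sub (fun l => D (j + l) ξ η) i
      simp only [← add_assoc, add_zero] at this
      rw [← Finset.mul_sum, this]
    -- the average of `M` first differences telescopes; the deviation from the average is controlled
    -- by the second differences
    have h4 : OpBound (surf n) (fun ξ η => ∑ i ∈ Finset.range M,
        W ξ η * (D (j + i) ξ η - D j ξ η)) (M * (M * (b * (Z + Z) + δ))) := by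
      refine OpBound.sum M fun i hi => (h3 i).mono ?_
      have : (i : ℝ) ≤ M := by exact_mod_cast hi.le
      gcongr
    have h5 := (((hV (j + M) (by omega)).sub (hV j hj)).sub h4).const_mul ((M : ℂ)⁻¹)
    refine (h5.congr fun ξ η => ?_).mono ?_
    · have h6 : ∑ i ∈ Finset.range M, D (j + i) ξ η = V (j + M) ξ η - V j ξ η := by
        have := Finset.sum_range_sub (fun l => V (j + l) ξ η) M
        simpa [hD, add_assoc] using this
      rw [← Finset.mul_sum, Finset.sum_sub_distrib, h6]
      have : (M : ℂ) ≠ 0 := by exact_mod_cast hM0.ne'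
      simp only [Finset.sum_const, Finset.card_range, nsmul_eq_mul]
      field_simp
      ring
    · rw [norm_inv, Complex.norm_natCast]
      have e : (M : ℝ)⁻¹ * (Y + Y + M * (M * (b * (Z + Z) + δ))) =
          T + 2 * (M * b) * Z := by
        rw [hT]; field_simp; ring
      rw [e]
      nlinarith
  have hiter : ∀ i : ℕ, ∀ j ≥ k, OpBound (surf n) (fun ξ η => W ξ η * D j ξ η)
      (2 * T + 2 * Y / 2 ^ i) := by
    intro i
    induction i with
    | zero =>
      intro j hj
      refine (((hV (j + 1) (by omega)).sub (hV j hj)).congr fun ξ η => ?_).mono ?_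
      · simp only [hD]; ring
      · rw [pow_zero, div_one]; linarith
    | succ i ih =>
      intro j hj
      refine (step _ ih j hj).mono (le_of_eq ?_)
      rw [pow_succ]; field_simp; ring
  intro j hj
  have e : 4 * Y / M + 2 * M * δ = 2 * T := by rw [hT]; ring
  rw [e]
  refine OpBound.of_forall_add (by positivity) fun δ' hδ' => ?_
  obtain ⟨i, hi⟩ := exists_pow_lt_of_lt_one (show 0 < δ' / (2 * Y + 1) by positivity)
    (show (1 / 2 : ℝ) < 1 by norm_num)
  refine (hiter i j hj).mono ?_
  rw [lt_div_iff₀ (by positivity)] at hi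
  have e2 : 2 * Y / 2 ^ i = (1 / 2) ^ i * (2 * Y) := by
    rw [one_div, inv_pow]; field_simp
  have : (0 : ℝ) < (1 / 2) ^ i := by positivity
  rw [e2]
  nlinarith

end Cutoffs

/-! ### `L²` bounds of the localized remainders -/

section Descent

variable {n : ℕ}

lemma eq_or_eq_neg_of_sq_eq_one {ε : ℝ} (h : ε ^ 2 = 1) : ε = 1 ∨ ε = -1 := by
  rwa [sq, mul_self_eq_one_iff] at h

lemma IsBump.id_mul {φ : ℝ → ℝ} (h : IsBump φ) : IsBump fun s => s * φ s := by
  obtain ⟨a, b, ha, hab⟩ := h.supp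
  exact ⟨contDiff_id.mul h.smooth, a, b, ha, fun s hs => hab s (right_ne_zero_of_mul hs)⟩

/-- `ε^k C_k^{(a)}`, as a kernel. -/
def altGeg (n a : ℕ) (ε : ℝ) (k : ℕ) (ξ η : Sph n) : ℂ := ((ε ^ k * geg a k (sip ξ η) 1 : ℝ) : ℂ)

lemma geg_add_two_eq (a j : ℕ) (x : ℝ) :
    geg a (j + 2) x 1 = a / (j + 2 + a) * (geg (a + 1) (j + 2) x 1 - geg (a + 1) j x 1) := by
  have h := geg_contig a (j + 2) x 1
  rw [gegS_add_two] at h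
  push_cast at h
  have : (0 : ℝ) < j + 2 + a := by positivity
  field_simp
  linarith

/-- The three-term recurrence in the form required by `opBound_landau`. -/
lemma altGeg_rec {a : ℕ} {ε : ℝ} (hε : ε ^ 2 = 1) (j : ℕ) (ξ η : Sph n) :
    (altGeg n (a + 1) ε (j + 2) ξ η - altGeg n (a + 1) ε (j + 1) ξ η) -
      (altGeg n (a + 1) ε (j + 1) ξ η - altGeg n (a + 1) ε j ξ η) =
    ((a / (j + 2 + a) : ℝ) : ℂ) * ((altGeg n (a + 1) ε (j + 2) ξ η -
        altGeg n (a + 1) ε (j + 1) ξ η) +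
      (altGeg n (a + 1) ε (j + 1) ξ η - altGeg n (a + 1) ε j ξ η)) -
    ((sqDist ε ξ η : ℝ) : ℂ) * altGeg n (a + 1) ε (j + 1) ξ η := by
  have h1 := geg_rec a j (sip ξ η) 1
  have h3 := geg_add_two_eq a j (sip ξ η)
  simp only [altGeg, sqDist]
  norm_cast
  push_cast
  rw [pow_succ, pow_succ]
  linear_combination (ε ^ j * (geg (a + 1) (j + 2) (sip ξ η) 1 - a / (j + 2 + a) *
    geg (a + 1) (j + 2) (sip ξ η) 1 - 2 * sip ξ η * geg (a + 1) (j + 1) (sip ξ η) 1)) * hε +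
    ε ^ j * h1 + ε ^ j * h3

/-- Bounds of size `(l / (k + 1))^i` for the localized polynomials of index `n - i`. -/
def GegBound (n i : ℕ) : Prop := ∀ φ : ℝ → ℝ, IsBump φ → ∃ C : ℝ, 0 ≤ C ∧ ∀ (ε l : ℝ) (k : ℕ),
  ε ^ 2 = 1 → 0 < l → l < 1 → (8 * n + 2 * i : ℝ) ≤ (k + 1) * l →
  OpBound (surf n) (fun ξ η => cut φ ε l ξ η * altGeg n (n - i) ε k ξ η)
    (C * (l / (k + 1)) ^ i)

/-- First differences of the localized polynomials gain a factor `l`. -/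
def GegDiffBound (n i : ℕ) : Prop := ∀ φ : ℝ → ℝ, IsBump φ → ∃ C : ℝ, 0 ≤ C ∧
  ∀ (ε l : ℝ) (k : ℕ), ε ^ 2 = 1 → 0 < l → l < 1 → (8 * n + 2 * i : ℝ) ≤ (k + 1) * l →
  OpBound (surf n) (fun ξ η => cut φ ε l ξ η *
    (altGeg n (n - i) ε (k + 1) ξ η - altGeg n (n - i) ε k ξ η)) (C * l * (l / (k + 1)) ^ i)

/-- Landau's inequality with `M` of order `1 / l`: on the support of the cutoff `‖η - εξ‖²` is of
order `l²`, so that `M δ` and `Y / M` are both of order `l Y`. -/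
lemma gegDiffBound (hn : 2 ≤ n) {i : ℕ} (hi : i < n) (h : GegBound n i) : GegDiffBound n i := by
  intro φ hφ
  obtain ⟨C₁, hC₁, H₁⟩ := h φ hφ
  obtain ⟨C₂, hC₂, H₂⟩ := h _ hφ.id_mul
  refine ⟨4 * C₁ + 4 * C₂, by positivity, fun ε l k hε hl0 hl1 hk => ?_⟩
  obtain ⟨a, ha⟩ : ∃ a, n - i = a + 1 := ⟨n - i - 1, by omega⟩
  have hn0 : (2 : ℝ) ≤ n := by exact_mod_cast hn
  have hk0 : (0 : ℝ) < k + 1 := by positivity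
  set M := ⌈l⁻¹⌉₊ with hMdef
  have hM1 : l⁻¹ ≤ M := Nat.le_ceil _
  have hl1' : 1 < l⁻¹ := (one_lt_inv₀ hl0).2 hl1
  have hM2 : (M : ℝ) ≤ 2 * l⁻¹ := by
    have := Nat.ceil_lt_add_one (show 0 ≤ l⁻¹ by positivity)
    linarith
  have hM : 1 ≤ M := Nat.one_le_ceil_iff.2 (by positivity)
  set Y := (l / ((k : ℝ) + 1)) ^ i with hY
  have hY0 : 0 ≤ Y := by positivity
  have hmono : ∀ j ≥ k, (l / ((j : ℝ) + 1)) ^ i ≤ Y := by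
    intro j hj
    have : (k : ℝ) ≤ j := by exact_mod_cast hj
    rw [hY]
    gcongr
  have hthr : ∀ j ≥ k, (8 * n + 2 * i : ℝ) ≤ (j + 1) * l := by
    intro j hj
    have : (k : ℝ) ≤ j := by exact_mod_cast hj
    refine hk.trans ?_
    gcongr
  have key := opBound_landau (V := altGeg n (n - i) ε) (W := cut φ ε l)
    (ρ := fun ξ η => ((sqDist ε ξ η : ℝ) : ℂ)) (β := fun j => (a : ℝ) / (j + 2 + a)) (k := k)
    (M := M) (Y := C₁ * Y) (δ := l ^ 2 * (C₂ * Y)) (b := n / (k + 1)) hM (by positivity)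
    (by positivity) ?_ ?_ ?_ ?_ ?_ k le_rfl
  · refine key.mono ?_
    have h1 : 4 * (C₁ * Y) / M ≤ 4 * (C₁ * Y) * l := by
      rw [div_eq_mul_inv]
      gcongr
      exact inv_le_of_inv_le₀ hl0 hM1
    have h2 : 2 * M * (l ^ 2 * (C₂ * Y)) ≤ 2 * (2 * l⁻¹) * (l ^ 2 * (C₂ * Y)) := by gcongr
    have h3 : 2 * (2 * l⁻¹) * (l ^ 2 * (C₂ * Y)) = 4 * l * (C₂ * Y) := by field_simp; ring
    linarith
  · calc (M : ℝ) * (n / (k + 1)) ≤ 2 * l⁻¹ * (n / (k + 1)) := by gcongr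
      _ ≤ 1 / 4 := by
        rw [show 2 * l⁻¹ * ((n : ℝ) / (k + 1)) = 2 * n / ((k + 1) * l) by field_simp,
          div_le_iff₀ (by positivity)]
        have : (0 : ℝ) ≤ i := by positivity
        linarith
  · intro j hj
    refine (H₁ ε l j hε hl0 hl1 (hthr j hj)).mono ?_
    have := hmono j hj
    gcongr
  · intro j hj
    have h1 := (H₂ ε l j hε hl0 hl1 (hthr j hj)).const_mul ((l ^ 2 : ℝ) : ℂ)
    refine (h1.congr fun ξ η => ?_).mono ?_
    · simp only [cut]
      have : l ^ 2 * (sqDist ε ξ η / l ^ 2 * φ (sqDist ε ξ η / l ^ 2)) =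
          φ (sqDist ε ξ η / l ^ 2) * sqDist ε ξ η := by field_simp
      rw [← mul_assoc, ← mul_assoc, ← Complex.ofReal_mul, ← Complex.ofReal_mul, this]
    · rw [Complex.norm_real, Real.norm_eq_abs, abs_of_nonneg (sq_nonneg l)]
      have := hmono j hj
      gcongr
  · intro j hj
    have h1 : (k : ℝ) ≤ j := by exact_mod_cast hj
    have h2 : (a : ℝ) ≤ n := by exact_mod_cast (by omega : a ≤ n)
    rw [abs_of_nonneg (by positivity)]
    exact div_le_div₀ (by positivity) h2 hk0 (by linarith [(Nat.cast_nonneg a : (0 : ℝ) ≤ a)])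
  · intro j hj ξ η
    rw [ha]
    exact altGeg_rec hε j ξ η

/-- Descent in the index, starting from `opBound_geg`: `(k + a) C_k^{(a)}` is `a` times the
difference `C_k^{(a+1)} - C_{k-2}^{(a+1)}`, which is a sum of two first differences. -/
lemma gegBound (hn : 2 ≤ n) {i : ℕ} (hi : i ≤ n) : GegBound n i := by
  induction i with
  | zero =>
    intro φ hφ
    obtain ⟨C, hC, H⟩ := exists_opBound_cut (n := n) hφ
    refine ⟨C * (surf n).real Set.univ, mul_nonneg hC measureReal_nonneg,
      fun ε l k hε hl0 hl1 hk => ?_⟩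
    have h1 := H ε l hε hl0 _ _ ((opBound_geg hn k).const_mul ((ε ^ k : ℝ) : ℂ))
    refine (h1.congr fun ξ η => ?_).mono ?_
    · simp [altGeg]
    · have : ‖((ε ^ k : ℝ) : ℂ)‖ = 1 := by
        rw [Complex.norm_real, norm_pow]
        have : ‖ε‖ = 1 := by
          rw [Real.norm_eq_abs, ← sq_eq_sq₀ (abs_nonneg _) zero_le_one, sq_abs, hε, one_pow]
        rw [this, one_pow]
      rw [this]; simp
  | succ i ih =>
    intro φ hφ
    obtain ⟨C, hC, H⟩ := gegDiffBound hn (by omega) (ih (by omega)) φ hφ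
    refine ⟨2 * n * C * 3 ^ i, by positivity, fun ε l k hε hl0 hl1 hk => ?_⟩
    obtain ⟨a, ha⟩ : ∃ a, n - i = a + 1 := ⟨n - i - 1, by omega⟩
    have ha' : n - (i + 1) = a := by omega
    have hn0 : (2 : ℝ) ≤ n := by exact_mod_cast hn
    have hk2 : 2 ≤ k := by
      by_contra hlt
      have h1 : (k : ℝ) ≤ 1 := by exact_mod_cast (by omega : k ≤ 1)
      have h2 : ((k : ℝ) + 1) * l ≤ 2 * 1 := by gcongr; linarith
      push_cast at hk
      have : (0 : ℝ) ≤ i := by positivity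
      linarith
    obtain ⟨j, rfl⟩ : ∃ j, k = j + 2 := ⟨k - 2, by omega⟩
    push_cast at hk ⊢
    have hk1 : (8 * n + 2 * i : ℝ) ≤ (j + 1) * l := by nlinarith
    have hk1' : (8 * n + 2 * i : ℝ) ≤ ((j + 1 : ℕ) + 1) * l := by push_cast; nlinarith
    have h1 := ((H ε l (j + 1) hε hl0 hl1 hk1').add (H ε l j hε hl0 hl1 hk1)).const_mul
      ((a / (j + 2 + a) : ℝ) : ℂ)
    rw [ha] at h1
    rw [ha']
    refine (h1.congr fun ξ η => ?_).mono ?_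
    · have h3 := geg_add_two_eq a j (sip ξ η)
      simp only [cut, altGeg]
      norm_cast
      push_cast
      rw [h3]
      linear_combination (-(a : ℝ) / (j + 2 + a) * φ (sqDist ε ξ η / l ^ 2) *
        geg (a + 1) j (sip ξ η) 1 * -ε ^ j) * hε
    · rw [Complex.norm_real, Real.norm_eq_abs, abs_of_nonneg (by positivity)]
      set r := l / ((j : ℝ) + 2 + 1) with hr
      have e1 : l / (((j + 1 : ℕ) : ℝ) + 1) ≤ 3 * r := by
        rw [hr, ← mul_div_assoc, div_le_div_iff₀ (by positivity) (by positivity)]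
        push_cast; nlinarith [(Nat.cast_nonneg j : (0 : ℝ) ≤ j)]
      have e2 : l / ((j : ℝ) + 1) ≤ 3 * r := by
        rw [hr, ← mul_div_assoc, div_le_div_iff₀ (by positivity) (by positivity)]
        nlinarith [(Nat.cast_nonneg j : (0 : ℝ) ≤ j)]
      have e3 : (a : ℝ) / (j + 2 + a) * l ≤ n * r := by
        rcases Nat.eq_zero_or_pos a with h0 | h0
        · rw [h0]; simp; positivity
        · have : (a : ℝ) ≤ n := by exact_mod_cast (by omega : a ≤ n)
          have h1 : (1 : ℝ) ≤ a := by exact_mod_cast h0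
          rw [hr, div_mul_eq_mul_div, ← mul_div_assoc]
          gcongr
      calc _ ≤ (a : ℝ) / (j + 2 + a) * (C * l * (3 * r) ^ i + C * l * (3 * r) ^ i) := by gcongr
        _ = 2 * C * 3 ^ i * (r ^ i) * ((a : ℝ) / (j + 2 + a) * l) := by rw [mul_pow]; ring
        _ ≤ 2 * C * 3 ^ i * (r ^ i) * (n * r) := by gcongr
        _ = _ := by rw [pow_succ]; ring

/-- Negative powers of `1 - 2xu + u²` act as Schur multipliers on the localized kernels. When
`ε = -1`, the localization has to stay away from the antipodal point of `εξ`. -/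
lemma exists_opBound_cut_mul_quadR {φ : ℝ → ℝ} (hφ : IsBump φ) (b : ℕ) :
    ∃ C : ℝ, 0 ≤ C ∧ ∀ (ε l u : ℝ), ε ^ 2 = 1 → 0 < l → l < 1 → 0 < u →
      (ε = 1 ∨ ∀ s, φ s ≠ 0 → s * l ^ 2 ≤ 3) → ∀ (K : Sph n → Sph n → ℂ) (M : ℝ),
      OpBound (surf n) K M →
      OpBound (surf n) (fun ξ η => cut φ ε l ξ η * (((quadR (sip ξ η) u)⁻¹ ^ b : ℝ) : ℂ) * K ξ η)
        (C * (|1 - ε * u| + l)⁻¹ ^ (2 * b) * M) := by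
  obtain ⟨a₀, b₀, ha₀, hab⟩ := hφ.supp
  obtain ⟨C, hC, H⟩ := exists_opBound_cut_mul_inv_pow (n := n) hφ
    (c := min (1 / 16) (2 * a₀ / 9)) (by positivity) b
  refine ⟨C, hC, fun ε l u hε hl0 hl1 hu hcond K M hK => ?_⟩
  set E := |1 - ε * u| + l with hE
  have habs := abs_nonneg (1 - ε * u)
  have hE0 : 0 < E := by positivity
  have hlE : l ≤ E := by linarith
  have hsq : (1 - ε * u) ^ 2 = |1 - ε * u| ^ 2 := (sq_abs _).symm
  have hp : |(1 - ε * u) ^ 2 / E ^ 2| ≤ 2 := by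
    rw [abs_of_nonneg (by positivity), div_le_iff₀ (by positivity), hsq]
    nlinarith
  have hq : |ε * u * l ^ 2 / E ^ 2| ≤ 2 := by
    have hε1 : |ε| = 1 := by rw [← sq_eq_sq₀ (abs_nonneg _) zero_le_one, sq_abs, hε, one_pow]
    rw [abs_div, abs_mul, abs_mul, hε1, abs_of_pos hu, abs_of_nonneg (by positivity : 0 ≤ l ^ 2),
      abs_of_nonneg (by positivity : 0 ≤ E ^ 2), div_le_iff₀ (by positivity), one_mul]
    have h1 : u ≤ 1 + |1 - ε * u| := by
      rcases eq_or_eq_neg_of_sq_eq_one hε with rfl | rfl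
      · linarith [neg_abs_le (1 - 1 * u)]
      · linarith [le_abs_self (1 - -1 * u)]
    have h2 : u * l ^ 2 ≤ (1 + |1 - ε * u|) * l ^ 2 := by gcongr
    nlinarith [mul_nonneg habs hl0.le, mul_nonneg (mul_nonneg habs hl0.le) (sub_nonneg.2 hl1.le)]
  have hpq : ∀ s, φ s ≠ 0 → s * l ^ 2 ≤ 4 → min (1 / 16) (2 * a₀ / 9) ≤
      (1 - ε * u) ^ 2 / E ^ 2 + ε * u * l ^ 2 / E ^ 2 * s := by
    intro s hs _
    have has := (hab s hs).1
    have e : (1 - ε * u) ^ 2 / E ^ 2 + ε * u * l ^ 2 / E ^ 2 * s =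
        ((1 - ε * u) ^ 2 + ε * u * (s * l ^ 2)) / E ^ 2 := by ring
    rw [e, le_div_iff₀ (by positivity)]
    by_cases h1 : ε = 1
    · subst h1
      simp only [one_mul] at *
      by_cases h : l / 2 ≤ |1 - u|
      · have h2 : (1 / 16 : ℝ) * E ^ 2 ≤ (1 - u) ^ 2 := by rw [hsq]; nlinarith
        have h3 : 0 ≤ u * (s * l ^ 2) := by have := ha₀.trans_le has; positivity
        calc _ ≤ (1 / 16 : ℝ) * E ^ 2 := by gcongr; exact min_le_left _ _
          _ ≤ _ := by linarith
      · have h := not_le.1 h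
        have hu2 : 1 / 2 ≤ u := by linarith [le_abs_self (1 - u)]
        calc _ ≤ (2 * a₀ / 9) * (3 / 2 * l) ^ 2 := by
              gcongr
              · exact min_le_right _ _
              · linarith
          _ = 1 / 2 * (a₀ * l ^ 2) := by ring
          _ ≤ u * (s * l ^ 2) := by gcongr
          _ ≤ _ := by nlinarith
    · have h3 := hcond.resolve_left h1 s hs
      have h4 : ε = -1 := by
        rcases eq_or_eq_neg_of_sq_eq_one hε with h | h
        · exact absurd h h1
        · exact h
      subst h4
      have h5 : |1 - -1 * u| = 1 + u := by rw [abs_of_nonneg] <;> linarith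
      rw [h5] at hE
      calc _ ≤ (1 / 16 : ℝ) * (2 * (1 + u)) ^ 2 := by
            gcongr
            · exact min_le_left _ _
            · linarith
        _ ≤ _ := by nlinarith [mul_le_mul_of_nonneg_left h3 hu.le, sq_nonneg (1 - u)]
  have h := (H ε l _ _ hε hl0 hp hq hpq K M hK).const_mul ((E⁻¹ ^ (2 * b) : ℝ) : ℂ)
  refine (h.congr fun ξ η => ?_).mono (le_of_eq ?_)
  · have e : (1 - ε * u) ^ 2 / E ^ 2 + ε * u * l ^ 2 / E ^ 2 * (sqDist ε ξ η / l ^ 2) =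
        quadR (sip ξ η) u / E ^ 2 := by
      rw [quadR_sip hε u]; field_simp
    rw [e, inv_div, div_pow, ← pow_mul]
    simp only [cut]
    rw [← mul_assoc, ← Complex.ofReal_mul, ← Complex.ofReal_mul]
    congr 2
    rw [inv_pow, inv_pow]
    field_simp
  · rw [Complex.norm_real, Real.norm_of_nonneg (by positivity)]
    ring

/-- The `L²` bound of the localized Taylor remainders, by induction on the index along the recursion
defining `rem`. Passing to a lower index costs a factor `(1 - 2xu + u²)^{-1}`, which is compensated
by the gain `l / (k + 1) ≤ l²` of the polynomials of lower index. -/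
lemma exists_opBound_cut_mul_rem (hn : 2 ≤ n) {m : ℕ} (hm : m ≤ n) : ∀ (b : ℕ) (φ : ℝ → ℝ),
    IsBump φ → ∃ C : ℝ, 0 ≤ C ∧ ∀ (ε l u : ℝ) (k : ℕ), ε ^ 2 = 1 → 0 < l → l < 1 → 0 < u →
      (ε = 1 ∨ ∀ s, φ s ≠ 0 → s * l ^ 2 ≤ 3) → (10 * n : ℝ) ≤ (k + 1) * l →
      OpBound (surf n) (fun ξ η => cut φ ε l ξ η * (((quadR (sip ξ η) u)⁻¹ ^ b : ℝ) : ℂ) *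
        ((rem m (k + 1) (sip ξ η) u : ℝ) : ℂ))
        (C * (|1 - ε * u| + l)⁻¹ ^ (2 * b + 1) * (l / (k + 1)) ^ (n - m)) := by
  induction m with
  | zero =>
    intro b φ hφ
    refine ⟨0, le_rfl, fun ε l u k hε hl0 hl1 hu hcond hk => ?_⟩
    refine (opBound_zero.congr fun ξ η => ?_).mono (by simp)
    simp [rem]
  | succ m ih =>
    intro b φ hφ
    obtain ⟨φ', hφ', hφφ⟩ := hφ.exists_eq_one
    obtain ⟨C₀, hC₀, H₀⟩ := exists_opBound_cut_mul_quadR (n := n) hφ (b + 1)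
    obtain ⟨i, hi⟩ : ∃ i, n - (m + 1) = i := ⟨_, rfl⟩
    have hi1 : n - i = m + 1 := by omega
    have hi2 : n - m = i + 1 := by omega
    have hi3 : n - (i + 1) = m := by omega
    obtain ⟨C₁, hC₁, H₁⟩ := gegBound hn (i := i) (by omega) φ' hφ'
    obtain ⟨C₂, hC₂, H₂⟩ := gegDiffBound hn (by omega) (gegBound hn (i := i) (by omega)) φ' hφ'
    obtain ⟨C₃, hC₃, H₃⟩ := gegBound hn (i := i + 1) (by omega) φ' hφ'
    obtain ⟨C₄, hC₄, H₄⟩ := ih (by omega) (b + 1) φ hφ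
    refine ⟨C₀ * (C₂ + C₁ + C₃) + C₄, by positivity, fun ε l u k hε hl0 hl1 hu hcond hk => ?_⟩
    have hn0 : (2 : ℝ) ≤ n := by exact_mod_cast hn
    have hin : (i : ℝ) + 1 ≤ n := by exact_mod_cast (by omega : i + 1 ≤ n)
    have hk1 : (8 * n + 2 * i : ℝ) ≤ (k + 1) * l := by linarith
    have hk2 : (8 * n + 2 * (i + 1 : ℕ) : ℝ) ≤ ((k + 1 : ℕ) + 1) * l := by push_cast; nlinarith
    set E := |1 - ε * u| + l with hE
    have habs := abs_nonneg (1 - ε * u)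
    have hE0 : 0 < E := by positivity
    have hlE : l ≤ E := by linarith
    set r := l / ((k : ℝ) + 1) with hr
    have hr0 : 0 ≤ r := by positivity
    have hε1 : ∀ j : ℕ, ‖((ε ^ j : ℝ) : ℂ)‖ = 1 := by
      intro j
      rw [Complex.norm_real, norm_pow]
      have : ‖ε‖ = 1 := by
        rw [Real.norm_eq_abs, ← sq_eq_sq₀ (abs_nonneg _) zero_le_one, sq_abs, hε, one_pow]
      rw [this, one_pow]
    -- the source term of the recursion
    have hX : OpBound (surf n) (fun ξ η => cut φ' ε l ξ η *
        ((geg (m + 1) (k + 1) (sip ξ η) 1 - u * geg (m + 1) k (sip ξ η) 1 -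
          geg m (k + 1) (sip ξ η) 1 : ℝ) : ℂ)) ((C₂ + C₁ + C₃) * (E * r ^ i)) := by
      have h1 := H₁ ε l k hε hl0 hl1 hk1
      have h2 := H₂ ε l k hε hl0 hl1 hk1
      have h3 := H₃ ε l (k + 1) hε hl0 hl1 hk2
      rw [hi1] at h1 h2
      rw [hi3] at h3
      have h4 := ((h2.add (h1.const_mul ((1 - ε * u : ℝ) : ℂ))).const_mul
        ((ε ^ (k + 1) : ℝ) : ℂ)).sub (h3.const_mul ((ε ^ (k + 1) : ℝ) : ℂ))
      refine (h4.congr fun ξ η => ?_).mono ?_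
      · simp only [cut, altGeg]
        norm_cast
        have hε2 : (ε ^ k) ^ 2 = 1 := by rw [← pow_mul, mul_comm, pow_mul, hε, one_pow]
        simp only [pow_succ ε k]
        have hε3 : (ε ^ k * ε) ^ 2 = 1 := by rw [mul_pow, hε2, hε, one_mul]
        linear_combination (φ' (sqDist ε ξ η / l ^ 2) * (geg (m + 1) (k + 1) (sip ξ η) 1 -
          u * geg (m + 1) k (sip ξ η) 1 - geg m (k + 1) (sip ξ η) 1)) * hε3
      · rw [hε1, Complex.norm_real, Real.norm_eq_abs, one_mul, one_mul]
        have e1 : (l / (((k + 1 : ℕ) : ℝ) + 1)) ^ (i + 1) ≤ r ^ i * E := by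
          have h5 : l / (((k + 1 : ℕ) : ℝ) + 1) ≤ r := by
            rw [hr]; push_cast; gcongr; linarith
          have h6 : r ≤ E := (div_le_self hl0.le (by
            have : (0 : ℝ) ≤ k := Nat.cast_nonneg k
            linarith)).trans hlE
          calc _ ≤ r ^ (i + 1) := by gcongr
            _ = r ^ i * r := pow_succ _ _
            _ ≤ _ := by gcongr
        have e2 : |1 - ε * u| ≤ E := by linarith
        have e3 : |1 - ε * u| * (C₁ * r ^ i) ≤ E * (C₁ * r ^ i) := by gcongr
        have e4 : C₂ * l * r ^ i ≤ C₂ * E * r ^ i := by gcongr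
        have e5 : C₃ * (l / (((k + 1 : ℕ) : ℝ) + 1)) ^ (i + 1) ≤ C₃ * (r ^ i * E) := by gcongr
        linarith
    have hD := (H₀ ε l u hε hl0 hl1 hu hcond _ _ hX).add (H₄ ε l u k hε hl0 hl1 hu hcond hk)
    rw [hi]
    refine (hD.congr fun ξ η => ?_).mono ?_
    · have h1 : rem (m + 1) (k + 1) (sip ξ η) u = (quadR (sip ξ η) u)⁻¹ *
          (geg (m + 1) (k + 1) (sip ξ η) 1 - u * geg (m + 1) k (sip ξ η) 1
            - geg m (k + 1) (sip ξ η) 1 + rem m (k + 1) (sip ξ η) u) := by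
        rw [rem, gegS_add_two]
      rw [h1]
      simp only [cut]
      norm_cast
      have h2 := hφφ (sqDist ε ξ η / l ^ 2)
      rw [pow_succ (quadR (sip ξ η) u)⁻¹]
      linear_combination ((quadR (sip ξ η) u)⁻¹ ^ b * (quadR (sip ξ η) u)⁻¹ *
        (geg (m + 1) (k + 1) (sip ξ η) 1 - u * geg (m + 1) k (sip ξ η) 1
            - geg m (k + 1) (sip ξ η) 1)) * h2
    · rw [hi2]
      have hEi : 0 < E⁻¹ := by positivity
      have e1 : C₀ * E⁻¹ ^ (2 * (b + 1)) * ((C₂ + C₁ + C₃) * (E * r ^ i)) =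
          C₀ * (C₂ + C₁ + C₃) * E⁻¹ ^ (2 * b + 1) * r ^ i := by
        have : E⁻¹ ^ (2 * (b + 1)) * E = E⁻¹ ^ (2 * b + 1) := by
          rw [show 2 * (b + 1) = 2 * b + 1 + 1 by ring, pow_succ, mul_assoc,
            inv_mul_cancel₀ hE0.ne', mul_one]
        rw [← this]; ring
      have e2 : r ≤ E ^ 2 := by
        have h1 : r ≤ l ^ 2 := by
          rw [hr, div_le_iff₀ (by positivity)]
          nlinarith
        nlinarith
      have e3 : C₄ * E⁻¹ ^ (2 * (b + 1) + 1) * r ^ (i + 1) ≤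
          C₄ * E⁻¹ ^ (2 * b + 1) * r ^ i := by
        calc _ = C₄ * E⁻¹ ^ (2 * b + 1) * r ^ i * (E⁻¹ ^ 2 * r) := by ring
          _ ≤ C₄ * E⁻¹ ^ (2 * b + 1) * r ^ i * (E⁻¹ ^ 2 * E ^ 2) := by gcongr
          _ = _ := by field_simp
      rw [e1]
      linarith

end Descent

/-! ### Spherical cutoffs as multipliers -/

section SphereBump

variable {n : ℕ}

/-- The chain rule for an affine inner function. -/
lemma norm_iteratedFDeriv_comp_affine_le {V W : Type*} [NormedAddCommGroup V] [NormedSpace ℝ V]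
    [NormedAddCommGroup W] [NormedSpace ℝ W] {h : W → ℝ} {U : Set W} (hU : IsOpen U)
    (hh : ContDiffOn ℝ ∞ h U) (a : W) (T : V →L[ℝ] W) (k : ℕ) {v : V} (hv : a + T v ∈ U) :
    ‖iteratedFDeriv ℝ k (fun v => h (a + T v)) v‖ ≤
      ‖iteratedFDeriv ℝ k h (a + T v)‖ * ‖T‖ ^ k := by
  set U' : Set W := (fun w => a + w) ⁻¹' U with hU'
  have hU'o : IsOpen U' := hU.preimage (by fun_prop)
  have hh' : ContDiffOn ℝ ∞ (fun w => h (a + w)) U' :=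
    hh.comp (contDiff_const.add contDiff_id).contDiffOn fun w hw => hw
  have hTo : IsOpen (T ⁻¹' U') := hU'o.preimage T.continuous
  have hv' : v ∈ T ⁻¹' U' := hv
  have e := T.iteratedFDerivWithin_comp_right hh' hU'o.uniqueDiffOn hTo.uniqueDiffOn
    (x := v) hv' (i := k) (by exact_mod_cast le_top)
  rw [iteratedFDerivWithin_of_isOpen k hTo hv', iteratedFDerivWithin_of_isOpen k hU'o hv',
    iteratedFDeriv_comp_add_left] at e
  change ‖iteratedFDeriv ℝ k ((fun w => h (a + w)) ∘ T) v‖ ≤ _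
  rw [e]
  refine (ContinuousMultilinearMap.norm_compContinuousLinearMap_le _ _).trans_eq ?_
  rw [Finset.prod_const, Finset.card_univ, Fintype.card_fin]

lemma isOpen_pairs : IsOpen {x : Cn n × Cn n | x.1 ≠ 0 ∧ x.2 ≠ 0} :=
  (isOpen_ne.preimage continuous_fst).inter (isOpen_ne.preimage continuous_snd)

lemma homExt_smul_right (χ : Cn n × Cn n → ℝ) {r : ℝ} (hr : 0 < r) (x y : Cn n) :
    homExt χ (x, r • y) = homExt χ (x, y) := by
  simp only [homExt, norm_smul, Real.norm_eq_abs, abs_of_pos hr, smul_smul]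
  rw [mul_inv, mul_right_comm, inv_mul_cancel₀ hr.ne', one_mul]

lemma homExt_coe (χ : Cn n × Cn n → ℝ) (ξ η : Sph n) :
    homExt χ ((ξ : Cn n), (η : Cn n)) = χ ((ξ : Cn n), (η : Cn n)) := by
  simp [homExt]

lemma IsSphereBump.contDiffAt {B : ℕ → ℝ} {l : ℝ} {χ : Cn n × Cn n → ℝ} (h : IsSphereBump B l χ)
    {x y : Cn n} (hx : x ≠ 0) (hy : y ≠ 0) : ContDiffAt ℝ ∞ (homExt χ) (x, y) :=
  h.smooth.contDiffAt (isOpen_pairs.mem_nhds ⟨hx, hy⟩)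

lemma IsSphereBump.measurable {B : ℕ → ℝ} {l : ℝ} {χ : Cn n × Cn n → ℝ}
    (h : IsSphereBump B l χ) :
    Measurable fun p : Sph n × Sph n => χ ((p.1 : Cn n), (p.2 : Cn n)) := by
  refine Continuous.measurable (continuous_iff_continuousAt.2 fun p => ?_)
  have h1 : (p.1 : Cn n) ≠ 0 := ne_zero_of_mem_unit_sphere p.1
  have h2 : (p.2 : Cn n) ≠ 0 := ne_zero_of_mem_unit_sphere p.2
  have e : (fun p : Sph n × Sph n => χ ((p.1 : Cn n), (p.2 : Cn n))) =
      fun p => homExt χ ((p.1 : Cn n), (p.2 : Cn n)) := by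
    funext p; rw [homExt_coe]
  rw [e]
  exact ContinuousAt.comp (f := fun p : Sph n × Sph n => ((p.1 : Cn n), (p.2 : Cn n)))
    (h.contDiffAt h1 h2).continuousAt (by fun_prop)

/-- By homogeneity, the rescaled function `v ↦ χ(ξ, ε ξ + l v)` has bounded derivatives as long as
`ε ξ + l v` stays away from the origin. -/
lemma IsSphereBump.norm_iteratedFDeriv_le {B : ℕ → ℝ} {l : ℝ} {χ : Cn n × Cn n → ℝ}
    (h : IsSphereBump B l χ) (hl : 0 < l) (ε : ℝ) (ξ : Sph n) {v : Cn n}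
    (hv : 1 / 2 ≤ ‖ε • (ξ : Cn n) + l • v‖) (k : ℕ) :
    ‖iteratedFDeriv ℝ k (fun v => homExt χ ((ξ : Cn n), ε • (ξ : Cn n) + l • v)) v‖ ≤
      2 ^ k * |B k| := by
  set y := ε • (ξ : Cn n) + l • v with hy
  set r := ‖y‖⁻¹ with hr
  have hy0 : 0 < ‖y‖ := by linarith
  have hr0 : 0 < r := inv_pos.2 hy0
  have hr2 : r ≤ 2 := by
    rw [hr, inv_le_comm₀ hy0 two_pos]; linarith
  let T : Cn n →L[ℝ] Cn n × Cn n :=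
    ContinuousLinearMap.prod 0 ((r * l) • ContinuousLinearMap.id ℝ (Cn n))
  have hT : ‖T‖ ≤ r * l := by
    refine ContinuousLinearMap.opNorm_le_bound _ (by positivity) fun w => ?_
    simp only [T, ContinuousLinearMap.prod_apply, Prod.norm_def]
    refine max_le ?_ ?_
    · simp; positivity
    · simp [norm_smul, abs_of_pos hr0, abs_of_pos hl]
  have e : (fun v => homExt χ ((ξ : Cn n), ε • (ξ : Cn n) + l • v)) =
      fun v => homExt χ (((ξ : Cn n), (r * ε) • (ξ : Cn n)) + T v) := by
    funext w
    rw [← homExt_smul_right χ hr0]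
    congr 1
    simp [T, smul_smul]
  have hry : r • y ∈ Metric.sphere (0 : Cn n) 1 := by
    rw [mem_sphere_zero_iff_norm, norm_smul, Real.norm_eq_abs, abs_of_pos hr0]
    exact inv_mul_cancel₀ hy0.ne'
  have e2 : ((ξ : Cn n), (r * ε) • (ξ : Cn n)) + T v = ((ξ : Cn n), r • y) := by
    simp [T, hy, smul_smul]
  have hmem : ((ξ : Cn n), (r * ε) • (ξ : Cn n)) + T v ∈ {x : Cn n × Cn n | x.1 ≠ 0 ∧ x.2 ≠ 0} := by
    rw [e2]
    exact ⟨ne_zero_of_mem_unit_sphere ξ, ne_zero_of_mem_unit_sphere ⟨_, hry⟩⟩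
  rw [e]
  refine (norm_iteratedFDeriv_comp_affine_le isOpen_pairs h.smooth _ T k hmem).trans ?_
  rw [e2]
  have h1 := h.deriv_le k ξ ⟨r • y, hry⟩
  have h2 : ‖T‖ ^ k ≤ (2 * l) ^ k := by gcongr; exact hT.trans (by gcongr)
  calc _ ≤ (|B k| * l ^ (-(k : ℤ))) * (2 * l) ^ k := by
        refine mul_le_mul (h1.trans ?_) h2 (by positivity) (by positivity)
        gcongr
        exact le_abs_self _
    _ = 2 ^ k * |B k| := by
        rw [zpow_neg, zpow_natCast, mul_pow]
        field_simp

/-- Localized cutoffs on the sphere are Schur multipliers. -/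
lemma exists_opBound_sphereBump {φ : ℝ → ℝ} (hφ : IsBump φ) (B : ℕ → ℝ) :
    ∃ C : ℝ, 0 ≤ C ∧ ∀ (ε l : ℝ) (χ : Cn n × Cn n → ℝ), ε ^ 2 = 1 → 0 < l → l < 1 →
      IsSphereBump B l χ → ∀ (K : Sph n → Sph n → ℂ) (M : ℝ), OpBound (surf n) K M →
      OpBound (surf n) (fun ξ η => (χ ((ξ : Cn n), (η : Cn n)) : ℂ) * cut φ ε l ξ η * K ξ η)
        (C * M) := by
  obtain ⟨a₀, b₀, ha₀, hab⟩ := hφ.supp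
  obtain ⟨κ, hκ, hκs, hκ1⟩ := exists_isBump_eq_one (a := 1 / 2) (b := 1) (by norm_num)
  set R : ℝ := √ (|b₀|) with hR
  set Ψ : (Cn n × ℝ) × Cn n → ℂ := fun x =>
    ((κ (‖x.1.1 + x.1.2 • x.2‖ ^ 2) * φ (‖x.2‖ ^ 2) : ℝ) : ℂ) with hΨdef
  have hΨ : ContDiff ℝ ∞ Ψ := by
    refine Complex.ofRealCLM.contDiff.comp ((hκ.smooth.comp ?_).mul (hφ.smooth.comp ?_))
    · exact ((contDiff_fst.comp contDiff_fst).add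
        ((contDiff_snd.comp contDiff_fst).smul contDiff_snd)).norm_sq ℝ
    · exact contDiff_snd.norm_sq ℝ
  have h0 : ∀ (p : Cn n × ℝ) (v : Cn n), R < ‖v‖ → Ψ (p, v) = 0 := by
    intro p v hv
    have : φ (‖v‖ ^ 2) = 0 := by
      by_contra h
      have h1 := (hab _ h).2
      have h2 := (Real.sqrt_lt' (by
        have := Real.sqrt_nonneg |b₀|
        linarith)).1 hv
      linarith [le_abs_self b₀]
    simp [hΨdef, this]
  obtain ⟨A, hA0, hA⟩ := exists_iteratedFDeriv_le_of_compact hΨ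
    ((isCompact_closedBall (0 : Cn n) 1).prod (isCompact_Icc (a := (0 : ℝ)) (b := 1))) h0
    (2 * n + 1)
  obtain ⟨C, hC0, hC⟩ := exists_opBound_mul_symbol n R
  set S : ℝ := ∑ k ∈ Finset.range (2 * n + 2), ∑ i ∈ Finset.range (k + 1),
    (k.choose i : ℝ) * (2 ^ i * |B i|) * A with hS
  have hS0 : 0 ≤ S := by positivity
  refine ⟨C * S, by positivity, fun ε l χ hε hl hl1 hχ K M hK => ?_⟩
  have hεn : |ε| = 1 := by rw [← sq_eq_sq₀ (abs_nonneg _) zero_le_one, sq_abs, hε, one_pow]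
  have hξn : ∀ ξ : Sph n, ‖ε • (ξ : Cn n)‖ = 1 := fun ξ => by simp [norm_smul, hεn]
  set y : Sph n → Cn n → Cn n := fun ξ v => ε • (ξ : Cn n) + l • v with hy
  have hyc : Continuous fun p : Sph n × Cn n => y p.1 p.2 := by simp only [hy]; fun_prop
  set F : Sph n → Cn n → ℝ := fun ξ v => homExt χ ((ξ : Cn n), y ξ v) with hF
  set G : Sph n → Cn n → ℂ := fun ξ v => F ξ v • Ψ ((ε • (ξ : Cn n), l), v) with hG
  have hFs : ∀ ξ v, y ξ v ≠ 0 → ContDiffAt ℝ ∞ (F ξ) v := by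
    intro ξ v hv
    refine ContDiffAt.comp (g := homExt χ) (f := fun v => ((ξ : Cn n), y ξ v)) v
      (hχ.contDiffAt (ne_zero_of_mem_unit_sphere ξ) hv) ?_
    simp only [hy]
    fun_prop
  have hΨs : ∀ ξ : Sph n, ContDiff ℝ ∞ fun v => Ψ ((ε • (ξ : Cn n), l), v) := fun ξ =>
    hΨ.comp (contDiff_const.prodMk contDiff_id)
  -- the cutoff `κ` removes the singularity at `y = 0`
  have hGz : ∀ ξ v, ‖y ξ v‖ < 1 / 2 → G ξ v = 0 := by
    intro ξ v hv
    have : κ (‖y ξ v‖ ^ 2) = 0 := by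
      by_contra h
      have := (hκs _ h).1
      nlinarith [norm_nonneg (y ξ v)]
    have : Ψ ((ε • (ξ : Cn n), l), v) = 0 := by
      simp only [hΨdef]
      simp only [hy] at this
      rw [this]; simp
    simp only [hG]
    rw [this, smul_zero]
  have hsym : IsSymbol R S G := by
    refine ⟨?_, fun ξ => contDiff_iff_contDiffAt.2 fun v => ?_, fun ξ v hv => ?_,
      fun ξ k hk v => ?_⟩
    · refine Continuous.measurable (continuous_iff_continuousAt.2 fun p => ?_)
      by_cases hp : y p.1 p.2 = 0
      · refine (continuousAt_const (y := (0 : ℂ))).congr ?_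
        have : {q : Sph n × Cn n | ‖y q.1 q.2‖ < 1 / 2} ∈ nhds p :=
          (isOpen_lt hyc.norm continuous_const).mem_nhds (by
            simp only [Set.mem_ofPred_eq, hp]; norm_num)
        filter_upwards [this] with q hq
        exact (hGz q.1 q.2 hq).symm
      · have h1 : ContinuousAt (fun q : Sph n × Cn n => F q.1 q.2) p :=
          ContinuousAt.comp (f := fun q : Sph n × Cn n => ((q.1 : Cn n), y q.1 q.2))
            (hχ.contDiffAt (ne_zero_of_mem_unit_sphere p.1) hp).continuousAt
            ((by fun_prop : Continuous fun q : Sph n × Cn n =>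
              ((q.1 : Cn n), y q.1 q.2)).continuousAt)
        exact h1.smul (hΨ.continuous.comp (by fun_prop :
          Continuous fun q : Sph n × Cn n => ((ε • (q.1 : Cn n), l), q.2))).continuousAt
    · by_cases hv : y ξ v = 0
      · refine (contDiffAt_const (c := (0 : ℂ))).congr_of_eventuallyEq ?_
        have : {w : Cn n | ‖y ξ w‖ < 1 / 2} ∈ nhds v :=
          (isOpen_lt (by fun_prop) continuous_const).mem_nhds (by
            simp only [Set.mem_ofPred_eq, hv]; norm_num)
        filter_upwards [this] with w hw
        exact hGz ξ w hw
      · exact (hFs ξ v hv).smul (hΨs ξ).contDiffAt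
    · simp only [hG]
      rw [h0 _ v hv, smul_zero]
    · rcases lt_or_ge ‖y ξ v‖ (1 / 2) with hv | hv
      · have : {w : Cn n | ‖y ξ w‖ < 1 / 2} ∈ nhds v :=
          (isOpen_lt (by fun_prop) continuous_const).mem_nhds hv
        have h1 : G ξ =ᶠ[nhds v] fun _ => 0 := by
          filter_upwards [this] with w hw
          exact hGz ξ w hw
        rw [← nhdsWithin_univ] at h1
        have : iteratedFDeriv ℝ k (G ξ) v = 0 := by
          rw [← iteratedFDerivWithin_univ, h1.iteratedFDerivWithin_eq (hGz ξ v hv) k,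
            iteratedFDerivWithin_univ]
          exact congrFun (iteratedFDeriv_fun_zero (𝕜 := ℝ) (E := Cn n) (F := ℂ) (n := k)) v
        rw [this, norm_zero]
        exact hS0
      · set U : Set (Cn n) := {w | y ξ w ≠ 0} with hU
        have hUo : IsOpen U := isOpen_ne.preimage (by fun_prop : Continuous (y ξ))
        have hvU : v ∈ U := by
          intro h
          rw [h, norm_zero] at hv
          norm_num at hv
        have h1 := norm_iteratedFDerivWithin_smul_le (𝕜 := ℝ) (s := U) (N := ∞) (f := F ξ)
          (g := fun v => Ψ ((ε • (ξ : Cn n), l), v)) (n := k)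
          (fun w hw => (hFs ξ w hw).contDiffWithinAt) (hΨs ξ).contDiffOn hUo.uniqueDiffOn hvU
          (by exact_mod_cast le_top)
        simp only [iteratedFDerivWithin_of_isOpen _ hUo hvU] at h1
        refine h1.trans ?_
        refine le_trans (Finset.sum_le_sum fun i hi => ?_) (Finset.single_le_sum
          (f := fun k => ∑ i ∈ Finset.range (k + 1), (k.choose i : ℝ) * (2 ^ i * |B i|) * A)
          (fun i _ => by positivity) (Finset.mem_range.2 (by omega : k < 2 * n + 2)))
        have h2 := hχ.norm_iteratedFDeriv_le hl ε ξ hv i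
        have h3 := hA (ε • (ξ : Cn n), l) ⟨by simp [hξn ξ], hl.le, hl1.le⟩ (k - i) (by omega) v
        gcongr
  refine (hC S G hS0 hsym ε l K M hK).congr fun ξ η => ?_
  have e : ‖l⁻¹ • ((η : Cn n) - ε • (ξ : Cn n))‖ ^ 2 = sqDist ε ξ η / l ^ 2 := by
    rw [norm_smul, mul_pow, norm_sub_sq hε, Real.norm_eq_abs, sq_abs]
    field_simp
  have e1 : ε • (ξ : Cn n) + l • l⁻¹ • ((η : Cn n) - ε • (ξ : Cn n)) = η := by
    rw [smul_smul, mul_inv_cancel₀ hl.ne', one_smul, add_sub_cancel]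
  have hη : ‖(η : Cn n)‖ = 1 := by simp
  simp only [hG, hF, hy, hΨdef, e1, e, hη, homExt_coe, cut]
  rw [one_pow, hκ1 1 (by norm_num) le_rfl, one_mul, Complex.real_smul]

end SphereBump

/-! ### The `L²` bound on annuli -/

section Annulus

variable {n : ℕ}

lemma absSin_sq (ξ η : Sph n) : absSin (ξ : Cn n) (η : Cn n) ^ 2 = 1 - sip ξ η ^ 2 := by
  have h : InnerProductGeometry.angle (ξ : Cn n) (η : Cn n) = Real.arccos (sip ξ η) := by
    simp [InnerProductGeometry.angle, sip]
  rw [absSin, h, Real.sin_arccos, sq_abs, Real.sq_sqrt]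
  nlinarith [abs_le.1 (abs_sip_le ξ η)]

lemma absSin_nonneg (x y : Cn n) : 0 ≤ absSin x y := abs_nonneg _

/-- The coefficient of `K_N^{s,t}`, without the cutoff and the constant, as a function of
`u = s / t`. -/
def radKernel (N : ℕ) (u : ℝ) (j : Fin n) (ξ η : Sph n) : ℂ :=
  (starRingEnd ℂ) ((η : Cn n) j) * (rem n N (sip ξ η) u : ℝ) -
    (starRingEnd ℂ) ((ξ : Cn n) j) * (rem n (N - 1) (sip ξ η) u : ℝ)

lemma norm_coord_le (ξ : Sph n) (j : Fin n) : ‖(starRingEnd ℂ) ((ξ : Cn n) j)‖ ≤ 1 := by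
  have h1 : ‖(ξ : Cn n)‖ = 1 := by simp
  rw [RCLike.norm_conj]
  exact (PiLp.norm_apply_le (ξ : Cn n) j).trans h1.le

lemma measurable_coord (j : Fin n) :
    Measurable fun ξ : Sph n => (starRingEnd ℂ) ((ξ : Cn n) j) :=
  Continuous.measurable (by fun_prop)

/-- The case `m = n`, `b = 0` of `exists_opBound_cut_mul_rem`, for both terms of the kernel. -/
lemma exists_opBound_cut_mul_radKernel (hn : 2 ≤ n) {φ : ℝ → ℝ} (hφ : IsBump φ) :
    ∃ C : ℝ, 0 ≤ C ∧ ∀ (ε l u : ℝ) (k : ℕ) (j : Fin n), ε ^ 2 = 1 → 0 < l → l < 1 → 0 < u →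
      (ε = 1 ∨ ∀ s, φ s ≠ 0 → s * l ^ 2 ≤ 3) → (10 * n : ℝ) ≤ (k + 1) * l →
      OpBound (surf n) (fun ξ η => cut φ ε l ξ η * radKernel (k + 2) u j ξ η)
        (C * (|1 - u| + l)⁻¹) := by
  obtain ⟨C, hC0, hC⟩ := exists_opBound_cut_mul_rem hn le_rfl 0 φ hφ
  refine ⟨2 * C, by positivity, fun ε l u k j hε hl hl1 hu hs hk => ?_⟩
  have h1 := hC ε l u k hε hl hl1 hu hs hk
  have h2 := hC ε l u (k + 1) hε hl hl1 hu hs (by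
    push_cast; nlinarith)
  have h3 := (h2.mul_both measurable_const (measurable_coord j) zero_le_one zero_le_one
    (fun _ => norm_one.le) (norm_coord_le · j)).sub
    (h1.mul_both (measurable_coord j) measurable_const zero_le_one zero_le_one
      (norm_coord_le · j) (fun _ => norm_one.le))
  refine (h3.congr fun ξ η => ?_).mono ?_
  · simp only [radKernel, pow_zero, Complex.ofReal_one]
    simp only [show k + 2 - 1 = k + 1 by omega]
    ring
  · simp only [Nat.sub_self, pow_zero, mul_one, mul_zero, zero_add, pow_one, one_mul]
    have h4 : |1 - u| ≤ |1 - ε * u| := by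
      rcases eq_or_eq_neg_of_sq_eq_one hε with rfl | rfl
      · rw [one_mul]
      · rw [show (1 : ℝ) - -1 * u = 1 + u by ring, abs_of_pos (by linarith : 0 < 1 + u)]
        exact abs_le.2 ⟨by linarith, by linarith⟩
    have h5 : (|1 - ε * u| + l)⁻¹ ≤ (|1 - u| + l)⁻¹ := by
      have := abs_nonneg (1 - u)
      gcongr
    nlinarith [mul_le_mul_of_nonneg_left h5 hC0]

/-- Off the diagonal and the antidiagonal the kernel is bounded on `L²` without any loss in `N`. -/
lemma exists_opBound_annular (hn : 2 ≤ n) (B : ℕ → ℝ) :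
    ∃ C : ℝ, 0 < C ∧ ∀ (l u : ℝ) (k : ℕ) (χ : Cn n × Cn n → ℝ) (j : Fin n), 0 < l → l < 1 →
      0 < u → IsAnnularCutoff B l χ → (10 * n : ℝ) ≤ (k + 1) * l →
      OpBound (surf n)
        (fun ξ η => (χ ((ξ : Cn n), (η : Cn n)) : ℂ) * radKernel (k + 2) u j ξ η)
        (C * (|1 - u| + l)⁻¹) := by
  obtain ⟨φ₁, hφ₁, hs₁, hφ₁1⟩ := exists_isBump_eq_one (a := 1 / 10 ^ 4) (b := 20000) (by norm_num)
  obtain ⟨φ₂, hφ₂, hs₂, hφ₂1⟩ := exists_isBump_eq_one (a := 1 / 10 ^ 4) (b := 160000) (by norm_num)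
  obtain ⟨C₁, hC₁0, hC₁⟩ := exists_opBound_cut_mul_radKernel hn hφ₁
  obtain ⟨C₂, hC₂0, hC₂⟩ := exists_opBound_cut_mul_radKernel hn hφ₂
  obtain ⟨D₁, hD₁0, hD₁⟩ := exists_opBound_sphereBump (n := n) hφ₁ B
  obtain ⟨D₂, hD₂0, hD₂⟩ := exists_opBound_sphereBump (n := n) hφ₂ B
  refine ⟨2 * D₁ * C₁ + D₂ * C₂ + 1, by positivity, fun l u k χ j hl hl1 hu hχ hk => ?_⟩
  have hinv : 0 ≤ (|1 - u| + l)⁻¹ := by positivity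
  have hcase : ∀ ξ η : Sph n, χ ((ξ : Cn n), (η : Cn n)) = 0 ∨
      (l ^ 2 / 10 ^ 4 ≤ 1 - sip ξ η ^ 2 ∧ 1 - sip ξ η ^ 2 ≤ 10 ^ 4 * l ^ 2) := by
    intro ξ η
    by_cases h : absSin (ξ : Cn n) (η : Cn n) < l / 100 ∨ 100 * l < absSin (ξ : Cn n) (η : Cn n)
    · exact Or.inl (hχ.eq_zero ξ η h)
    · right
      push Not at h
      rw [← absSin_sq]
      constructor <;> nlinarith [absSin_nonneg (ξ : Cn n) (η : Cn n)]
  -- for small `l` the support of `χ` consists of two separate annuli, around `ξ` and around `-ξ`;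
  -- for `l` bounded from below it lies in a single annulus around `ξ`
  rcases lt_or_ge l (1 / 200) with hl2 | hl2
  · have hs : ∀ s, φ₁ s ≠ 0 → s * l ^ 2 ≤ 3 := by
      intro s h
      have := (hs₁ s h).2
      have : l ^ 2 ≤ 1 / 40000 := by nlinarith
      nlinarith [sq_nonneg l]
    have key := fun ε (hε : ε ^ 2 = 1) => hD₁ ε l χ hε hl hl1 hχ.toIsSphereBump _ _
      (hC₁ ε l u k j hε hl hl1 hu (Or.inr hs) hk)
    refine (((key 1 (by norm_num)).add (key (-1) (by norm_num))).congr fun ξ η => ?_).mono ?_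
    · rcases hcase ξ η with h | ⟨h1, h2⟩
      · simp [h]
      · -- the cutoff at the pole nearest to `η` is one, the other one vanishes
        have hφ : ∀ ε : ℝ, ε ^ 2 = 1 → 0 ≤ ε * sip ξ η →
            φ₁ (sqDist ε ξ η / l ^ 2) = 1 ∧ φ₁ (sqDist (-ε) ξ η / l ^ 2) = 0 := by
          intro ε hε hx
          have hx2 : (ε * sip ξ η) ^ 2 = sip ξ η ^ 2 := by rw [mul_pow, hε, one_mul]
          have hx1 : ε * sip ξ η ≤ 1 := by
            have := abs_le.1 (abs_sip_le ξ η)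
            nlinarith
          have hl4 : 40000 * l ^ 2 < 1 := by nlinarith
          constructor
          · apply hφ₁1
            · rw [le_div_iff₀ (by positivity), sqDist]; nlinarith
            · rw [div_le_iff₀ (by positivity), sqDist]; nlinarith
          · by_contra hne
            have := (hs₁ _ hne).2
            rw [div_le_iff₀ (by positivity), sqDist] at this
            nlinarith
        rcases le_total 0 (sip ξ η) with hx | hx
        · obtain ⟨h3, h4⟩ := hφ 1 (by norm_num) (by linarith)
          simp [cut, h3, h4]
        · obtain ⟨h3, h4⟩ := hφ (-1) (by norm_num) (by linarith)
          rw [neg_neg] at h4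
          simp [cut, h3, h4]
    · have : 0 ≤ D₂ * C₂ := by positivity
      nlinarith
  · have key := hD₂ 1 l χ (by norm_num) hl hl1 hχ.toIsSphereBump _ _
      (hC₂ 1 l u k j (by norm_num) hl hl1 hu (Or.inl rfl) hk)
    refine (key.congr fun ξ η => ?_).mono ?_
    · rcases hcase ξ η with h | ⟨h1, h2⟩
      · simp [h]
      · have hx := abs_le.1 (abs_sip_le ξ η)
        have h3 : φ₂ (sqDist 1 ξ η / l ^ 2) = 1 := by
          apply hφ₂1
          · rw [le_div_iff₀ (by positivity), sqDist]; nlinarith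
          · rw [div_le_iff₀ (by positivity), sqDist]; nlinarith
        simp [cut, h3]
    · have : 0 ≤ D₁ * C₁ := by positivity
      nlinarith

end Annulus

/-! ### Size and support of the kernel -/

section Pointwise

variable {n : ℕ}

lemma MapsLp.mono {k : Sph n → Sph n → Fin n → ℂ} {p p' : ℝ≥0∞} {M M' : ℝ} (h : MapsLp k p p' M)
    (hM : M ≤ M') : MapsLp k p p' M' := fun f hf =>
  ⟨(h f hf).1, (h f hf).2.1, (h f hf).2.2.trans (by gcongr)⟩

/-- The vector-valued form of `exists_interpolation`, applied to each component of the kernel. -/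
lemma exists_mapsLp (p p' q : ℝ≥0∞) (hp1 : 1 ≤ p) (hp2 : p ≤ 2)
    (hp' : p⁻¹ + p'⁻¹ = 1) (hq : p⁻¹ = p'⁻¹ + q⁻¹) :
    ∃ c : ℝ, 0 < c ∧ ∀ (k : Sph n → Sph n → Fin n → ℂ) (M₁ M₂ : ℝ), 0 < M₁ → 0 < M₂ →
      (∀ ξ η j, ‖k ξ η j‖ ≤ M₁) → (∀ j, OpBound (surf n) (fun ξ η => k ξ η j) M₂) →
      MapsLp k p p' (c * (M₁ ^ (q⁻¹).toReal * M₂ ^ (1 - (q⁻¹).toReal))) := by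
  obtain ⟨c, hc0, hc⟩ := exists_interpolation (μ := surf n) p p' q hp1 hp2 hp' hq
  have hp'1 : 1 ≤ p' := by
    rw [← ENNReal.inv_le_one, ← hp']
    exact le_add_self
  refine ⟨(n + 1) * c, by positivity, fun k M₁ M₂ hM₁ hM₂ hk hop f hf => ?_⟩
  have hfj : ∀ j, MemLp (fun η => f η j) p (surf n) := fun j =>
    hf.of_le ((EuclideanSpace.proj (𝕜 := ℂ) j).continuous.comp_aestronglyMeasurable hf.1)
      (Filter.Eventually.of_forall fun η => PiLp.norm_apply_le (f η) j)
  have hfi : ∀ j, Integrable (fun η => f η j) (surf n) := fun j => (hfj j).integrable hp1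
  have hi : ∀ j ξ, Integrable (fun η => k ξ η j * f η j) (surf n) := fun j ξ =>
    (hop j).toBddKernel.integrable (hfi j) ξ
  have e : kernelOp k f = ∑ j, kop (surf n) (fun ξ η => k ξ η j) (fun η => f η j) := by
    funext ξ
    rw [kernelOp, integral_finsetSum _ fun j _ => hi j ξ, Finset.sum_apply]
    rfl
  have hm : ∀ j, MemLp (kop (surf n) (fun ξ η => k ξ η j) (fun η => f η j)) p' (surf n) :=
    fun j => (hop j).toBddKernel.memLp_kop (hfi j) p'
  refine ⟨fun ξ => integrable_finsetSum _ fun j _ => hi j ξ, ?_, ?_⟩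
  · rw [e]
    exact memLp_finsetSum' _ fun j _ => hm j
  · set X := M₁ ^ (q⁻¹).toReal * M₂ ^ (1 - (q⁻¹).toReal) with hX
    have hX0 : 0 ≤ X := by positivity
    rw [e]
    calc _ ≤ ∑ j, eLpNorm (kop (surf n) (fun ξ η => k ξ η j) (fun η => f η j)) p' (surf n) :=
          eLpNorm_sum_le (fun j _ => (hm j).1) hp'1
      _ ≤ ∑ _j : Fin n, ENNReal.ofReal (c * X) * eLpNorm f p (surf n) := by
          refine Finset.sum_le_sum fun j _ =>
            (hc _ M₁ M₂ hM₁ hM₂ (fun ξ η => hk ξ η j) (hop j) _ (hfj j)).trans ?_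
          gcongr 1
          exact eLpNorm_mono fun η => PiLp.norm_apply_le (f η) j
      _ = ENNReal.ofReal (n * (c * X)) * eLpNorm f p (surf n) := by
          rw [Finset.sum_const, Finset.card_univ, Fintype.card_fin, nsmul_eq_mul, ← mul_assoc,
            ENNReal.ofReal_mul (Nat.cast_nonneg n), ENNReal.ofReal_natCast]
      _ ≤ _ := by
          gcongr 1
          refine ENNReal.ofReal_le_ofReal ?_
          have : 0 ≤ c * X := by positivity
          nlinarith

lemma measurable_rem (m N : ℕ) (u : ℝ) : Measurable fun x : ℝ => rem m N x u := by
  induction m with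
  | zero => exact measurable_const
  | succ m ih =>
    simp only [rem, quadR]
    have h1 := (continuous_geg (m + 1) N).measurable
    have h2 := (continuous_gegS (m + 1) (N + 1)).measurable
    have h3 := (continuous_geg m N).measurable
    fun_prop

lemma measurable_radKernel (N : ℕ) (u : ℝ) (j : Fin n) :
    Measurable (Function.uncurry (radKernel N u j)) := by
  have h : ∀ N, Measurable fun p : Sph n × Sph n => ((rem n N (sip p.1 p.2) u : ℝ) : ℂ) := fun N =>
    Complex.measurable_ofReal.comp ((measurable_rem n N u).comp continuous_sip.measurable)
  exact (((measurable_coord j).comp measurable_snd).mul (h N)).sub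
    (((measurable_coord j).comp measurable_fst).mul (h (N - 1)))

lemma norm_smul_sub_smul_sq {s t : ℝ} (ht : 0 < t) (ξ η : Sph n) :
    ‖s • (ξ : Cn n) - t • (η : Cn n)‖ ^ 2 = t ^ 2 * quadR (sip ξ η) (s / t) := by
  have h1 : ‖(ξ : Cn n)‖ = 1 := by simp
  have h2 : ‖(η : Cn n)‖ = 1 := by simp
  rw [norm_sub_sq_real, norm_smul, norm_smul, h1, h2, inner_smul_left, inner_smul_right, quadR, sip,
    Real.norm_eq_abs, Real.norm_eq_abs, mul_one, mul_one, sq_abs, sq_abs]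
  simp only [conj_trivial]
  field_simp
  ring

variable {A : ℕ → ℝ} {N : ℕ} {ψ : Cn n × Cn n → ℝ}

lemma norm_smul_coe {t : ℝ} (ht : 0 < t) (η : Sph n) : ‖t • (η : Cn n)‖ = t := by
  simp [norm_smul, abs_of_pos ht]

lemma smul_coe_ne_zero {t : ℝ} (ht : 0 < t) (η : Sph n) : t • (η : Cn n) ≠ 0 :=
  norm_pos_iff.1 (by rwa [norm_smul_coe ht])

lemma IsDiagCutoff.measurable (h : IsDiagCutoff A N ψ) (s : ℝ) {t : ℝ} (ht : 0 < t) :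
    Measurable fun p : Sph n × Sph n => ψ (s • (p.1 : Cn n), t • (p.2 : Cn n)) := by
  have h1 : ContinuousOn ψ {x | x.2 ≠ 0} := h.smooth.continuousOn
  refine (h1.comp_continuous (f := fun p : Sph n × Sph n => (s • (p.1 : Cn n), t • (p.2 : Cn n)))
    (by fun_prop) fun p => ?_).measurable
  exact smul_coe_ne_zero ht p.2

lemma IsDiagCutoff.abs_le (h : IsDiagCutoff A N ψ) (s : ℝ) {t : ℝ} (ht : 0 < t) (ξ η : Sph n) :
    |ψ (s • (ξ : Cn n), t • (η : Cn n))| ≤ |A 0| := by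
  have := h.deriv_le 0 (s • (ξ : Cn n)) _ (smul_coe_ne_zero ht η)
  simp only [norm_iteratedFDeriv_zero, CharP.cast_eq_zero, neg_zero, zpow_zero, mul_one] at this
  exact this.trans (le_abs_self _)

/-- On the support of `ψ`, the distance `|η - uξ|` is at least `1 / (2N)`. -/
lemma IsDiagCutoff.le_quadR (h : IsDiagCutoff A N ψ) (hN : 1 ≤ N) {s t : ℝ} (ht : 0 < t)
    {ξ η : Sph n} (hne : ψ (s • (ξ : Cn n), t • (η : Cn n)) ≠ 0) :
    (1 / (2 * (N : ℝ))) ^ 2 ≤ quadR (sip ξ η) (s / t) := by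
  have h1 : 1 / (2 * (N : ℝ)) * t ≤ ‖s • (ξ : Cn n) - t • (η : Cn n)‖ := by
    by_contra hlt
    refine hne (h.eq_zero _ _ (smul_coe_ne_zero ht η) ?_)
    rw [norm_smul_coe ht]
    exact not_le.1 hlt
  have h2 := norm_smul_sub_smul_sq (s := s) ht ξ η
  have h3 : (1 / (2 * (N : ℝ)) * t) ^ 2 ≤ t ^ 2 * quadR (sip ξ η) (s / t) := by
    rw [← h2]; gcongr
  have h4 : 0 < t ^ 2 := by positivity
  nlinarith

lemma IsDiagCutoff.eq_one_of_lt_quadR (h : IsDiagCutoff A N ψ) {s t : ℝ} (ht : 0 < t)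
    {ξ η : Sph n} (hlt : (1 / (N : ℝ)) ^ 2 < quadR (sip ξ η) (s / t)) :
    ψ (s • (ξ : Cn n), t • (η : Cn n)) = 1 := by
  refine h.eq_one _ _ (smul_coe_ne_zero ht η) ?_
  rw [norm_smul_coe ht]
  refine lt_of_pow_lt_pow_left₀ 2 (norm_nonneg _) ?_
  rw [norm_smul_sub_smul_sq ht, mul_pow, mul_comm]
  gcongr

/-- The constant `c_n`. -/
def formConst (n : ℕ) : ℂ := (((n - 1).factorial : ℂ) / (2 * (Real.pi : ℂ) * Complex.I) ^ n)

lemma sphKernel_eq (hψ : IsDiagCutoff A N ψ) (hN : 1 ≤ N) (χ : Cn n × Cn n → ℝ) {s t : ℝ}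
    (hs : 0 < s) (ht : 0 < t) (ξ η : Sph n) (j : Fin n) :
    sphKernel N ψ χ s t ξ η j = (χ ((ξ : Cn n), (η : Cn n)) : ℂ) *
      ((ψ (s • (ξ : Cn n), t • (η : Cn n)) : ℂ) *
        (formConst n * radKernel N (s / t) j ξ η)) := by
  rw [sphKernel, kernelK, formI]
  by_cases h : ψ (s • (ξ : Cn n), t • (η : Cn n)) = 0
  · simp [h]
  · have h1 := hψ.le_quadR hN ht h
    have h2 : (0 : ℝ) < N := by exact_mod_cast hN
    have h3 : quadR (sip ξ η) (s / t) ≠ 0 := by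
      have : 0 < (1 / (2 * (N : ℝ))) ^ 2 := by positivity
      linarith
    rw [remCoeff_eq hN j hs ht ξ η h3]
    rfl

/-- The assumptions of the pointwise estimates hold with `ε` the sign of `ξ · η`. -/
lemma exists_gegData (ξ η : Sph n) {u : ℝ} (hu : 0 < u) (h : 0 < quadR (sip ξ η) u) :
    ∃ ε : ℝ, GegData (sip ξ η) u ε ‖(η : Cn n) - ε • (ξ : Cn n)‖ √(quadR (sip ξ η) u) := by
  have key : ∀ ε : ℝ, ε ^ 2 = 1 → 0 ≤ ε * sip ξ η →
      GegData (sip ξ η) u ε ‖(η : Cn n) - ε • (ξ : Cn n)‖ √(quadR (sip ξ η) u) := fun ε hε hx =>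
    ⟨abs_sip_le ξ η, hu, hε, hx, norm_nonneg _, by rw [norm_sub_sq hε, sqDist],
      Real.sqrt_pos.2 h, Real.sq_sqrt h.le⟩
  rcases le_total 0 (sip ξ η) with hx | hx
  · exact ⟨1, key 1 (by norm_num) (by linarith)⟩
  · exact ⟨-1, key (-1) (by norm_num) (by linarith)⟩

/-- The pointwise bound away from the diagonal. -/
lemma exists_norm_radKernel_le (hn : 2 ≤ n) : ∃ c : ℝ, 0 < c ∧ ∀ (N : ℕ) (u : ℝ) (j : Fin n)
    (ξ η : Sph n), 1 ≤ N → 0 < u → (1 / (2 * (N : ℝ))) ^ 2 ≤ quadR (sip ξ η) u →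
    ‖radKernel N u j ξ η‖ ≤ c * (N : ℝ) ^ (2 * n - 2) * (|1 - u| + 1 / N)⁻¹ := by
  obtain ⟨m, rfl⟩ : ∃ m, n = m + 1 := ⟨n - 1, by omega⟩
  obtain ⟨c, hc0, hc⟩ := exists_comb_le m
  refine ⟨4 * c, by positivity, fun N u j ξ η hN hu hq => ?_⟩
  obtain ⟨k, rfl⟩ : ∃ k, N = k + 1 := ⟨N - 1, by omega⟩
  have hq0 : 0 < quadR (sip ξ η) u := lt_of_lt_of_le (by positivity) hq
  obtain ⟨ε, hg⟩ := exists_gegData ξ η hu hq0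
  set Q := √(quadR (sip ξ η) u) with hQ
  have hQ1 : 1 / (2 * ((k + 1 : ℕ) : ℝ)) ≤ Q := Real.le_sqrt_of_sq_le hq
  push_cast at hQ1 ⊢
  have hQ2 : 1 ≤ 2 * Q * (k + 1) := by
    rw [div_le_iff₀ (by positivity)] at hQ1; linarith
  have hab : ‖(ε : ℂ) * (starRingEnd ℂ) ((η : Cn (m + 1)) j) -
      (starRingEnd ℂ) ((ξ : Cn (m + 1)) j)‖ ≤ ‖(η : Cn (m + 1)) - ε • (ξ : Cn (m + 1))‖ := by
    have e : (ε : ℂ) * (starRingEnd ℂ) ((η : Cn (m + 1)) j) - (starRingEnd ℂ) ((ξ : Cn (m + 1)) j) =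
        ε * (starRingEnd ℂ) (((η : Cn (m + 1)) - ε • (ξ : Cn (m + 1))) j) := by
      have : (ε : ℂ) ^ 2 = 1 := by exact_mod_cast hg.sign_sq
      simp only [PiLp.sub_apply, PiLp.smul_apply, map_sub, Complex.real_smul, map_mul,
        Complex.conj_ofReal]
      linear_combination ((starRingEnd ℂ) ((ξ : Cn (m + 1)) j)) * this
    have hε : ‖(ε : ℂ)‖ = 1 := by
      rcases hg.sign_eq with h | h <;> simp [h]
    rw [e, norm_mul, hε, one_mul, RCLike.norm_conj]
    exact PiLp.norm_apply_le _ j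
  have h1 := hc k (sip ξ η) u ε _ Q _ _ hg hQ2 (norm_coord_le η j) (norm_coord_le ξ j) hab
  have h2 : Q⁻¹ ≤ 4 * (|1 - u| + 1 / ((k : ℝ) + 1))⁻¹ := by
    have h3 := hg.abs_one_sub
    have h4 : 1 / ((k : ℝ) + 1) ≤ 2 * Q := by
      rw [div_le_iff₀ (by positivity)]; linarith
    have h5 : 0 < |1 - u| + 1 / ((k : ℝ) + 1) := by positivity
    rw [← div_eq_mul_inv, inv_eq_one_div, div_le_div_iff₀ hg.Q_pos h5]
    linarith
  rw [radKernel, Nat.add_sub_cancel]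
  refine h1.trans ?_
  have e : 2 * (m + 1) - 2 = 2 * m := by omega
  rw [e]
  calc _ ≤ c * ((k : ℝ) + 1) ^ (2 * m) * (4 * (|1 - u| + 1 / ((k : ℝ) + 1))⁻¹) := by gcongr
    _ = _ := by ring

lemma one_sub_sq_le_quadR (x u : ℝ) : 1 - x ^ 2 ≤ quadR x u := by
  rw [quadR]; nlinarith [sq_nonneg (u - x)]

/-- The pointwise bound where the angle is of order `l`. -/
lemma exists_norm_radKernel_le_of_le_absSin (hn : 2 ≤ n) : ∃ c : ℝ, 0 < c ∧
    ∀ (k : ℕ) (u l : ℝ) (j : Fin n) (ξ η : Sph n), 0 < u → 0 < l → 100 ≤ (k + 1) * l →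
      l / 100 ≤ absSin (ξ : Cn n) (η : Cn n) →
      ‖radKernel (k + 2) u j ξ η‖ ≤
        c * (((k + 2 : ℕ) : ℝ) ^ (n - 1) * l⁻¹ ^ n * (|1 - u| + l)⁻¹) := by
  obtain ⟨c, hc0, hc⟩ := exists_sqrt_pow_mul_rem_le n
  refine ⟨2 * (c * 100 ^ n * 102) + 1, by positivity, fun k u l j ξ η hu hl hk ha => ?_⟩
  have hS : √(1 - sip ξ η ^ 2) = absSin (ξ : Cn n) (η : Cn n) := by
    rw [← absSin_sq, Real.sqrt_sq (absSin_nonneg _ _)]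
  have hq0 : 0 < quadR (sip ξ η) u := by
    refine lt_of_lt_of_le ?_ (one_sub_sq_le_quadR _ _)
    rw [← absSin_sq]
    have : 0 < absSin (ξ : Cn n) (η : Cn n) := by linarith [div_pos hl (by norm_num : (0:ℝ) < 100)]
    positivity
  obtain ⟨ε, hg⟩ := exists_gegData ξ η hu hq0
  set Q := √(quadR (sip ξ η) u) with hQ
  have hSQ : l / 100 ≤ Q := by
    refine ha.trans ?_
    rw [← hS]
    exact Real.sqrt_le_sqrt (one_sub_sq_le_quadR _ _)
  have hQinv : Q⁻¹ ≤ 102 * (|1 - u| + l)⁻¹ := by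
    have h3 := hg.abs_one_sub
    have h5 : 0 < |1 - u| + l := by positivity
    rw [← div_eq_mul_inv, inv_eq_one_div, div_le_div_iff₀ hg.Q_pos h5]
    linarith
  have hrem : ∀ i : ℕ, k ≤ i → i ≤ k + 1 → |rem n (i + 1) (sip ξ η) u| ≤
      (c * 100 ^ n * 102) * (((k + 2 : ℕ) : ℝ) ^ (n - 1) * l⁻¹ ^ n * (|1 - u| + l)⁻¹) := by
    intro i hi hi2
    have hi' : (k : ℝ) ≤ i := by exact_mod_cast hi
    have h1 := hc i _ u ε _ Q hg (by rw [hS]; nlinarith)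
    rw [hS] at h1
    have h2 : (l / 100) ^ n ≤ absSin (ξ : Cn n) (η : Cn n) ^ n := by gcongr
    have hi0 : (0 : ℝ) < (i : ℝ) + 1 := by positivity
    have e : ((i : ℝ) + 1) ^ n = ((i : ℝ) + 1) ^ (n - 1) * ((i : ℝ) + 1) := by
      rw [← pow_succ]; congr 1; omega
    have h3 : (l / 100) ^ n * |rem n (i + 1) (sip ξ η) u| ≤ c * ((i : ℝ) + 1) ^ (n - 1) * Q⁻¹ := by
      refine le_of_mul_le_mul_right ?_ hi0
      calc _ ≤ absSin (ξ : Cn n) (η : Cn n) ^ n * |rem n (i + 1) (sip ξ η) u| * ((i : ℝ) + 1) := by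
            gcongr
        _ ≤ _ := h1
        _ = _ := by rw [e]; ring
    have h4 : ((i : ℝ) + 1) ^ (n - 1) ≤ ((k + 2 : ℕ) : ℝ) ^ (n - 1) := by
      gcongr
      push_cast
      have : (i : ℝ) ≤ k + 1 := by exact_mod_cast hi2
      linarith
    have h5 : |rem n (i + 1) (sip ξ η) u| =
        (100 * l⁻¹) ^ n * ((l / 100) ^ n * |rem n (i + 1) (sip ξ η) u|) := by
      rw [← mul_assoc, ← mul_pow]
      have : 100 * l⁻¹ * (l / 100) = 1 := by field_simp
      rw [this, one_pow, one_mul]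
    rw [h5]
    calc _ ≤ (100 * l⁻¹) ^ n * (c * ((i : ℝ) + 1) ^ (n - 1) * Q⁻¹) := by gcongr
      _ ≤ (100 * l⁻¹) ^ n * (c * ((k + 2 : ℕ) : ℝ) ^ (n - 1) * (102 * (|1 - u| + l)⁻¹)) := by
          gcongr
      _ = _ := by rw [mul_pow]; ring
  have h1 := hrem k le_rfl (by omega)
  have h2 := hrem (k + 1) (by omega) le_rfl
  set Y := ((k + 2 : ℕ) : ℝ) ^ (n - 1) * l⁻¹ ^ n * (|1 - u| + l)⁻¹ with hY
  have hY0 : 0 ≤ Y := by positivity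
  rw [radKernel, show k + 2 - 1 = k + 1 by omega]
  refine (norm_sub_le _ _).trans ?_
  rw [norm_mul, norm_mul, Complex.norm_real, Complex.norm_real, Real.norm_eq_abs, Real.norm_eq_abs]
  have h3 := mul_le_mul (norm_coord_le η j) h2 (abs_nonneg _) zero_le_one
  have h4 := mul_le_mul (norm_coord_le ξ j) h1 (abs_nonneg _) zero_le_one
  linarith

/-- The set of directions at angle at most of order `l` from a line has measure of order
`l^{d-1}`, which gives a Schur bound. -/
lemma exists_opBound_of_absSin_le (hn : 1 ≤ n) : ∃ c : ℝ, 0 < c ∧ ∀ (K : Sph n → Sph n → ℂ)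
    (M l : ℝ), Measurable (Function.uncurry K) → 0 ≤ M → 0 < l → l ≤ 1 →
    (∀ ξ η, ‖K ξ η‖ ≤ M) →
    (∀ ξ η : Sph n, 100 * l < absSin (ξ : Cn n) (η : Cn n) → K ξ η = 0) →
    OpBound (surf n) K (M * (c * l ^ (2 * n - 1))) := by
  set V := 2 * n * (200 + 1) ^ (2 * n) * (volume : Measure (Cn n)).real (Metric.ball 0 1) with hV
  have hV0 : 0 ≤ V := by positivity
  refine ⟨2 * V + 1, by positivity, fun K M l hKm hM hl hl1 hK h0 => ?_⟩
  have hsup : ∀ ξ : Sph n, ∀ F : Sph n → ℂ, Measurable F → (∀ η, ‖F η‖ ≤ M) →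
      (∀ η : Sph n, 1 - sip ξ η ^ 2 > (100 * l) ^ 2 → F η = 0) →
      ∫ η, ‖F η‖ ∂(surf n) ≤ M * ((2 * V + 1) * l ^ (2 * n - 1)) := by
    intro ξ F hF hFM hF0
    set S : ℝ → Set (Sph n) := fun ε => {η : Sph n | ‖(η : Cn n) - ε • (ξ : Cn n)‖ ≤ 200 * l}
    have hSm : ∀ ε, MeasurableSet (S ε) := fun ε =>
      (isClosed_le (by fun_prop) continuous_const).measurableSet
    have hle : ∀ η, ‖F η‖ ≤ (S 1).indicator (fun _ => M) η + (S (-1)).indicator (fun _ => M) η := by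
      intro η
      have i1 : ∀ ε, 0 ≤ (S ε).indicator (fun _ => M) η := fun ε =>
        Set.indicator_nonneg (fun _ _ => hM) _
      by_cases h : 1 - sip ξ η ^ 2 > (100 * l) ^ 2
      · rw [hF0 η h, norm_zero]
        exact add_nonneg (i1 1) (i1 (-1))
      · have hx := abs_le.1 (abs_sip_le ξ η)
        have key : ∀ ε : ℝ, ε ^ 2 = 1 → 0 ≤ ε * sip ξ η → η ∈ S ε := by
          intro ε hε hx
          have hx2 : (ε * sip ξ η) ^ 2 = sip ξ η ^ 2 := by rw [mul_pow, hε, one_mul]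
          refine (sq_le_sq₀ (norm_nonneg _) (by positivity)).1 ?_
          rw [norm_sub_sq hε, sqDist]
          nlinarith
        rcases le_total 0 (sip ξ η) with hx | hx
        · rw [Set.indicator_of_mem (key 1 (by norm_num) (by linarith))]
          linarith [hFM η, i1 (-1)]
        · rw [Set.indicator_of_mem (key (-1) (by norm_num) (by linarith))]
          linarith [hFM η, i1 1]
    have hind : ∀ ε, Integrable ((S ε).indicator (fun _ => M)) (surf n) := fun ε =>
      (integrable_const M).indicator (hSm ε)
    have hint : ∀ ε, ∫ η, (S ε).indicator (fun _ => M) η ∂(surf n) ≤ M * (V * l ^ (2 * n - 1)) := by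
      intro ε
      rw [integral_indicator_const M (hSm ε), smul_eq_mul, mul_comm]
      exact mul_le_mul_of_nonneg_left
        (surf_cap_le hn (ε • (ξ : Cn n)) (by norm_num) hl hl1) hM
    calc _ ≤ ∫ η, ((S 1).indicator (fun _ => M) η + (S (-1)).indicator (fun _ => M) η) ∂(surf n) :=
          integral_mono_of_nonneg (Filter.Eventually.of_forall fun _ => norm_nonneg _)
            ((hind 1).add (hind (-1))) (Filter.Eventually.of_forall hle)
      _ ≤ M * (V * l ^ (2 * n - 1)) + M * (V * l ^ (2 * n - 1)) := by
          rw [integral_add (hind 1) (hind (-1))]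
          exact add_le_add (hint 1) (hint (-1))
      _ ≤ _ := by
          have : 0 ≤ M * l ^ (2 * n - 1) := by positivity
          nlinarith
  have habs : ∀ ξ η : Sph n, 1 - sip ξ η ^ 2 > (100 * l) ^ 2 → K ξ η = 0 := by
    intro ξ η h
    rw [← absSin_sq] at h
    exact h0 ξ η (lt_of_pow_lt_pow_left₀ 2 (absSin_nonneg _ _) h)
  refine opBound_of_schur ⟨hKm, M, hM, hK⟩ (by positivity) (fun ξ => ?_) fun η => ?_
  · exact hsup ξ _ (hKm.comp measurable_prodMk_left) (hK ξ) (habs ξ)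
  · exact hsup η _ (hKm.comp measurable_prodMk_right) (hK · η) fun ξ h => habs ξ η (by
      rwa [sip_comm ξ η])

end Pointwise

/-! ### Interpolated bounds -/

section Assembly

variable {n : ℕ}

lemma rpow_le_rpow_abs {K x : ℝ} (hK : 1 ≤ K) (h1 : 1 / K ≤ x) (h2 : x ≤ K) (e : ℝ) :
    x ^ e ≤ K ^ |e| := by
  have hx : 0 < x := lt_of_lt_of_le (by positivity) h1
  rcases le_total 0 e with he | he
  · rw [abs_of_nonneg he]
    exact Real.rpow_le_rpow hx.le h2 he
  · have h3 : x ^ e = x⁻¹ ^ (-e) := by rw [Real.inv_rpow hx.le, Real.rpow_neg hx.le, inv_inv]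
    rw [abs_of_nonpos he, h3]
    refine Real.rpow_le_rpow (by positivity) ?_ (by linarith)
    rw [inv_le_comm₀ hx (by positivity)]
    simpa using h1

/-- The interpolated bound and the claimed one differ by a power of `N^{1/μ} l`. -/
lemma rpow_exponents {N l μ θ : ℝ} (hN : 0 < N) (hl : 0 < l) (hμ : μ ≠ 0) (hn : 1 ≤ n) :
    N ^ (2 * n - 2) * (l ^ (2 * n - 1)) ^ (1 - θ) =
      (N ^ (1 / μ) * l) ^ (μ * (2 * n - 2) - (n - 1) * θ) *
        (N ^ (n / μ * θ - 1 / μ * θ) * l ^ (-(n * θ) + 2 * n - 1 - μ * (2 * n - 2))) := by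
  have e1 : N ^ (2 * n - 2) = N ^ (2 * (n : ℝ) - 2) := by
    rw [← Real.rpow_natCast, Nat.cast_sub (by omega)]; push_cast; rfl
  have e2 : l ^ (2 * n - 1) = l ^ (2 * (n : ℝ) - 1) := by
    rw [← Real.rpow_natCast, Nat.cast_sub (by omega)]; push_cast; rfl
  rw [e1, e2, Real.mul_rpow (by positivity) hl.le, ← Real.rpow_mul hN.le, ← Real.rpow_mul hl.le,
    mul_mul_mul_comm, ← Real.rpow_add hN, ← Real.rpow_add hl]
  congr 2
  · field_simp; ring
  · ring

variable {A B : ℕ → ℝ} {N : ℕ} {ψ χ : Cn n × Cn n → ℝ} {l s t : ℝ}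

lemma IsSphereBump.norm_le_one (h : IsSphereBump B l χ) (ξ η : Sph n) :
    ‖(χ ((ξ : Cn n), (η : Cn n)) : ℂ)‖ ≤ 1 := by
  rw [Complex.norm_real, Real.norm_of_nonneg (h.mem_Icc ξ η).1]
  exact (h.mem_Icc ξ η).2

lemma IsAnnularCutoff.toIsUpperCutoff (h : IsAnnularCutoff B l χ) : IsUpperCutoff B l χ :=
  ⟨h.toIsSphereBump, fun ξ η hlt => h.eq_zero ξ η (Or.inr hlt)⟩

lemma measurable_sphKernel (hψ : IsDiagCutoff A N ψ) (hN : 1 ≤ N) (hχ : IsSphereBump B l χ)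
    (hs : 0 < s) (ht : 0 < t) (j : Fin n) :
    Measurable (Function.uncurry fun ξ η => sphKernel N ψ χ s t ξ η j) := by
  have e : (Function.uncurry fun ξ η => sphKernel N ψ χ s t ξ η j) = fun p : Sph n × Sph n =>
      (χ ((p.1 : Cn n), (p.2 : Cn n)) : ℂ) * ((ψ (s • (p.1 : Cn n), t • (p.2 : Cn n)) : ℂ) *
        (formConst n * Function.uncurry (radKernel N (s / t) j) p)) := by
    funext p
    exact sphKernel_eq hψ hN χ hs ht p.1 p.2 j
  rw [e]
  exact (Complex.measurable_ofReal.comp hχ.measurable).mul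
    ((Complex.measurable_ofReal.comp (hψ.measurable s ht)).mul
      ((measurable_radKernel N (s / t) j).const_mul _))

/-- The bound when `l` is of order `N^{-1/μ}`: the size of the kernel and of its support suffice. -/
lemma exists_mapsLp_upper (hn : 2 ≤ n) (p p' q : ℝ≥0∞) (hp1 : 1 ≤ p) (hp2 : p ≤ 2)
    (hp' : p⁻¹ + p'⁻¹ = 1) (hq : p⁻¹ = p'⁻¹ + q⁻¹) (A B : ℕ → ℝ) {μ Λ : ℝ} (hμ : 1 ≤ μ)
    (hΛ : 1 ≤ Λ) : ∃ C : ℝ, 0 < C ∧ ∀ (N : ℕ), 1 ≤ N → ∀ ψ : Cn n × Cn n → ℝ,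
      IsDiagCutoff A N ψ → ∀ l : ℝ, 0 < l → l < 1 → 1 / 200 * (N : ℝ) ^ (-(1 / μ)) ≤ l →
      l ≤ Λ * (N : ℝ) ^ (-(1 / μ)) → ∀ χ : Cn n × Cn n → ℝ, IsUpperCutoff B l χ →
      ∀ s t : ℝ, 0 < s → 0 < t → MapsLp (sphKernel N ψ χ s t) p p'
        (C * (N : ℝ) ^ (n / μ * (q⁻¹).toReal - 1 / μ * (q⁻¹).toReal)
          * l ^ (-(n * (q⁻¹).toReal) + 2 * n - 1 - μ * (2 * n - 2))
          * (|1 - s / t| + l ^ μ)⁻¹) := by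
  obtain ⟨c, hc0, hc⟩ := exists_mapsLp (n := n) p p' q hp1 hp2 hp' hq
  obtain ⟨c₁, hc₁0, hc₁⟩ := exists_norm_radKernel_le hn
  obtain ⟨c₂, hc₂0, hc₂⟩ := exists_opBound_of_absSin_le (n := n) (by omega)
  set θ := (q⁻¹).toReal with hθ
  set a := (|A 0| + 1) * (‖formConst n‖ + 1) * c₁ with ha
  have ha0 : 0 < a := by positivity
  -- the exponent of `N^{1/μ} l`, which lies in the interval from `1 / 200` to `Λ`
  set e := μ * (2 * n - 2) - (n - 1) * θ with he
  refine ⟨c * a * Λ ^ μ * c₂ ^ (1 - θ) * (200 * Λ) ^ |e|, by positivity,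
    fun N hN ψ hψ l hl hl1 hNl hlN χ hχ s t hs ht => ?_⟩
  have hN0 : (0 : ℝ) < N := by exact_mod_cast hN
  set u := s / t with hu
  have hu0 : 0 < u := div_pos hs ht
  set D := (|1 - u| + 1 / (N : ℝ))⁻¹ with hD
  have hD0 : 0 < D := by positivity
  set M := a * (N : ℝ) ^ (2 * n - 2) * D with hM
  have hM0 : 0 < M := by positivity
  have hsup : ∀ ξ η j, ‖sphKernel N ψ χ s t ξ η j‖ ≤ M := by
    intro ξ η j
    rw [sphKernel_eq hψ hN χ hs ht, norm_mul]
    refine (mul_le_of_le_one_left (norm_nonneg _) (hχ.norm_le_one ξ η)).trans ?_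
    by_cases h : ψ (s • (ξ : Cn n), t • (η : Cn n)) = 0
    · rw [h]; simpa using hM0.le
    · have h1 := hc₁ N u j ξ η hN hu0 (hψ.le_quadR hN ht h)
      have h2 := hψ.abs_le s ht ξ η
      rw [norm_mul, norm_mul, Complex.norm_real, Real.norm_eq_abs]
      calc _ ≤ (|A 0| + 1) * ((‖formConst n‖ + 1) * (c₁ * (N : ℝ) ^ (2 * n - 2) * D)) := by
            gcongr
            · linarith
            · linarith
        _ = M := by rw [hM, ha]; ring
  have hop : ∀ j, OpBound (surf n) (fun ξ η => sphKernel N ψ χ s t ξ η j)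
      (M * (c₂ * l ^ (2 * n - 1))) := fun j =>
    hc₂ _ M l (measurable_sphKernel hψ hN hχ.toIsSphereBump hs ht j) hM0.le hl hl1.le
      (hsup · · j) fun ξ η h => by simp [sphKernel, hχ.eq_zero ξ η h]
  refine (hc _ M _ hM0 (by positivity) hsup hop).mono ?_
  have hDle : D ≤ Λ ^ μ * (|1 - u| + l ^ μ)⁻¹ := by
    have h1 : l ^ μ ≤ Λ ^ μ * (1 / N) := by
      calc l ^ μ ≤ (Λ * (N : ℝ) ^ (-(1 / μ))) ^ μ := Real.rpow_le_rpow hl.le hlN (by linarith)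
        _ = Λ ^ μ * (1 / N) := by
          rw [Real.mul_rpow (by positivity) (by positivity), ← Real.rpow_mul hN0.le]
          have : -(1 / μ) * μ = -1 := by field_simp
          rw [this, Real.rpow_neg_one, one_div]
    have h2 : 1 ≤ Λ ^ μ := Real.one_le_rpow hΛ (by linarith)
    have h3 : 0 < |1 - u| + l ^ μ := by positivity
    have h4 : 0 < |1 - u| + 1 / (N : ℝ) := by positivity
    rw [hD, ← div_eq_mul_inv, inv_eq_one_div, div_le_div_iff₀ h4 h3]
    nlinarith [abs_nonneg (1 - u)]
  have hx : ((N : ℝ) ^ (1 / μ) * l) ^ e ≤ (200 * Λ) ^ |e| := by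
    have h1 : (N : ℝ) ^ (-(1 / μ)) = ((N : ℝ) ^ (1 / μ))⁻¹ := Real.rpow_neg hN0.le _
    have h2 : 0 < (N : ℝ) ^ (1 / μ) := by positivity
    rw [h1, ← div_eq_mul_inv] at hNl hlN
    rw [le_div_iff₀ h2] at hlN
    rw [div_le_iff₀ h2] at hNl
    refine rpow_le_rpow_abs (by linarith) ?_ (by linarith) e
    rw [div_le_iff₀ (by positivity)]
    nlinarith
  have key := rpow_exponents (θ := θ) hN0 hl (by linarith : μ ≠ 0) (by omega : 1 ≤ n)
  rw [← he] at key
  have hMM : M ^ θ * (M * (c₂ * l ^ (2 * n - 1))) ^ (1 - θ) =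
      a * D * c₂ ^ (1 - θ) * ((N : ℝ) ^ (2 * n - 2) * (l ^ (2 * n - 1)) ^ (1 - θ)) := by
    rw [Real.mul_rpow hM0.le (by positivity), ← mul_assoc, ← Real.rpow_add hM0,
      Real.mul_rpow hc₂0.le (by positivity), add_sub_cancel, Real.rpow_one, hM]
    ring
  rw [hMM, key]
  set Y := (N : ℝ) ^ (n / μ * θ - 1 / μ * θ) * l ^ (-(n * θ) + 2 * n - 1 - μ * (2 * n - 2)) with hY
  have hY0 : 0 ≤ Y := by positivity
  calc _ ≤ c * (a * (Λ ^ μ * (|1 - u| + l ^ μ)⁻¹) * c₂ ^ (1 - θ) * ((200 * Λ) ^ |e| * Y)) := by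
        gcongr
    _ = _ := by rw [hY]; ring

/-- The bound when `N l` is large: the cutoff `ψ` is invisible, and the `L²` bound without loss is
interpolated with the pointwise bound. -/
lemma exists_mapsLp_annular_of_large (hn : 2 ≤ n) (p p' q : ℝ≥0∞) (hp1 : 1 ≤ p) (hp2 : p ≤ 2)
    (hp' : p⁻¹ + p'⁻¹ = 1) (hq : p⁻¹ = p'⁻¹ + q⁻¹) (A B : ℕ → ℝ) :
    ∃ C : ℝ, 0 < C ∧ ∀ (N : ℕ), 1 ≤ N → ∀ ψ : Cn n × Cn n → ℝ,
      IsDiagCutoff A N ψ → ∀ l : ℝ, 0 < l → l < 1 → 200 + 20 * n ≤ N * l →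
      ∀ χ : Cn n × Cn n → ℝ, IsAnnularCutoff B l χ →
      ∀ s t : ℝ, 0 < s → 0 < t → MapsLp (sphKernel N ψ χ s t) p p'
        (C * (N : ℝ) ^ (n * (q⁻¹).toReal - (q⁻¹).toReal)
          * l ^ (-(n * (q⁻¹).toReal)) * (|1 - s / t| + l)⁻¹) := by
  obtain ⟨c, hc0, hc⟩ := exists_mapsLp (n := n) p p' q hp1 hp2 hp' hq
  obtain ⟨c₁, hc₁0, hc₁⟩ := exists_norm_radKernel_le_of_le_absSin hn
  obtain ⟨c₂, hc₂0, hc₂⟩ := exists_opBound_annular hn B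
  set θ := (q⁻¹).toReal with hθ
  set a := ‖formConst n‖ + 1 with ha
  have ha0 : 0 < a := by positivity
  refine ⟨c * ((a * c₁) ^ θ * (a * c₂) ^ (1 - θ)), by positivity,
    fun N hN ψ hψ l hl hl1 hNl χ hχ s t hs ht => ?_⟩
  have hN0 : (0 : ℝ) < N := by exact_mod_cast hN
  set u := s / t with hu
  have hu0 : 0 < u := div_pos hs ht
  have hN2 : 2 ≤ N := by
    by_contra h
    have : N = 1 := by omega
    rw [this] at hNl
    have : (0 : ℝ) ≤ n := by positivity
    push_cast at hNl
    linarith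
  obtain ⟨k, rfl⟩ : ∃ k, N = k + 2 := ⟨N - 2, by omega⟩
  have hk : 100 + 10 * (n : ℝ) ≤ (k + 1) * l := by
    push_cast at hNl
    nlinarith [mul_nonneg (Nat.cast_nonneg (α := ℝ) k) hl.le]
  set D := (|1 - u| + l)⁻¹ with hD
  have hD0 : 0 < D := by positivity
  have heq : ∀ ξ η j, sphKernel (k + 2) ψ χ s t ξ η j =
      formConst n * ((χ ((ξ : Cn n), (η : Cn n)) : ℂ) * radKernel (k + 2) u j ξ η) := by
    intro ξ η j
    rw [sphKernel_eq hψ hN χ hs ht]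
    by_cases h : absSin (ξ : Cn n) (η : Cn n) < l / 100
    · simp [hχ.eq_zero ξ η (Or.inl h)]
    · have h1 : (1 / ((k + 2 : ℕ) : ℝ)) ^ 2 < quadR (sip ξ η) (s / t) := by
        refine lt_of_lt_of_le ?_ (one_sub_sq_le_quadR _ _)
        rw [← absSin_sq]
        refine pow_lt_pow_left₀ (lt_of_lt_of_le ?_ (not_lt.1 h)) (by positivity) two_ne_zero
        rw [div_lt_div_iff₀ hN0 (by norm_num)]
        have : (0 : ℝ) ≤ n := by positivity
        linarith
      rw [hψ.eq_one_of_lt_quadR ht h1]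
      push_cast
      ring
  set M := a * c₁ * (((k + 2 : ℕ) : ℝ) ^ (n - 1) * l⁻¹ ^ n * D) with hM
  have hM0 : 0 < M := by positivity
  have hsup : ∀ ξ η j, ‖sphKernel (k + 2) ψ χ s t ξ η j‖ ≤ M := by
    intro ξ η j
    rw [heq]
    by_cases h : absSin (ξ : Cn n) (η : Cn n) < l / 100
    · rw [hχ.eq_zero ξ η (Or.inl h)]; simpa using hM0.le
    · have h1 := hc₁ k u l j ξ η hu0 hl (by
        have : (0 : ℝ) ≤ n := by positivity
        linarith) (not_lt.1 h)
      rw [norm_mul, norm_mul, hM, mul_assoc]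
      have h2 := (mul_le_of_le_one_left (norm_nonneg (radKernel (k + 2) u j ξ η))
        (hχ.norm_le_one ξ η)).trans h1
      refine mul_le_mul (by linarith) h2 (by positivity) ha0.le
  have hop : ∀ j, OpBound (surf n) (fun ξ η => sphKernel (k + 2) ψ χ s t ξ η j) (a * c₂ * D) := by
    intro j
    have h1 := (hc₂ l u k χ j hl hl1 hu0 hχ (by linarith)).const_mul (formConst n)
    refine (h1.congr fun ξ η => (heq ξ η j).symm).mono ?_
    rw [mul_assoc]
    gcongr
    linarith
  refine (hc _ M _ hM0 (by positivity) hsup hop).mono (le_of_eq ?_)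
  have e1 : (((k + 2 : ℕ) : ℝ) ^ (n - 1)) ^ θ = ((k + 2 : ℕ) : ℝ) ^ (n * θ - θ) := by
    rw [← Real.rpow_natCast, ← Real.rpow_mul hN0.le, Nat.cast_sub (by omega)]
    congr 1; push_cast; ring
  have e2 : (l⁻¹ ^ n) ^ θ = l ^ (-(n * θ)) := by
    rw [← Real.rpow_natCast, ← Real.rpow_mul (by positivity), Real.inv_rpow hl.le,
      Real.rpow_neg hl.le]
  have e3 : D ^ θ * D ^ (1 - θ) = D := by
    rw [← Real.rpow_add hD0, add_sub_cancel, Real.rpow_one]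
  rw [hM, Real.mul_rpow (x := a * c₁) (by positivity) (by positivity),
    Real.mul_rpow (y := D) (by positivity) hD0.le,
    Real.mul_rpow (y := l⁻¹ ^ n) (by positivity) (by positivity), e1, e2,
    Real.mul_rpow (y := D) (by positivity) hD0.le]
  calc _ = c * ((a * c₁) ^ θ * (a * c₂) ^ (1 - θ)) * ((k + 2 : ℕ) : ℝ) ^ (n * θ - θ) *
        l ^ (-(n * θ)) * (D ^ θ * D ^ (1 - θ)) := by ring
    _ = _ := by rw [e3]

/-- If `N l` is bounded, the bound follows from the case `μ = 1` of `exists_mapsLp_upper`, where `l`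
has the larger exponent; otherwise `exists_mapsLp_annular_of_large` applies. -/
lemma exists_mapsLp_annular (hn : 2 ≤ n) (p p' q : ℝ≥0∞) (hp1 : 1 ≤ p) (hp2 : p ≤ 2)
    (hp' : p⁻¹ + p'⁻¹ = 1) (hq : p⁻¹ = p'⁻¹ + q⁻¹) (A B : ℕ → ℝ) :
    ∃ C : ℝ, 0 < C ∧ ∀ (N : ℕ), 1 ≤ N → ∀ ψ : Cn n × Cn n → ℝ,
      IsDiagCutoff A N ψ → ∀ l : ℝ, 0 < l → l < 1 → 1 / 200 * (N : ℝ)⁻¹ ≤ l →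
      ∀ χ : Cn n × Cn n → ℝ, IsAnnularCutoff B l χ →
      ∀ s t : ℝ, 0 < s → 0 < t → MapsLp (sphKernel N ψ χ s t) p p'
        (C * (N : ℝ) ^ (n * (q⁻¹).toReal - (q⁻¹).toReal)
          * l ^ (-(n * (q⁻¹).toReal)) * (|1 - s / t| + l)⁻¹) := by
  obtain ⟨C₁, hC₁0, hC₁⟩ := exists_mapsLp_annular_of_large hn p p' q hp1 hp2 hp' hq A B
  obtain ⟨C₂, hC₂0, hC₂⟩ := exists_mapsLp_upper hn p p' q hp1 hp2 hp' hq A B (μ := 1)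
    (Λ := 200 + 20 * n) le_rfl (by
      have : (0 : ℝ) ≤ n := by positivity
      linarith)
  refine ⟨C₁ + C₂, by positivity, fun N hN ψ hψ l hl hl1 hNl χ hχ s t hs ht => ?_⟩
  have hN0 : (0 : ℝ) < N := by exact_mod_cast hN
  rcases le_total (200 + 20 * (n : ℝ)) (N * l) with h | h
  · refine (hC₁ N hN ψ hψ l hl hl1 h χ hχ s t hs ht).mono ?_
    gcongr
    linarith
  · have e : (N : ℝ) ^ (-(1 / 1) : ℝ) = (N : ℝ)⁻¹ := by rw [div_one, Real.rpow_neg_one]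
    refine (hC₂ N hN ψ hψ l hl hl1 (by rwa [e]) (by
      rw [e, ← div_eq_mul_inv, le_div_iff₀ hN0]; linarith) χ hχ.toIsUpperCutoff s t hs ht).mono ?_
    rw [Real.rpow_one, div_one, div_one, one_mul, one_mul]
    have e2 : l ^ (-((n : ℝ) * (q⁻¹).toReal) + 2 * n - 1 - (2 * n - 2)) ≤
        l ^ (-((n : ℝ) * (q⁻¹).toReal)) :=
      Real.rpow_le_rpow_of_exponent_ge hl hl1.le (by linarith)
    have : C₂ ≤ C₁ + C₂ := by linarith
    gcongr

end Assembly

end BMKernel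

end

theorem mainTheorem3 (n : ℕ) (hn : 2 ≤ n) (d : ℝ) (hd : d = 2 * (n : ℝ))
    (p p' q : ℝ≥0∞) (hp1 : 1 ≤ p) (hp2 : p ≤ 2)
    (hp' : p⁻¹ + p'⁻¹ = 1) (hq : p⁻¹ = p'⁻¹ + q⁻¹)
    (A B : ℕ → ℝ) :
    (∀ μ : ℝ, 1 ≤ μ → ∃ C : ℝ, 0 < C ∧
      ∀ (N : ℕ), 1 ≤ N →
      ∀ ψ : BMKernel.Cn n × BMKernel.Cn n → ℝ, BMKernel.IsDiagCutoff A N ψ →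
      ∀ l : ℝ, 0 < l → l < 1 →
        1 / 200 * (N : ℝ) ^ (-(1 / μ)) ≤ l → l ≤ 200 * (N : ℝ) ^ (-(1 / μ)) →
      ∀ χ : BMKernel.Cn n × BMKernel.Cn n → ℝ, BMKernel.IsUpperCutoff B l χ →
      ∀ s t : ℝ, 0 < s → 0 < t →
        BMKernel.MapsLp (BMKernel.sphKernel N ψ χ s t) p p'
          (C * (N : ℝ) ^ (d / (2 * μ) * (q⁻¹).toReal - 1 / μ * (q⁻¹).toReal)
            * l ^ (-(d / 2 * (q⁻¹).toReal) + d - 1 - μ * (d - 2))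
            * (|1 - s / t| + l ^ μ)⁻¹)) ∧
    (∃ C : ℝ, 0 < C ∧
      ∀ (N : ℕ), 1 ≤ N →
      ∀ ψ : BMKernel.Cn n × BMKernel.Cn n → ℝ, BMKernel.IsDiagCutoff A N ψ →
      ∀ l : ℝ, 0 < l → l < 1 → 1 / 200 * (N : ℝ)⁻¹ ≤ l →
      ∀ χ : BMKernel.Cn n × BMKernel.Cn n → ℝ, BMKernel.IsAnnularCutoff B l χ →
      ∀ s t : ℝ, 0 < s → 0 < t →
        BMKernel.MapsLp (BMKernel.sphKernel N ψ χ s t) p p'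
          (C * (N : ℝ) ^ (d / 2 * (q⁻¹).toReal - (q⁻¹).toReal)
            * l ^ (-(d / 2 * (q⁻¹).toReal))
            * (|1 - s / t| + l)⁻¹)) := by
  subst hd
  have e1 : ∀ μ : ℝ, 2 * (n : ℝ) / (2 * μ) = n / μ := fun μ => by
    rw [mul_div_mul_left _ _ two_ne_zero]
  have e2 : 2 * (n : ℝ) / 2 = n := by ring
  simp only [e1, e2]
  exact ⟨fun μ hμ => BMKernel.exists_mapsLp_upper hn p p' q hp1 hp2 hp' hq A B hμ (by norm_num),
    BMKernel.exists_mapsLp_annular hn p p' q hp1 hp2 hp' hq A B⟩
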